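/- All vector spaces are over $\mathbb C$. Let $A=\mathbb C[t,t^{-1}]$ and let $W=\mathrm{Der}(A)$ be the Witt algebra, with basis $d_n=t^{n+1}\frac{d}{dt}$ ($n\in\mathbb Z$) and $[d_m,d_n]=(n-m)d_{m+n}$. Let $\mathfrak g=\mathfrak g_{\bar 0}\oplus\mathfrak g_{\bar 1}$ be a Lie superalgebra (of any dimension, possibly infinite) with an even derivation $d$ that is diagonalizable: $\mathfrak g$ has a basis $(x_s)_{s\in S}$ with $d(x_s)=\beta_s x_s$, $\beta_s\in\mathbb C$. Let $\mathfrak L=W\ltimes(\mathfrak g\otimes A)$ be the Lie superalgebra with $$[d_i,x_s\otimes t^k]=(k+i\beta_s)\,x_s\otimes t^{i+k},\qquad [x\otimes t^k,y\otimes t^j]=[x,y]\otimes t^{k+j}\qquad(x,y\in\mathfrak g),$$ and $\widetilde{\mathfrak L}=W\ltimes\big((\mathfrak g\otimes A)\oplus A\big)$ its extension by the abelian even ideal $A$, where $[d_i,t^k]=k\,t^{i+k}$ and $[\mathfrak g\otimes A,A]=0$. Let $\widehat{\mathfrak g}=\mathbb Cd\ltimes\mathfrak g$ with $[d,x]=d(x)$,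 and for $k\ge 0$ let $$\mathfrak a_k=(t-1)^{k+1}W\ltimes\big(\mathfrak g\otimes(t-1)^kA\big)\subset\mathfrak L .$$ Then $\mathfrak a_0=(t-1)W\ltimes(\mathfrak g\otimes A)$ is a subalgebra, and $d_n-d_0\mapsto n\,d$, $x\otimes t^n\mapsto x$ defines a surjective homomorphism $\mathfrak a_0\to\widehat{\mathfrak g}$ with kernel $\mathfrak a_1$. Modules are $\mathbb Z/2$-graded, morphisms are parity-preserving, and a module is simple if it is nonzero and has no proper nonzero graded submodule. A Jet $\mathfrak L$-module is an $\widetilde{\mathfrak L}$-module $V$ such that $A$ acts associatively and unitally ($t^i(t^jv)=t^{i+j}v$, $t^0v=v$), $d_0$ acts diagonalizably, and $V$ is free of finite rank over $A$. For $\lambda\in\mathbb C$ let $\mathscr J_\lambda$ be the category of Jet $\mathfrak L$-modules all of whose $d_0$-eigenvalues lie in $\lambda+\mathbb Z$ (the zero module included). For an $\mathfrak a_0$-module $\overline V$ let $\mathcal F_\lambda(\overline V)=A\otimes\overline V$ with $$t^i\cdot(t^j\otimes u)=t^{i+j}\otimes u,\qquad d_i\cdot(t^j\otimes u)=(\lambda+j)\,t^{i+j}\otimes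 u+t^{i+j}\otimes(d_i-d_0)u,$$ $$(x\otimes t^i)\cdot(t^j\otimes u)=t^{i+j}\otimes(x\otimes t^i)u\qquad(x\in\mathfrak g).$$ **Theorem.** Let $\lambda\in\mathbb C$. 1. $\overline V\mapsto\mathcal F_\lambda(\overline V)$ is an equivalence from the category of finite-dimensional $\mathfrak a_0$-modules to $\mathscr J_\lambda$. Assume in addition that $\beta_s\neq 1$ for all $s\in S$. 2. Every $V\in\mathscr J_\lambda$ is isomorphic to $\mathcal F_\lambda(\overline V)$ for some finite-dimensional $\mathfrak a_0$-module $\overline V$ that is annihilated by $\mathfrak a_k$ for some $k\ge 0$. 3. $\overline V\mapsto\mathcal F_\lambda(\overline V)$, where a $\widehat{\mathfrak g}$-module is regarded as an $\mathfrak a_0$-module through $\mathfrak a_0\to\widehat{\mathfrak g}$, is an equivalence from the category of simple finite-dimensional $\widehat{\mathfrak g}$-modules to the category of simple modules in $\mathscr J_\lambda$. -/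

import Mathlib

open CategoryTheory
open scoped TensorProduct
open LaurentPolynomial (T)

universe u v w

noncomputable section

/-! ### Lie superalgebras over `ℂ` and their modules -/

/-- The sign `(-1)^(|x||y|)` for homogeneous elements of parities `i`, `j`. -/
def superSign (i j : ZMod 2) : ℂ := if i = 1 ∧ j = 1 then -1 else 1

/-- A Lie superalgebra structure on the complex vector space `L`. -/
structure LieSuperalgebra (L : Type*) [AddCommGroup L] [Module ℂ L] where
  /-- The even part `part 0` and the odd part `part 1`. -/
  part : ZMod 2 → Submodule ℂ L
  isCompl : IsCompl (part 0) (part 1)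
  bracket : L →ₗ[ℂ] L →ₗ[ℂ] L
  bracket_mem : ∀ {i j : ZMod 2} {x y : L}, x ∈ part i → y ∈ part j → bracket x y ∈ part (i + j)
  bracket_skew : ∀ {i j : ZMod 2} {x y : L}, x ∈ part i → y ∈ part j →
    bracket x y = -(superSign i j • bracket y x)
  jacobi : ∀ {i j : ZMod 2} {x y : L}, x ∈ part i → y ∈ part j → ∀ z : L,
    bracket x (bracket y z) =
      bracket (bracket x y) z + superSign i j • bracket y (bracket x z)

namespace LieSuperalgebra

variable {L : Type v} [AddCommGroup L] [Module ℂ L] {L' : Type w} [AddCommGroup L'] [Module ℂ L']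

/-- An even homomorphism of Lie superalgebras. -/
structure Hom (g : LieSuperalgebra L) (h : LieSuperalgebra L') where
  toLin : L →ₗ[ℂ] L'
  map_mem : ∀ {i : ZMod 2} {x : L}, x ∈ g.part i → toLin x ∈ h.part i
  map_bracket : ∀ x y : L, toLin (g.bracket x y) = h.bracket (toLin x) (toLin y)

/-- An even derivation of a Lie superalgebra. -/
structure EvenDerivation (g : LieSuperalgebra L) where
  toLin : L →ₗ[ℂ] L
  map_mem : ∀ {i : ZMod 2} {x : L}, x ∈ g.part i → toLin x ∈ g.part i
  leibniz : ∀ x y : L,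
    toLin (g.bracket x y) = g.bracket (toLin x) y + g.bracket x (toLin y)

/-- A graded subspace closed under the bracket is a Lie superalgebra. -/
def sub (g : LieSuperalgebra L) (H : Submodule ℂ L)
    (graded : H ≤ (H ⊓ g.part 0) ⊔ (H ⊓ g.part 1))
    (closed : ∀ x ∈ H, ∀ y ∈ H, g.bracket x y ∈ H) : LieSuperalgebra H where
  part i := (g.part i).comap H.subtype
  isCompl := by
    constructor
    · rw [disjoint_iff, ← Submodule.comap_inf, g.isCompl.inf_eq_bot]
      simp
    · rw [codisjoint_iff, eq_top_iff]
      rintro ⟨x, hx⟩ -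
      obtain ⟨y, hy, z, hz, rfl⟩ := Submodule.mem_sup.1 (graded hx)
      exact Submodule.mem_sup.2 ⟨⟨y, hy.1⟩, hy.2, ⟨z, hz.1⟩, hz.2, rfl⟩
  bracket := LinearMap.mk₂ ℂ (fun x y => ⟨g.bracket x y, closed x x.2 y y.2⟩)
    (fun _ _ _ => by ext; simp) (fun _ _ _ => by ext; simp)
    (fun _ _ _ => by ext; simp) (fun _ _ _ => by ext; simp)
  bracket_mem hx hy := g.bracket_mem hx hy
  bracket_skew hx hy := Subtype.ext (g.bracket_skew hx hy)
  jacobi hx hy z := Subtype.ext (g.jacobi hx hy z)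

/-- An action of the (purely even) Lie algebra `M` on a Lie superalgebra by even derivations. -/
structure EvenAction (M : Type*) [LieRing M] [LieAlgebra ℂ M] (g : LieSuperalgebra L) where
  toLin : M →ₗ[ℂ] L →ₗ[ℂ] L
  map_mem : ∀ (m : M) {i : ZMod 2} {x : L}, x ∈ g.part i → toLin m x ∈ g.part i
  leibniz : ∀ (m : M) (x y : L),
    toLin m (g.bracket x y) = g.bracket (toLin m x) y + g.bracket x (toLin m y)
  map_lie : ∀ (m m' : M) (x : L),
    toLin ⁅m, m'⁆ x = toLin m (toLin m' x) - toLin m' (toLin m x)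

lemma zmod2_cases (i : ZMod 2) : i = 0 ∨ i = 1 := by
  revert i; decide

@[simp] lemma superSign_zero_left (j : ZMod 2) : superSign 0 j = 1 := by simp [superSign]

@[simp] lemma superSign_zero_right (j : ZMod 2) : superSign j 0 = 1 := by simp [superSign]

@[simp] lemma superSign_one_one : superSign 1 1 = -1 := by simp [superSign]

/-- The semidirect product `M ⋉ g`, with bracket
`[(m, x), (m', x')] = ([m, m'], m · x' - m' · x + [x, x'])`. -/
def semidirect {M : Type*} [LieRing M] [LieAlgebra ℂ M] (g : LieSuperalgebra L)
    (ρ : EvenAction M g) : LieSuperalgebra (M × L) where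
  part i := (if i = 0 then ⊤ else ⊥ : Submodule ℂ M).prod (g.part i)
  isCompl := by
    constructor
    · rw [disjoint_iff, Submodule.prod_inf_prod, g.isCompl.inf_eq_bot]
      simp
    · rw [codisjoint_iff, Submodule.prod_sup_prod, g.isCompl.sup_eq_top]
      simp
  bracket := LinearMap.mk₂ ℂ
    (fun a b => (⁅a.1, b.1⁆, ρ.toLin a.1 b.2 - ρ.toLin b.1 a.2 + g.bracket a.2 b.2))
    (fun a b c => by ext <;> simp; abel)
    (fun c a b => by ext <;> simp [smul_sub])
    (fun a b c => by ext <;> simp; abel)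
    (fun c a b => by ext <;> simp [smul_sub])
  bracket_mem := by
    rintro i j ⟨m, x⟩ ⟨m', x'⟩ ⟨hm, hx⟩ ⟨hm', hx'⟩
    have h := g.bracket_mem hx hx'
    have h1 := ρ.map_mem m hx'
    have h2 := ρ.map_mem m' hx
    rcases zmod2_cases i with rfl | rfl <;> rcases zmod2_cases j with rfl | rfl <;>
      simp_all [Submodule.mem_prod, LinearMap.mk₂_apply]
    · exact add_mem (sub_mem h1 h2) h
    · exact add_mem h1 h
    · exact add_mem (neg_mem h2) h
  bracket_skew := by
    rintro i j ⟨m, x⟩ ⟨m', x'⟩ ⟨hm, hx⟩ ⟨hm', hx'⟩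
    have h := g.bracket_skew hx hx'
    have hs := lie_skew m m'
    rcases zmod2_cases i with rfl | rfl <;> rcases zmod2_cases j with rfl | rfl <;>
      simp_all [LinearMap.mk₂_apply] <;> abel
  jacobi := by
    rintro i j ⟨m, x⟩ ⟨m', x'⟩ ⟨hm, hx⟩ ⟨hm', hx'⟩ ⟨m'', x''⟩
    have h := g.jacobi hx hx' x''
    have hk := g.bracket_skew hx' (ρ.map_mem m'' hx)
    have hs := leibniz_lie m m' m''
    have e1 := ρ.leibniz m x' x''
    have e2 := ρ.leibniz m' x x''
    have e3 := ρ.leibniz m'' x x'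
    have f1 := ρ.map_lie m m' x''
    have f2 := ρ.map_lie m m'' x'
    have f3 := ρ.map_lie m' m'' x
    rcases zmod2_cases i with rfl | rfl <;> rcases zmod2_cases j with rfl | rfl <;>
      simp_all [LinearMap.mk₂_apply] <;> abel

end LieSuperalgebra

/-- A (super)module over the Lie superalgebra `g`. -/
structure SuperMod {L : Type v} [AddCommGroup L] [Module ℂ L] (g : LieSuperalgebra L) where
  carrier : Type u
  [addCommGroup : AddCommGroup carrier]
  [module : Module ℂ carrier]
  /-- The even part `part 0` and the odd part `part 1`. -/
  part : ZMod 2 → Submodule ℂ carrier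
  isCompl : IsCompl (part 0) (part 1)
  act : L →ₗ[ℂ] carrier →ₗ[ℂ] carrier
  act_mem : ∀ {i j : ZMod 2} {x : L} {a : carrier}, x ∈ g.part i → a ∈ part j →
    act x a ∈ part (i + j)
  act_bracket : ∀ {i j : ZMod 2} {x y : L}, x ∈ g.part i → y ∈ g.part j → ∀ a : carrier,
    act (g.bracket x y) a = act x (act y a) - superSign i j • act y (act x a)

attribute [instance] SuperMod.addCommGroup SuperMod.module

namespace SuperMod

variable {L : Type v} [AddCommGroup L] [Module ℂ L] {g : LieSuperalgebra L}
  {L' : Type w} [AddCommGroup L'] [Module ℂ L'] {h : LieSuperalgebra L'}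

/-- Morphisms of modules: parity preserving linear maps commuting with the action. -/
@[ext]
structure Hom (V V' : SuperMod.{u} g) where
  toLin : V.carrier →ₗ[ℂ] V'.carrier
  map_mem : ∀ {i : ZMod 2} {a : V.carrier}, a ∈ V.part i → toLin a ∈ V'.part i
  map_act : ∀ (x : L) (a : V.carrier), toLin (V.act x a) = V'.act x (toLin a)

instance : Category (SuperMod.{u} g) where
  Hom := Hom
  id V := ⟨LinearMap.id, fun ha => ha, fun _ _ => rfl⟩
  comp f f' := ⟨f'.toLin ∘ₗ f.toLin, fun ha => f'.map_mem (f.map_mem ha), fun x a => by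
    simp [f.map_act, f'.map_act]⟩

/-- The underlying linear map of a morphism. -/
def toLin {V V' : SuperMod.{u} g} (f : V ⟶ V') : V.carrier →ₗ[ℂ] V'.carrier := Hom.toLin f

/-- A submodule: a graded subspace stable under the action. -/
structure IsSubmodule (V : SuperMod.{u} g) (N : Submodule ℂ V.carrier) : Prop where
  graded : N ≤ (N ⊓ V.part 0) ⊔ (N ⊓ V.part 1)
  stable : ∀ (x : L), ∀ a ∈ N, V.act x a ∈ N

/-- A simple module: nonzero, with no submodules other than zero and itself. -/
def IsSimple (V : SuperMod.{u} g) : Prop :=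
  Nontrivial V.carrier ∧ ∀ N : Submodule ℂ V.carrier, V.IsSubmodule N → N = ⊥ ∨ N = ⊤

/-- Pull back of modules along a homomorphism of Lie superalgebras. -/
@[simps obj_carrier obj_part obj_act]
def restrict (f : LieSuperalgebra.Hom g h) : SuperMod.{u} h ⥤ SuperMod.{u} g where
  obj V :=
    { carrier := V.carrier
      part := V.part
      isCompl := V.isCompl
      act := V.act ∘ₗ f.toLin
      act_mem := fun hx ha => V.act_mem (f.map_mem hx) ha
      act_bracket := fun hx hy a => by
        simpa [f.map_bracket] using V.act_bracket (f.map_mem hx) (f.map_mem hy) a }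
  map {V V'} φ := ⟨Hom.toLin (V := V) (V' := V') φ, fun ha => Hom.map_mem (V := V) (V' := V') φ ha,
    fun x a => Hom.map_act (V := V) (V' := V') φ (f.toLin x) a⟩

variable (g) in
/-- Finite dimensional modules. -/
def finDim : ObjectProperty (SuperMod.{u} g) := fun V => FiniteDimensional ℂ V.carrier

variable (g) in
/-- Simple finite dimensional modules. -/
def simpleFinDim : ObjectProperty (SuperMod.{u} g) :=
  fun V => FiniteDimensional ℂ V.carrier ∧ V.IsSimple

end SuperMod

/-! ### The Witt algebra -/

/-- The algebra `A = ℂ[t, t⁻¹]`. -/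
abbrev Laur : Type := LaurentPolynomial ℂ

namespace Laur

/-- The linear map on `A` with prescribed values on the basis `tⁿ`. -/
def lift {N : Type*} [AddCommMonoid N] [Module ℂ N] (φ : ℤ → N) : Laur →ₗ[ℂ] N :=
  Finsupp.linearCombination ℂ φ ∘ₗ (AddMonoidAlgebra.coeffLinearEquiv ℂ).toLinearMap

@[simp] lemma lift_T {N : Type*} [AddCommMonoid N] [Module ℂ N] (φ : ℤ → N) (n : ℤ) :
    lift φ (T n) = φ n := by
  change Finsupp.linearCombination ℂ φ (Finsupp.single n 1) = φ n
  simp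

lemma hom_ext {N : Type*} [AddCommMonoid N] [Module ℂ N] {f f' : Laur →ₗ[ℂ] N}
    (H : ∀ n : ℤ, f (T n) = f' (T n)) : f = f' := by
  refine AddMonoidAlgebra.lhom_ext' fun n => ?_
  exact LinearMap.ext_ring (H n)

/-- Evaluation at `t = 1`. -/
def evalOne : Laur →ₐ[ℂ] ℂ :=
  { LaurentPolynomial.eval₂ (RingHom.id ℂ) 1 with
    commutes' := fun r => by
      change LaurentPolynomial.eval₂ (RingHom.id ℂ) 1 (algebraMap ℂ Laur r) = r
      rw [← LaurentPolynomial.C_eq_algebraMap]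
      simp }

@[simp] lemma evalOne_T (n : ℤ) : evalOne (T n) = 1 := by
  change LaurentPolynomial.eval₂ (RingHom.id ℂ) 1 (T n) = 1
  simp

end Laur

/-- The Witt algebra `W = Der ℂ[t, t⁻¹]`. -/
abbrev Witt : Type := Derivation ℂ Laur Laur

namespace Witt

/-- The Euler derivation `d₀ = t d/dt`. -/
def euler : Witt :=
  Derivation.mk' (Laur.lift fun n => (n : ℂ) • (T n : Laur)) (by
    intro a b
    have key : (LinearMap.mul ℂ Laur).compr₂ (Laur.lift fun n => (n : ℂ) • (T n : Laur)) =
        (LinearMap.mul ℂ Laur).compl₂ (Laur.lift fun n => (n : ℂ) • (T n : Laur)) +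
        (LinearMap.mul ℂ Laur) ∘ₗ (Laur.lift fun n => (n : ℂ) • (T n : Laur)) := by
      refine Laur.hom_ext fun m => Laur.hom_ext fun n => ?_
      simp only [LinearMap.compr₂_apply, LinearMap.mul_apply', LinearMap.add_apply,
        LinearMap.compl₂_apply, LinearMap.comp_apply, ← LaurentPolynomial.T_add, Laur.lift_T,
        mul_smul_comm, smul_mul_assoc]
      push_cast
      module
    have := LinearMap.congr_fun₂ key a b
    simpa [mul_comm] using this)

@[simp] lemma euler_T (n : ℤ) : euler (T n) = (n : ℂ) • (T n : Laur) := by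
  simp [euler]

/-- The basis element `d_n = tⁿ⁺¹ d/dt` of the Witt algebra. -/
def d (n : ℤ) : Witt := (T n : Laur) • euler

lemma d_apply_T (n k : ℤ) : d n (T k) = (k : ℂ) • (T (k + n) : Laur) := by
  rw [d, Derivation.smul_apply, euler_T, smul_eq_mul, mul_smul_comm, ← LaurentPolynomial.T_add,
    add_comm]

/-- The coefficient `f` in `D = f · t d/dt`. -/
def symb : Witt →ₗ[ℂ] Laur :=
  { toFun := fun D => T (-1) * D (T 1)
    map_add' := fun _ _ => by simp [mul_add]
    map_smul' := fun _ _ => by simp }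

@[simp] lemma symb_smul_euler (f : Laur) : symb (f • euler) = f := by
  have : (T (-1) * T 1 : Laur) = 1 := by rw [← LaurentPolynomial.T_add]; simp
  simp only [symb, LinearMap.coe_mk, AddHom.coe_mk, Derivation.smul_apply, euler_T, smul_eq_mul]
  rw [mul_left_comm]
  simp [this]

@[simp] lemma symb_d (n : ℤ) : symb (d n) = T n := symb_smul_euler _

lemma ext_T_one {D D' : Witt} (H : D (T 1) = D' (T 1)) : D = D' := by
  have hinv : (T 1 * T (-1) : Laur) = 1 := by rw [← LaurentPolynomial.T_add]; simp
  have hneg : D (T (-1)) = D' (T (-1)) := by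
    have e : D (T 1 * T (-1)) = D' (T 1 * T (-1)) := by rw [hinv]; simp
    rw [Derivation.leibniz, Derivation.leibniz, H] at e
    have e' := congrArg (fun z => T (-1) * z) (add_right_cancel e)
    simpa only [smul_eq_mul, ← mul_assoc, mul_comm (T (-1)) (T 1 : Laur), hinv, one_mul] using e'
  have hnat : ∀ n : ℕ, D (T n) = D' (T n) ∧ D (T (-n)) = D' (T (-n)) := by
    intro n
    induction n with
    | zero => simp
    | succ n ih =>
      constructor
      · push_cast
        rw [LaurentPolynomial.T_add, Derivation.leibniz, Derivation.leibniz, H, ih.1]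
      · push_cast
        rw [neg_add, LaurentPolynomial.T_add, Derivation.leibniz, Derivation.leibniz, hneg, ih.2]
  have : (D : Laur →ₗ[ℂ] Laur) = (D' : Laur →ₗ[ℂ] Laur) := by
    refine Laur.hom_ext fun n => ?_
    obtain ⟨m, rfl | rfl⟩ := n.eq_nat_or_neg
    · exact (hnat m).1
    · exact (hnat m).2
  ext1 a
  exact LinearMap.congr_fun this a

lemma symb_smul (D : Witt) : symb D • euler = D := by
  refine ext_T_one ?_
  have : (T (-1) * T 1 : Laur) = 1 := by rw [← LaurentPolynomial.T_add]; simp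
  simp only [symb, LinearMap.coe_mk, AddHom.coe_mk, Derivation.smul_apply, euler_T, smul_eq_mul]
  simp [mul_right_comm]

lemma apply_eq (D : Witt) (a : Laur) : D a = symb D * euler a := by
  conv_lhs => rw [← symb_smul D]
  simp

/-- For `D = f · t d/dt` this is `t f'`. -/
def dsymb : Witt →ₗ[ℂ] Laur := (euler : Laur →ₗ[ℂ] Laur) ∘ₗ symb

lemma dsymb_apply (D : Witt) : dsymb D = euler (symb D) := rfl

lemma symb_lie (D D' : Witt) : symb ⁅D, D'⁆ = D (symb D') - D' (symb D) := by
  rw [← symb_smul_euler (D (symb D') - D' (symb D))]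
  congr 1
  ext1 a
  rw [Derivation.commutator_apply, Derivation.smul_apply]
  simp only [apply_eq D, apply_eq D', Derivation.leibniz, smul_eq_mul]
  ring

lemma dsymb_lie (D D' : Witt) : dsymb ⁅D, D'⁆ = D (dsymb D') - D' (dsymb D) := by
  simp only [dsymb_apply, symb_lie, apply_eq D, apply_eq D', Derivation.leibniz, smul_eq_mul,
    map_sub]
  ring

lemma lie_d (m n : ℤ) : ⁅d m, d n⁆ = ((n : ℂ) - m) • d (m + n) := by
  rw [← symb_smul ⁅d m, d n⁆, symb_lie, ← symb_smul (((n : ℂ) - m) • d (m + n))]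
  simp [d_apply_T, sub_smul, add_comm]

lemma hom_ext {N : Type*} [AddCommMonoid N] [Module ℂ N] {f f' : Witt →ₗ[ℂ] N}
    (H : ∀ n : ℤ, f (d n) = f' (d n)) : f = f' := by
  let s : Laur →ₗ[ℂ] Witt :=
    { toFun := fun a => a • euler
      map_add' := fun _ _ => add_smul _ _ _
      map_smul' := fun _ _ => by simp [smul_assoc] }
  have : f ∘ₗ s = f' ∘ₗ s := Laur.hom_ext H
  ext D
  have h := LinearMap.congr_fun this (symb D)
  simpa [s, symb_smul] using h

end Witt

/-! ### The Lie superalgebras `𝔏`, `𝔏̃`, `𝔞ₖ` and `ĝ` -/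

namespace LieSuperalgebra

section Tensor

variable {E F : Type*} [AddCommGroup E] [Module ℂ E] [AddCommGroup F] [Module ℂ F]

lemma isCompl_rTensor {p q : Submodule ℂ E} (h : IsCompl p q) :
    IsCompl (LinearMap.range (LinearMap.rTensor F p.subtype))
      (LinearMap.range (LinearMap.rTensor F q.subtype)) := by
  constructor
  · rw [Submodule.disjoint_def]
    rintro _ ⟨a, rfl⟩ ⟨b, hb⟩
    have h1 : LinearMap.rTensor F (p.projectionOnto q h) (LinearMap.rTensor F p.subtype a) = a := by
      rw [← LinearMap.comp_apply, ← LinearMap.rTensor_comp]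
      have : p.projectionOnto q h ∘ₗ p.subtype = LinearMap.id := by ext x; simp
      simp [this]
    have h2 : LinearMap.rTensor F (p.projectionOnto q h) (LinearMap.rTensor F q.subtype b) = 0 := by
      rw [← LinearMap.comp_apply, ← LinearMap.rTensor_comp]
      have : p.projectionOnto q h ∘ₗ q.subtype = 0 := by ext x; simp
      simp [this]
    rw [hb, h1] at h2
    simp [h2]
  · rw [codisjoint_iff, eq_top_iff]
    rintro a -
    induction a with
    | zero => exact zero_mem _
    | add a b ha hb => exact add_mem ha hb
    | tmul x f =>
      obtain ⟨y, hy, z, hz, rfl⟩ :=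
        Submodule.mem_sup.1 (h.sup_eq_top ▸ Submodule.mem_top : x ∈ p ⊔ q)
      rw [TensorProduct.add_tmul]
      exact Submodule.add_mem_sup ⟨(⟨y, hy⟩ : p) ⊗ₜ f, rfl⟩ ⟨(⟨z, hz⟩ : q) ⊗ₜ f, rfl⟩

lemma range_rTensor_induction {p : Submodule ℂ E}
    {motive : ∀ a : E ⊗[ℂ] F, a ∈ LinearMap.range (LinearMap.rTensor F p.subtype) → Prop}
    (zero : motive 0 (zero_mem _))
    (add : ∀ a b ha hb, motive a ha → motive b hb → motive (a + b) (add_mem ha hb))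
    (tmul : ∀ x (hx : x ∈ p) f, motive (x ⊗ₜ f) ⟨(⟨x, hx⟩ : p) ⊗ₜ f, rfl⟩) {a : E ⊗[ℂ] F}
    (ha : a ∈ LinearMap.range (LinearMap.rTensor F p.subtype)) : motive a ha := by
  obtain ⟨b, rfl⟩ := ha
  induction b with
  | zero => convert zero; simp
  | add a b ha hb => convert add _ _ _ _ ha hb; simp
  | tmul x f => exact tmul x x.2 f

end Tensor

variable {L : Type v} [AddCommGroup L] [Module ℂ L] (g : LieSuperalgebra L)

/-- The loop superalgebra `g ⊗ A`, with `[x ⊗ a, y ⊗ b] = [x, y] ⊗ ab`. -/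
def loop : LieSuperalgebra (L ⊗[ℂ] Laur) where
  part i := LinearMap.range (LinearMap.rTensor Laur (g.part i).subtype)
  isCompl := isCompl_rTensor g.isCompl
  bracket := TensorProduct.map₂ g.bracket (LinearMap.mul ℂ Laur)
  bracket_mem := by
    intro i j x y hx hy
    induction hx using range_rTensor_induction with
    | zero => simp
    | add a b _ _ ha hb => rw [map_add, LinearMap.add_apply]; exact add_mem ha hb
    | tmul x hx a =>
      induction hy using range_rTensor_induction with
      | zero => simp
      | add a b _ _ ha hb => rw [map_add]; exact add_mem ha hb
      | tmul y hy b => exact ⟨(⟨_, g.bracket_mem hx hy⟩ : g.part (i + j)) ⊗ₜ (a * b), by simp⟩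
  bracket_skew := by
    intro i j x y hx hy
    induction hx using range_rTensor_induction with
    | zero => simp
    | add a b _ _ ha hb => simp only [map_add, LinearMap.add_apply, ha, hb]; module
    | tmul x hx a =>
      induction hy using range_rTensor_induction with
      | zero => simp
      | add a b _ _ ha hb => simp only [map_add, LinearMap.add_apply, ha, hb]; module
      | tmul y hy b =>
        simp only [TensorProduct.map₂_apply_tmul, TensorProduct.map_tmul, LinearMap.mul_apply',
          g.bracket_skew hx hy,
          mul_comm a b, TensorProduct.neg_tmul, TensorProduct.smul_tmul']
  jacobi := by
    intro i j x y hx hy z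
    induction hx using range_rTensor_induction with
    | zero => simp
    | add a b _ _ ha hb => simp only [map_add, LinearMap.add_apply, ha, hb]; module
    | tmul x hx a =>
      induction hy using range_rTensor_induction with
      | zero => simp
      | add a b _ _ ha hb => simp only [map_add, LinearMap.add_apply, ha, hb]; module
      | tmul y hy b =>
        induction z with
        | zero => simp
        | add a b ha hb => simp only [map_add, ha, hb]; module
        | tmul z c =>
          simp only [TensorProduct.map₂_apply_tmul, TensorProduct.map_tmul, LinearMap.mul_apply',
            g.jacobi hx hy z,
            TensorProduct.add_tmul, TensorProduct.smul_tmul', mul_assoc, mul_left_comm a b c]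

/-- The product of `g` with the abelian, purely even Lie algebra `A`. -/
def prodLaur : LieSuperalgebra (L × Laur) where
  part i := (g.part i).prod (if i = 0 then ⊤ else ⊥)
  isCompl := by
    constructor
    · rw [disjoint_iff, Submodule.prod_inf_prod, g.isCompl.inf_eq_bot]
      simp
    · rw [codisjoint_iff, Submodule.prod_sup_prod, g.isCompl.sup_eq_top]
      simp
  bracket := LinearMap.mk₂ ℂ (fun x y => (g.bracket x.1 y.1, 0))
    (fun _ _ _ => by ext <;> simp) (fun _ _ _ => by ext <;> simp)
    (fun _ _ _ => by ext <;> simp) (fun _ _ _ => by ext <;> simp)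
  bracket_mem hx hy := ⟨g.bracket_mem hx.1 hy.1, zero_mem _⟩
  bracket_skew hx hy := by
    ext1
    · exact g.bracket_skew hx.1 hy.1
    · simp
  jacobi hx hy z := by
    ext1
    · exact g.jacobi hx.1 hy.1 z.1
    · simp

variable {g} (d : EvenDerivation g)

namespace EvenDerivation

section

attribute [local instance] LieRing.ofAssociativeRing

/-- The one-dimensional Lie algebra `ℂ d` acts on `g` by multiples of the derivation `d`. -/
def lineAction : EvenAction ℂ g where
  toLin := LinearMap.toSpanSingleton ℂ _ d.toLin
  map_mem c _ _ hx := Submodule.smul_mem _ _ (d.map_mem hx)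
  leibniz c x y := by simp [d.leibniz, smul_add]
  map_lie c c' x := by
    simp only [LieRing.of_associative_ring_bracket, LinearMap.toSpanSingleton_apply,
      LinearMap.smul_apply, map_smul, smul_smul]
    rw [mul_comm c' c]
    simp

/-- The Lie superalgebra `ĝ = ℂ d + g` with `[d, x] = d(x)`; the element `c d + x` is `(c, x)`. -/
def hat : LieSuperalgebra (ℂ × L) := g.semidirect d.lineAction

end

/-- The Witt algebra acts on `g ⊗ A` by `d_i · (x ⊗ tᵏ) = k x ⊗ tⁱ⁺ᵏ + i d(x) ⊗ tⁱ⁺ᵏ`, that is,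
`(f d₀) · (x ⊗ a) = x ⊗ f d₀(a) + d(x) ⊗ d₀(f) a`. -/
def wittLin : Witt →ₗ[ℂ] L ⊗[ℂ] Laur →ₗ[ℂ] L ⊗[ℂ] Laur :=
  { toFun := fun D => LinearMap.lTensor L (D : Laur →ₗ[ℂ] Laur) +
      TensorProduct.map d.toLin (LinearMap.mulLeft ℂ (Witt.dsymb D))
    map_add' := fun D D' => by
      ext x a
      simp [add_mul, TensorProduct.tmul_add]
      abel
    map_smul' := fun c D => by
      ext x a
      simp [TensorProduct.tmul_smul] }

@[simp] lemma wittLin_tmul (D : Witt) (x : L) (a : Laur) :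
    d.wittLin D (x ⊗ₜ a) = x ⊗ₜ D a + d.toLin x ⊗ₜ (Witt.dsymb D * a) := by
  simp [wittLin]

def wittAction : EvenAction Witt g.loop where
  toLin := d.wittLin
  map_mem D i x hx := by
    induction hx using range_rTensor_induction with
    | zero => simp
    | add a b _ _ ha hb => rw [map_add]; exact add_mem ha hb
    | tmul x hx a =>
      rw [wittLin_tmul]
      exact add_mem ⟨(⟨x, hx⟩ : g.part i) ⊗ₜ D a, rfl⟩
        ⟨(⟨_, d.map_mem hx⟩ : g.part i) ⊗ₜ (Witt.dsymb D * a), rfl⟩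
  leibniz D x y := by
    induction x with
    | zero => simp
    | add a b ha hb => simp only [map_add, LinearMap.add_apply, ha, hb]; abel
    | tmul x a =>
      induction y with
      | zero => simp
      | add a b ha hb => simp only [map_add, ha, hb]; abel
      | tmul y b =>
        simp only [loop, TensorProduct.map₂_apply_tmul, wittLin_tmul, map_add,
          LinearMap.add_apply, TensorProduct.map_tmul, LinearMap.mul_apply', d.leibniz,
          Derivation.leibniz, smul_eq_mul, TensorProduct.add_tmul, TensorProduct.tmul_add]
        rw [mul_comm b (D a), mul_assoc, mul_left_comm a]
        abel
  map_lie D D' x := by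
    induction x with
    | zero => simp
    | add a b ha hb => simp only [map_add, ha, hb]; abel
    | tmul x a =>
      simp only [wittLin_tmul, map_add, Derivation.commutator_apply, Witt.dsymb_lie,
        Derivation.leibniz, smul_eq_mul, TensorProduct.tmul_add, TensorProduct.tmul_sub, sub_mul]
      rw [mul_comm a (D (Witt.dsymb D')), mul_comm a (D' (Witt.dsymb D)),
        mul_left_comm (Witt.dsymb D) (Witt.dsymb D') a]
      abel

/-- The Lie superalgebra `𝔏 = W ⋉ (g ⊗ A)`. -/
def affine : LieSuperalgebra (Witt × (L ⊗[ℂ] Laur)) := g.loop.semidirect d.wittAction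

def wittActionExt : EvenAction Witt g.loop.prodLaur where
  toLin :=
    { toFun := fun D => (d.wittLin D).prodMap (D : Laur →ₗ[ℂ] Laur)
      map_add' := fun D D' => by
        refine LinearMap.ext fun x => ?_
        ext1 <;> simp
      map_smul' := fun c D => by
        refine LinearMap.ext fun x => ?_
        ext1 <;> simp }
  map_mem D i x hx := by
    refine ⟨d.wittAction.map_mem D hx.1, ?_⟩
    have h := hx.2
    rcases zmod2_cases i with rfl | rfl <;> simp_all
  leibniz D x y := by
    ext1
    · exact d.wittAction.leibniz D x.1 y.1
    · simp [prodLaur]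
  map_lie D D' x := by
    ext1
    · exact d.wittAction.map_lie D D' x.1
    · exact Derivation.commutator_apply (D1 := D) (D2 := D') (a := x.2)

/-- The Lie superalgebra `𝔏̃ = W ⋉ ((g ⊗ A) ⊕ A)`; here `[D, a] = D(a)` for `D ∈ W` and `a ∈ A`,
and `A` is abelian and commutes with `g ⊗ A`. -/
def affineExt : LieSuperalgebra (Witt × ((L ⊗[ℂ] Laur) × Laur)) :=
  g.loop.prodLaur.semidirect d.wittActionExt

lemma affine_bracket_d (i j : ℤ) :
    d.affine.bracket (Witt.d i, 0) (Witt.d j, 0) = (((j : ℂ) - i) • Witt.d (i + j), 0) := by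
  simp [affine, semidirect, Witt.lie_d]

/-- If `d(x) = β x` then `[d_i, x ⊗ tᵏ] = (k + i β) x ⊗ tⁱ⁺ᵏ`. -/
lemma affine_bracket_d_tmul (i k : ℤ) {x : L} {β : ℂ} (hx : d.toLin x = β • x) :
    d.affine.bracket (Witt.d i, 0) (0, x ⊗ₜ T k) =
      (0, ((k : ℂ) + i * β) • (x ⊗ₜ[ℂ] (T (i + k) : Laur))) := by
  ext1
  · simp [affine, semidirect]
  · simp only [affine, semidirect, LinearMap.mk₂_apply, wittAction, wittLin_tmul, hx,
      Witt.dsymb_apply, Witt.symb_d, Witt.d_apply_T, Witt.euler_T, smul_mul_assoc,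
      ← LaurentPolynomial.T_add, TensorProduct.tmul_smul, add_comm k i]
    simp only [map_zero, LinearMap.zero_apply, sub_zero, add_zero, ← TensorProduct.smul_tmul',
      smul_smul, add_smul]

/-- The subspace `𝔞ₖ = (t-1)ᵏ⁺¹ W ⋉ (g ⊗ (t-1)ᵏ A)` of `𝔏`. -/
def aSub (_d : EvenDerivation g) (k : ℕ) : Submodule ℂ (Witt × (L ⊗[ℂ] Laur)) :=
  (LinearMap.range (Algebra.lsmul ℂ ℂ Witt ((T 1 - 1 : Laur) ^ (k + 1)))).prod
    (LinearMap.range (LinearMap.lTensor L (LinearMap.mulLeft ℂ ((T 1 - 1 : Laur) ^ k))))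

lemma mem_aSub_zero_iff {X : Witt × (L ⊗[ℂ] Laur)} :
    X ∈ d.aSub 0 ↔ ∃ D : Witt, X.1 = (T 1 - 1 : Laur) • D := by
  have h : LinearMap.mulLeft ℂ (1 : Laur) = LinearMap.id := by ext1; simp
  simp only [aSub, Submodule.mem_prod, pow_zero, h, LinearMap.lTensor_id, LinearMap.range_id,
    Submodule.mem_top, and_true, zero_add, pow_one, LinearMap.mem_range, Algebra.lsmul_coe]
  exact exists_congr fun _ => eq_comm

end EvenDerivation
end LieSuperalgebra

namespace LieSuperalgebra

variable {L : Type v} [AddCommGroup L] [Module ℂ L] {g : LieSuperalgebra L}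

namespace EvenDerivation

variable (d : EvenDerivation g)

/-- The Lie superalgebra `𝔞₀ = (t-1) W ⋉ (g ⊗ A)`, a subalgebra of `𝔏`. -/
def aZero : LieSuperalgebra (d.aSub 0) :=
  d.affine.sub (d.aSub 0)
    (by
      rintro ⟨D, x⟩ hX
      obtain ⟨y, hy, z, hz, rfl⟩ := Submodule.mem_sup.1
        (g.loop.isCompl.sup_eq_top ▸ Submodule.mem_top : x ∈ g.loop.part 0 ⊔ g.loop.part 1)
      refine Submodule.mem_sup.2 ⟨(D, y), ⟨?_, ?_⟩, (0, z), ⟨?_, ?_⟩, by simp⟩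
      · obtain ⟨D', hD'⟩ := d.mem_aSub_zero_iff.1 hX
        exact d.mem_aSub_zero_iff.2 ⟨D', hD'⟩
      · exact ⟨by simp, hy⟩
      · exact d.mem_aSub_zero_iff.2 ⟨0, by simp⟩
      · exact ⟨by simp, hz⟩)
    (by
      intro X hX Y hY
      obtain ⟨D, hD⟩ := d.mem_aSub_zero_iff.1 hX
      obtain ⟨D', hD'⟩ := d.mem_aSub_zero_iff.1 hY
      refine d.mem_aSub_zero_iff.2 ⟨D (T 1 - 1) • D' - D' (T 1 - 1) • D + (T 1 - 1 : Laur) • ⁅D, D'⁆, ?_⟩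
      change ⁅X.1, Y.1⁆ = _
      rw [hD, hD']
      ext1 a
      simp only [Derivation.commutator_apply, Derivation.smul_apply, Derivation.add_apply,
        Derivation.sub_apply, smul_eq_mul, Derivation.leibniz]
      ring)

lemma T_sub_one_dvd (n : ℤ) : (T 1 - 1 : Laur) ∣ T n - 1 := by
  have hnat : ∀ m : ℕ, (T 1 - 1 : Laur) ∣ T m - 1 := fun m => by
    have h := sub_dvd_pow_sub_pow (T 1 : Laur) 1 m
    simpa [LaurentPolynomial.T_pow] using h
  obtain ⟨m, rfl | rfl⟩ := n.eq_nat_or_neg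
  · exact hnat m
  · have e : (T (-(m : ℤ)) - 1 : Laur) = -T (-(m : ℤ)) * (T m - 1) := by
      rw [mul_sub, neg_mul, ← LaurentPolynomial.T_add]
      simp
      ring
    rw [e]
    exact (hnat m).mul_left _

/-- The element `d_n - d₀` of `𝔞₀`. -/
def aD (n : ℤ) : d.aSub 0 :=
  ⟨(Witt.d n - Witt.d 0, 0), d.mem_aSub_zero_iff.2 (by
    obtain ⟨q, hq⟩ := T_sub_one_dvd n
    refine ⟨q • Witt.euler, ?_⟩
    rw [smul_smul, ← hq, sub_smul]
    simp [Witt.d])⟩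

/-- The inclusion of `g ⊗ A` in `𝔞₀`. -/
def aLoop : L ⊗[ℂ] Laur →ₗ[ℂ] d.aSub 0 :=
  LinearMap.codRestrict _ (LinearMap.inr ℂ _ _) fun _ => d.mem_aSub_zero_iff.2 ⟨0, by simp⟩

/-- The homomorphism `𝔞₀ → ĝ` with kernel `𝔞₁`, sending `d_n - d₀` to `n d` and `x ⊗ tᵏ` to `x`. -/
def aToHat : Hom d.aZero d.hat where
  toLin := (LinearMap.prodMap (Laur.evalOne.toLinearMap ∘ₗ Witt.dsymb)
    ((TensorProduct.rid ℂ L).toLinearMap ∘ₗ LinearMap.lTensor L Laur.evalOne.toLinearMap)) ∘ₗ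
      (d.aSub 0).subtype
  map_mem := by
    rintro i X ⟨h1, h2⟩
    refine ⟨?_, ?_⟩
    · rcases zmod2_cases i with rfl | rfl <;> simp_all
    · change (TensorProduct.rid ℂ L) (LinearMap.lTensor L Laur.evalOne.toLinearMap X.1.2) ∈ _
      change X.1.2 ∈ _ at h2
      generalize X.1.2 = y at h2
      induction h2 using range_rTensor_induction with
      | zero => simp
      | add a b _ _ ha hb => simp only [map_add]; exact add_mem ha hb
      | tmul x hx a => simpa using Submodule.smul_mem _ _ hx
  map_bracket := by
    have key : ∀ (D : Witt), (∃ D', D = (T 1 - 1 : Laur) • D') → ∀ a, Laur.evalOne (D a) = 0 := by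
      rintro _ ⟨D', rfl⟩ a
      simp
    have act : ∀ (D : Witt), (∃ D', D = (T 1 - 1 : Laur) • D') → ∀ y : L ⊗[ℂ] Laur,
        (TensorProduct.rid ℂ L) (LinearMap.lTensor L Laur.evalOne.toLinearMap (d.wittLin D y)) =
          Laur.evalOne (Witt.dsymb D) • d.toLin
            ((TensorProduct.rid ℂ L) (LinearMap.lTensor L Laur.evalOne.toLinearMap y)) := by
      intro D hD y
      induction y with
      | zero => simp
      | add a b ha hb => simp only [map_add, smul_add, ha, hb]
      | tmul x a => simp [key D hD, mul_smul]
    have br : ∀ y z : L ⊗[ℂ] Laur,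
        (TensorProduct.rid ℂ L) (LinearMap.lTensor L Laur.evalOne.toLinearMap
          (g.loop.bracket y z)) =
          g.bracket ((TensorProduct.rid ℂ L) (LinearMap.lTensor L Laur.evalOne.toLinearMap y))
            ((TensorProduct.rid ℂ L) (LinearMap.lTensor L Laur.evalOne.toLinearMap z)) := by
      intro y z
      induction y with
      | zero => simp
      | add a b ha hb => simp only [map_add, LinearMap.add_apply, ha, hb]
      | tmul x a =>
        induction z with
        | zero => simp
        | add a b ha hb => simp only [map_add, ha, hb]
        | tmul y b => 
          simp only [loop, TensorProduct.map₂_apply_tmul, TensorProduct.map_tmul,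
            LinearMap.mul_apply', LinearMap.lTensor_tmul, TensorProduct.rid_tmul,
            AlgHom.toLinearMap_apply, map_mul, map_smul, LinearMap.smul_apply, smul_smul]
          rw [mul_comm]
    rintro ⟨⟨D, y⟩, hX⟩ ⟨⟨D', z⟩, hY⟩
    have hD := d.mem_aSub_zero_iff.1 hX
    have hD' := d.mem_aSub_zero_iff.1 hY
    ext1
    · change Laur.evalOne (Witt.dsymb ⁅D, D'⁆) = ⁅(_ : ℂ), (_ : ℂ)⁆
      rw [Witt.dsymb_lie, map_sub, key D hD, key D' hD', LieRing.of_associative_ring_bracket]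
      simp [mul_comm]
    · change (TensorProduct.rid ℂ L) (LinearMap.lTensor L Laur.evalOne.toLinearMap
        (d.wittLin D z - d.wittLin D' y + g.loop.bracket y z)) = _
      rw [map_add, map_add, map_sub, map_sub, act D hD, act D' hD', br]
      rfl

end EvenDerivation
end LieSuperalgebra

/-! ### Jet modules and the modules `F_λ(V)` -/

namespace SuperMod

variable {L : Type v} [AddCommGroup L] [Module ℂ L] {g : LieSuperalgebra L}

lemma act_bracket_even (V : SuperMod.{u} g) {x : L} (hx : x ∈ g.part 0) (y : L) (a : V.carrier) :
    V.act (g.bracket x y) a = V.act x (V.act y a) - V.act y (V.act x a) := by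
  obtain ⟨y0, h0, y1, h1, rfl⟩ := Submodule.mem_sup.1
    (g.isCompl.sup_eq_top ▸ Submodule.mem_top : y ∈ g.part 0 ⊔ g.part 1)
  have e0 := V.act_bracket hx h0 a
  have e1 := V.act_bracket hx h1 a
  simp only [LieSuperalgebra.superSign_zero_left, one_smul] at e0 e1
  simp only [map_add, LinearMap.add_apply, e0, e1]
  abel

variable (d : LieSuperalgebra.EvenDerivation g)

/-- The element `a ∈ A` of `𝔏̃`. -/
def laurElt (_d : LieSuperalgebra.EvenDerivation g) (a : Laur) :
    Witt × ((L ⊗[ℂ] Laur) × Laur) := (0, (0, a))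

/-- The element `d_n ∈ W` of `𝔏̃`. -/
def wittElt (_d : LieSuperalgebra.EvenDerivation g) (n : ℤ) :
    Witt × ((L ⊗[ℂ] Laur) × Laur) := (Witt.d n, (0, 0))

/-- The element `x ⊗ tⁿ ∈ g ⊗ A` of `𝔏̃`. -/
def loopElt (_d : LieSuperalgebra.EvenDerivation g) (x : L) (n : ℤ) :
    Witt × ((L ⊗[ℂ] Laur) × Laur) := (0, (x ⊗ₜ T n, 0))

variable {d}

/-- An `A𝔏`-module: an `𝔏̃`-module on which `A` acts associatively. -/
structure IsAModule (V : SuperMod.{u} d.affineExt) : Prop where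
  one_act : ∀ m : V.carrier, V.act (laurElt d 1) m = m
  mul_act : ∀ (a b : Laur) (m : V.carrier),
    V.act (laurElt d (a * b)) m = V.act (laurElt d a) (V.act (laurElt d b) m)

/-- The `A`-module underlying an `A𝔏`-module. -/
abbrev IsAModule.toModule {V : SuperMod.{u} d.affineExt} (h : V.IsAModule) :
    Module Laur V.carrier where
  smul a m := V.act (laurElt d a) m
  one_smul := h.one_act
  mul_smul := h.mul_act
  smul_zero a := map_zero _
  smul_add a := map_add _
  add_smul a b m := by
    change V.act (laurElt d (a + b)) m = V.act (laurElt d a) m + V.act (laurElt d b) m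
    rw [← LinearMap.add_apply, ← map_add]
    simp [laurElt]
  zero_smul m := by
    change V.act (laurElt d 0) m = 0
    have : laurElt d 0 = 0 := rfl
    simp [this]

/-- The weight space `V_μ = {m | d₀ m = μ m}`. -/
def weightSpace (V : SuperMod.{u} d.affineExt) (μ : ℂ) : Submodule ℂ V.carrier :=
  Module.End.eigenspace (V.act (wittElt d 0)) μ

/-- A weight module: `d₀` acts diagonalizably. -/
def IsWeight (V : SuperMod.{u} d.affineExt) : Prop := ⨆ μ : ℂ, V.weightSpace μ = ⊤

/-- The support: the set of weights. -/
def supp (V : SuperMod.{u} d.affineExt) : Set ℂ := {μ | V.weightSpace μ ≠ ⊥}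

/-- A Jet `𝔏`-module: a weight `A𝔏`-module that is a free `A`-module of finite rank. -/
def IsJet (V : SuperMod.{u} d.affineExt) : Prop :=
  V.IsWeight ∧ ∃ h : V.IsAModule,
    letI := h.toModule
    Module.Free Laur V.carrier ∧ Module.Finite Laur V.carrier

variable (d) in
/-- The category `𝒥_λ` of Jet `𝔏`-modules supported on `λ + ℤ`. -/
def jet (lam : ℂ) : ObjectProperty (SuperMod.{u} d.affineExt) :=
  fun V => V.IsJet ∧ V.supp ⊆ {μ | ∃ n : ℤ, μ = lam + n}

variable (d) in
/-- The simple modules in `𝒥_λ`. -/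
def simpleJet (lam : ℂ) : ObjectProperty (SuperMod.{u} d.affineExt) :=
  fun V => jet d lam V ∧ V.IsSimple

/-- An `𝔞₀`-module annihilated by `𝔞ₖ`. -/
def IsAnnihilatedBy (V : SuperMod.{u} d.aZero) (k : ℕ) : Prop :=
  ∀ X : d.aSub 0, X.1 ∈ d.aSub k → ∀ m : V.carrier, V.act X m = 0

section Tensor

variable (V : SuperMod.{u} d.aZero)

/-- For `X ∈ 𝔞₀` the operator `tʲ ⊗ u ↦ tⁿ⁺ʲ ⊗ X u` on `A ⊗ V`. -/
def shiftAct (n : ℤ) : d.aSub 0 →ₗ[ℂ] ((Laur ⊗[ℂ] V.carrier) →ₗ[ℂ] (Laur ⊗[ℂ] V.carrier)) :=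
  TensorProduct.mapBilinear (RingHom.id ℂ) Laur V.carrier Laur V.carrier
    (LinearMap.mulLeft ℂ (T n)) ∘ₗ V.act

@[simp] lemma shiftAct_tmul (n : ℤ) (X : d.aSub 0) (a : Laur) (m : V.carrier) :
    V.shiftAct n X (a ⊗ₜ m) = (T n * a) ⊗ₜ V.act X m := rfl

/-- `d_n · (tʲ ⊗ u) = (λ + j) tⁿ⁺ʲ ⊗ u + tⁿ⁺ʲ ⊗ (d_n - d₀) u`, extended linearly to `W`. -/
def tensorWitt (lam : ℂ) : Witt →ₗ[ℂ] ((Laur ⊗[ℂ] V.carrier) →ₗ[ℂ] (Laur ⊗[ℂ] V.carrier)) :=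
  { toFun := fun D => LinearMap.rTensor V.carrier
      ((D : Laur →ₗ[ℂ] Laur) + lam • LinearMap.mulLeft ℂ (Witt.symb D)) +
      Laur.lift (fun n => V.shiftAct n (d.aD n)) (Witt.symb D)
    map_add' := fun D D' => by
      ext a m
      simp [add_mul, TensorProduct.add_tmul, smul_add]
      abel
    map_smul' := fun c D => by
      ext a m
      simp [smul_add, TensorProduct.smul_tmul', smul_comm c lam] }

/-- `(x ⊗ tⁿ) · (tʲ ⊗ u) = tⁿ⁺ʲ ⊗ (x ⊗ tⁿ) u`, extended linearly to `g ⊗ A`. -/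
def tensorLoop : L ⊗[ℂ] Laur →ₗ[ℂ] ((Laur ⊗[ℂ] V.carrier) →ₗ[ℂ] (Laur ⊗[ℂ] V.carrier)) :=
  TensorProduct.lift (Laur.lift fun n =>
    V.shiftAct n ∘ₗ d.aLoop ∘ₗ (TensorProduct.mk ℂ L Laur).flip (T n)).flip

/-- `a · (b ⊗ u) = ab ⊗ u` for `a, b ∈ A`. -/
def tensorLaur : Laur →ₗ[ℂ] ((Laur ⊗[ℂ] V.carrier) →ₗ[ℂ] (Laur ⊗[ℂ] V.carrier)) :=
  LinearMap.rTensorHom V.carrier ∘ₗ LinearMap.mul ℂ Laur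

lemma tensorWitt_apply (lam : ℂ) (n j : ℤ) (m : V.carrier) :
    V.tensorWitt lam (Witt.d n) (T j ⊗ₜ m) =
      (lam + j) • ((T (n + j) : Laur) ⊗ₜ[ℂ] m) + (T (n + j) : Laur) ⊗ₜ V.act (d.aD n) m := by
  simp only [tensorWitt, LinearMap.coe_mk, AddHom.coe_mk, LinearMap.add_apply,
    LinearMap.rTensor_tmul, LinearMap.smul_apply, LinearMap.mulLeft_apply, Witt.symb_d,
    Laur.lift_T, shiftAct_tmul, ← LaurentPolynomial.T_add, Derivation.coeFn_coe, Witt.d_apply_T,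
    ← TensorProduct.smul_tmul', ← add_smul, add_comm j n, add_comm lam]

lemma tensorLoop_apply (x : L) (n j : ℤ) (m : V.carrier) :
    V.tensorLoop (x ⊗ₜ T n) (T j ⊗ₜ m) =
      (T (n + j) : Laur) ⊗ₜ V.act (d.aLoop (x ⊗ₜ T n)) m := by
  simp only [tensorLoop, TensorProduct.lift.tmul, LinearMap.flip_apply, Laur.lift_T,
    LinearMap.comp_apply, TensorProduct.mk_apply, shiftAct_tmul, ← LaurentPolynomial.T_add]

lemma tensorLaur_apply (a b : Laur) (m : V.carrier) :
    V.tensorLaur a (b ⊗ₜ m) = (a * b) ⊗ₜ m := by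
  simp [tensorLaur]

lemma tensor_end_ext {f f' : (Laur ⊗[ℂ] V.carrier) →ₗ[ℂ] (Laur ⊗[ℂ] V.carrier)}
    (H : ∀ (j : ℤ) (m : V.carrier), f (T j ⊗ₜ m) = f' (T j ⊗ₜ m)) : f = f' := by
  have h : (TensorProduct.mk ℂ Laur V.carrier).compr₂ f =
      (TensorProduct.mk ℂ Laur V.carrier).compr₂ f' :=
    Laur.hom_ext fun j => LinearMap.ext fun m => H j m
  exact TensorProduct.ext h

lemma tensorWitt_lie (lam : ℂ) (D D' : Witt) (z : Laur ⊗[ℂ] V.carrier) :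
    V.tensorWitt lam ⁅D, D'⁆ z = V.tensorWitt lam D (V.tensorWitt lam D' z) -
      V.tensorWitt lam D' (V.tensorWitt lam D z) := by
  let B : Witt →ₗ[ℂ] Witt →ₗ[ℂ] Witt := LinearMap.mk₂ ℂ (fun D D' => ⁅D, D'⁆)
    (fun a b c => by ext1; simp [Derivation.commutator_apply]; ring)
    (fun c a b => by ext1; simp [Derivation.commutator_apply, smul_sub])
    (fun a b c => by ext1; simp [Derivation.commutator_apply]; ring)
    (fun c a b => by ext1; simp [Derivation.commutator_apply, smul_sub])
  let C : Witt →ₗ[ℂ] Witt →ₗ[ℂ] ((Laur ⊗[ℂ] V.carrier) →ₗ[ℂ] (Laur ⊗[ℂ] V.carrier)) :=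
    (LinearMap.llcomp ℂ (Laur ⊗[ℂ] V.carrier) (Laur ⊗[ℂ] V.carrier)
      (Laur ⊗[ℂ] V.carrier)).compl₁₂ (V.tensorWitt lam)
      (V.tensorWitt lam)
  have key : B.compr₂ (V.tensorWitt lam) + C.flip = C := by
    refine Witt.hom_ext fun i => Witt.hom_ext fun k => V.tensor_end_ext fun j m => ?_
    have hb : d.aZero.bracket (d.aD i) (d.aD k) + (k : ℂ) • d.aD k =
        ((k : ℂ) - i) • d.aD (i + k) + (i : ℂ) • d.aD i := by
      apply Subtype.ext
      change d.affine.bracket (d.aD i).1 (d.aD k).1 + (k : ℂ) • (d.aD k).1 = _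
      have e0 : ∀ n, (d.aD n).1 = (Witt.d n, 0) - (Witt.d 0, 0) := fun n => by
        simp [LieSuperalgebra.EvenDerivation.aD]
      simp only [e0, map_sub, LinearMap.sub_apply, d.affine_bracket_d, Submodule.coe_add, Submodule.coe_smul]
      ext1
      · simp
        module
      · simp
    have hm : d.aD i ∈ d.aZero.part 0 := ⟨by simp, zero_mem _⟩
    have h := LinearMap.congr_fun (congrArg V.act hb) m
    simp only [map_add, map_smul, LinearMap.add_apply, LinearMap.smul_apply,
      V.act_bracket_even hm] at h
    have h' := sub_eq_iff_eq_add.1 (eq_sub_of_add_eq h)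
    simp only [B, C, LinearMap.compr₂_apply, LinearMap.mk₂_apply, Witt.lie_d, map_smul,
      LinearMap.smul_apply, LinearMap.add_apply, LinearMap.compl₁₂_apply, LinearMap.flip_apply,
      LinearMap.llcomp_apply, tensorWitt_apply, map_add, h',
      TensorProduct.tmul_add, TensorProduct.tmul_sub, TensorProduct.tmul_smul]
    rw [show k + (i + j) = i + k + j by ring, show i + (k + j) = i + k + j by ring]
    push_cast
    module
  exact eq_sub_iff_add_eq.2 (LinearMap.congr_fun (LinearMap.congr_fun₂ key D D') z)

lemma tensorWitt_loop (lam : ℂ) (D : Witt) (y : L ⊗[ℂ] Laur)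
    (z : Laur ⊗[ℂ] V.carrier) :
    V.tensorLoop (d.wittLin D y) z =
      V.tensorWitt lam D (V.tensorLoop y z) - V.tensorLoop y (V.tensorWitt lam D z) := by
  let C : Witt →ₗ[ℂ] L ⊗[ℂ] Laur →ₗ[ℂ] ((Laur ⊗[ℂ] V.carrier) →ₗ[ℂ] (Laur ⊗[ℂ] V.carrier)) :=
    (LinearMap.llcomp ℂ (Laur ⊗[ℂ] V.carrier) (Laur ⊗[ℂ] V.carrier)
      (Laur ⊗[ℂ] V.carrier)).compl₁₂ (V.tensorWitt lam)
      V.tensorLoop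
  let C' : L ⊗[ℂ] Laur →ₗ[ℂ] Witt →ₗ[ℂ] ((Laur ⊗[ℂ] V.carrier) →ₗ[ℂ] (Laur ⊗[ℂ] V.carrier)) :=
    (LinearMap.llcomp ℂ (Laur ⊗[ℂ] V.carrier) (Laur ⊗[ℂ] V.carrier)
      (Laur ⊗[ℂ] V.carrier)).compl₁₂ V.tensorLoop
      (V.tensorWitt lam)
  have key : d.wittLin.compr₂ V.tensorLoop + C'.flip = C := by
    refine Witt.hom_ext fun i => TensorProduct.ext (LinearMap.ext fun x =>
      Laur.hom_ext fun k => V.tensor_end_ext fun j m => ?_)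
    have hw : d.wittLin (Witt.d i) (x ⊗ₜ T k) =
        (k : ℂ) • (x ⊗ₜ[ℂ] (T (i + k) : Laur)) + (i : ℂ) • (d.toLin x ⊗ₜ[ℂ] (T (i + k) : Laur)) := by
      simp only [d.wittLin_tmul, Witt.d_apply_T, Witt.dsymb_apply, Witt.symb_d, Witt.euler_T,
        smul_mul_assoc, ← LaurentPolynomial.T_add, TensorProduct.tmul_smul, add_comm k i]
    have hb : d.aZero.bracket (d.aD i) (d.aLoop (x ⊗ₜ T k)) + (k : ℂ) • d.aLoop (x ⊗ₜ T k) =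
        (k : ℂ) • d.aLoop (x ⊗ₜ[ℂ] (T (i + k) : Laur)) +
          (i : ℂ) • d.aLoop (d.toLin x ⊗ₜ[ℂ] (T (i + k) : Laur)) := by
      have h0 : d.wittLin (Witt.d 0) (x ⊗ₜ T k) = (k : ℂ) • (x ⊗ₜ[ℂ] (T k : Laur)) := by
        simp [Witt.d_apply_T, Witt.dsymb_apply]
      simp only [← map_smul, ← map_add]
      rw [← hw, ← h0]
      apply Subtype.ext
      change d.affine.bracket (Witt.d i - Witt.d 0, 0) (0, x ⊗ₜ T k) +
        (0, d.wittLin (Witt.d 0) (x ⊗ₜ T k)) = (0, d.wittLin (Witt.d i) (x ⊗ₜ T k))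
      ext1
      · simp [LieSuperalgebra.EvenDerivation.affine, LieSuperalgebra.semidirect]
      · simp [LieSuperalgebra.EvenDerivation.affine, LieSuperalgebra.semidirect,
          LieSuperalgebra.EvenDerivation.wittAction]
    have hm : d.aD i ∈ d.aZero.part 0 := ⟨by simp, zero_mem _⟩
    have h := LinearMap.congr_fun (congrArg V.act hb) m
    simp only [map_add, map_smul, LinearMap.add_apply, LinearMap.smul_apply,
      V.act_bracket_even hm] at h
    have h' := sub_eq_iff_eq_add.1 (eq_sub_of_add_eq h)
    simp only [C, C', LinearMap.compr₂_apply, LinearMap.compr₂ₛₗ_apply, LinearMap.compl₁₂_apply,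
      LinearMap.flip_apply, TensorProduct.mk_apply,
      LinearMap.add_apply, LinearMap.llcomp_apply, hw, map_add, map_smul,
      LinearMap.add_apply, LinearMap.smul_apply, tensorWitt_apply, tensorLoop_apply, h',
      TensorProduct.tmul_add, TensorProduct.tmul_sub, TensorProduct.tmul_smul]
    rw [show k + (i + j) = i + k + j by ring, show i + (k + j) = i + k + j by ring]
    push_cast
    module
  exact eq_sub_iff_add_eq.2 (LinearMap.congr_fun (LinearMap.congr_fun₂ key D y) z)

lemma tensorWitt_laur (lam : ℂ) (D : Witt) (a : Laur) (z : Laur ⊗[ℂ] V.carrier) :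
    V.tensorLaur (D a) z =
      V.tensorWitt lam D (V.tensorLaur a z) - V.tensorLaur a (V.tensorWitt lam D z) := by
  let E : Witt →ₗ[ℂ] Laur →ₗ[ℂ] Laur :=
    { toFun := fun D => (D : Laur →ₗ[ℂ] Laur)
      map_add' := fun _ _ => rfl
      map_smul' := fun _ _ => rfl }
  let C : Witt →ₗ[ℂ] Laur →ₗ[ℂ] ((Laur ⊗[ℂ] V.carrier) →ₗ[ℂ] (Laur ⊗[ℂ] V.carrier)) :=
    (LinearMap.llcomp ℂ (Laur ⊗[ℂ] V.carrier) (Laur ⊗[ℂ] V.carrier)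
      (Laur ⊗[ℂ] V.carrier)).compl₁₂ (V.tensorWitt lam)
      V.tensorLaur
  let C' : Laur →ₗ[ℂ] Witt →ₗ[ℂ] ((Laur ⊗[ℂ] V.carrier) →ₗ[ℂ] (Laur ⊗[ℂ] V.carrier)) :=
    (LinearMap.llcomp ℂ (Laur ⊗[ℂ] V.carrier) (Laur ⊗[ℂ] V.carrier)
      (Laur ⊗[ℂ] V.carrier)).compl₁₂ V.tensorLaur
      (V.tensorWitt lam)
  have key : E.compr₂ V.tensorLaur + C'.flip = C := by
    refine Witt.hom_ext fun i => Laur.hom_ext fun k => V.tensor_end_ext fun j m => ?_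
    simp only [C, C', E, LinearMap.compr₂_apply, LinearMap.compl₁₂_apply, LinearMap.flip_apply,
      LinearMap.add_apply, LinearMap.llcomp_apply, LinearMap.coe_mk,
      AddHom.coe_mk, Derivation.coeFn_coe, Witt.d_apply_T, map_smul, LinearMap.smul_apply,
      tensorWitt_apply, tensorLaur_apply, ← LaurentPolynomial.T_add, map_add]
    rw [show k + (i + j) = i + k + j by ring, show i + (k + j) = i + k + j by ring,
      show k + i + j = i + k + j by ring]
    push_cast
    module
  exact eq_sub_iff_add_eq.2 (LinearMap.congr_fun (LinearMap.congr_fun₂ key D a) z)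

lemma tensorLoop_laur (y : L ⊗[ℂ] Laur) (a : Laur) :
    V.tensorLoop y ∘ₗ V.tensorLaur a = V.tensorLaur a ∘ₗ V.tensorLoop y := by
  let C : L ⊗[ℂ] Laur →ₗ[ℂ] Laur →ₗ[ℂ] ((Laur ⊗[ℂ] V.carrier) →ₗ[ℂ] (Laur ⊗[ℂ] V.carrier)) :=
    (LinearMap.llcomp ℂ (Laur ⊗[ℂ] V.carrier) (Laur ⊗[ℂ] V.carrier)
      (Laur ⊗[ℂ] V.carrier)).compl₁₂ V.tensorLoop V.tensorLaur
  let C' : Laur →ₗ[ℂ] L ⊗[ℂ] Laur →ₗ[ℂ] ((Laur ⊗[ℂ] V.carrier) →ₗ[ℂ] (Laur ⊗[ℂ] V.carrier)) :=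
    (LinearMap.llcomp ℂ (Laur ⊗[ℂ] V.carrier) (Laur ⊗[ℂ] V.carrier)
      (Laur ⊗[ℂ] V.carrier)).compl₁₂ V.tensorLaur V.tensorLoop
  have key : C = C'.flip := by
    refine TensorProduct.ext (LinearMap.ext fun x => Laur.hom_ext fun k =>
      Laur.hom_ext fun i => V.tensor_end_ext fun j m => ?_)
    simp only [C, C', LinearMap.compr₂ₛₗ_apply, LinearMap.compl₁₂_apply,
      LinearMap.flip_apply, TensorProduct.mk_apply,
      LinearMap.llcomp_apply, tensorLoop_apply, tensorLaur_apply,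
      ← LaurentPolynomial.T_add]
    rw [show k + (i + j) = i + (k + j) by ring]
  exact LinearMap.congr_fun₂ key y a

lemma tensorLaur_laur (a b : Laur) :
    V.tensorLaur a ∘ₗ V.tensorLaur b = V.tensorLaur (a * b) := by
  refine V.tensor_end_ext fun j m => ?_
  simp [tensorLaur_apply, mul_assoc]

lemma tensorLoop_loop {i j : ZMod 2} {y z : L ⊗[ℂ] Laur} (hy : y ∈ g.loop.part i)
    (hz : z ∈ g.loop.part j) (w : Laur ⊗[ℂ] V.carrier) :
    V.tensorLoop (g.loop.bracket y z) w =
      V.tensorLoop y (V.tensorLoop z w) - superSign i j • V.tensorLoop z (V.tensorLoop y w) := by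
  induction hy using LieSuperalgebra.range_rTensor_induction with
  | zero => simp
  | add a b _ _ ha hb =>
    simp only [map_add, LinearMap.add_apply, ha, hb, smul_add]
    abel
  | tmul x hx f =>
    induction hz using LieSuperalgebra.range_rTensor_induction with
    | zero => simp
    | add a b _ _ ha hb =>
      simp only [map_add, LinearMap.add_apply, ha, hb, smul_add]
      abel
    | tmul x' hx' f' =>
      let P : L → Laur →ₗ[ℂ] ((Laur ⊗[ℂ] V.carrier) →ₗ[ℂ] (Laur ⊗[ℂ] V.carrier)) := fun x =>
        V.tensorLoop ∘ₗ TensorProduct.mk ℂ L Laur x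
      let B : Laur →ₗ[ℂ] Laur →ₗ[ℂ] ((Laur ⊗[ℂ] V.carrier) →ₗ[ℂ] (Laur ⊗[ℂ] V.carrier)) :=
        (LinearMap.mul ℂ Laur).compr₂ (P (g.bracket x x'))
      have key : B + superSign i j • ((LinearMap.llcomp ℂ (Laur ⊗[ℂ] V.carrier) (Laur ⊗[ℂ] V.carrier)
            (Laur ⊗[ℂ] V.carrier)).compl₁₂ (P x') (P x)).flip =
          (LinearMap.llcomp ℂ (Laur ⊗[ℂ] V.carrier) (Laur ⊗[ℂ] V.carrier)
            (Laur ⊗[ℂ] V.carrier)).compl₁₂ (P x) (P x') := by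
        refine Laur.hom_ext fun n => Laur.hom_ext fun k => V.tensor_end_ext fun l m => ?_
        have hb : d.aZero.bracket (d.aLoop (x ⊗ₜ T n)) (d.aLoop (x' ⊗ₜ T k)) =
            d.aLoop (g.bracket x x' ⊗ₜ (T (n + k))) := by
          apply Subtype.ext
          change d.affine.bracket (0, x ⊗ₜ T n) (0, x' ⊗ₜ T k) = (0, _)
          ext1
          · simp [LieSuperalgebra.EvenDerivation.affine, LieSuperalgebra.semidirect]
          · simp only [LieSuperalgebra.EvenDerivation.affine, LieSuperalgebra.semidirect,
              LieSuperalgebra.loop, LinearMap.mk₂_apply, TensorProduct.map₂_apply_tmul,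
              TensorProduct.map_tmul, LinearMap.mul_apply', ← LaurentPolynomial.T_add]
            simp
        have m1 : d.aLoop (x ⊗ₜ T n) ∈ d.aZero.part i :=
          ⟨zero_mem _, (⟨x, hx⟩ : g.part i) ⊗ₜ T n, rfl⟩
        have m2 : d.aLoop (x' ⊗ₜ T k) ∈ d.aZero.part j :=
          ⟨zero_mem _, (⟨x', hx'⟩ : g.part j) ⊗ₜ T k, rfl⟩
        have h := V.act_bracket m1 m2 m
        rw [hb] at h
        simp only [B, P, LinearMap.compr₂_apply, LinearMap.comp_apply, TensorProduct.mk_apply,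
          LinearMap.compl₁₂_apply, LinearMap.flip_apply, LinearMap.add_apply,
          LinearMap.smul_apply, LinearMap.llcomp_apply, LinearMap.mul_apply', tensorLoop_apply,
          ← LaurentPolynomial.T_add, h, TensorProduct.tmul_sub, TensorProduct.tmul_smul]
        rw [show k + (n + l) = n + k + l by ring, show n + (k + l) = n + k + l by ring]
        exact sub_add_cancel _ _
      exact eq_sub_iff_add_eq.2 (LinearMap.congr_fun (LinearMap.congr_fun₂ key f f') w)

lemma isCompl_lTensor {E F : Type*} [AddCommGroup E] [Module ℂ E] [AddCommGroup F] [Module ℂ F]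
    {p q : Submodule ℂ E} (h : IsCompl p q) :
    IsCompl (LinearMap.range (LinearMap.lTensor F p.subtype))
      (LinearMap.range (LinearMap.lTensor F q.subtype)) := by
  have e : ∀ r : Submodule ℂ E, LinearMap.range (LinearMap.lTensor F r.subtype) =
      Submodule.orderIsoMapComap (TensorProduct.comm ℂ E F)
        (LinearMap.range (LinearMap.rTensor F r.subtype)) := fun r => by
    rw [Submodule.orderIsoMapComap_apply, ← LinearMap.comm_comp_rTensor_comp_comm_eq]
    rw [LinearMap.range_comp, LinearMap.range_comp_of_range_eq_top _ (LinearEquiv.range _)]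
  rw [e, e]
  exact (Submodule.orderIsoMapComap (TensorProduct.comm ℂ E F)).isCompl
    (LieSuperalgebra.isCompl_rTensor h)

/-- The action of `𝔏̃` on `A ⊗ V`. -/
def tensorAct (lam : ℂ) : Witt × ((L ⊗[ℂ] Laur) × Laur) →ₗ[ℂ]
    (Laur ⊗[ℂ] V.carrier) →ₗ[ℂ] (Laur ⊗[ℂ] V.carrier) :=
  (V.tensorWitt lam).coprod (V.tensorLoop.coprod V.tensorLaur)

lemma tensorAct_apply (lam : ℂ) (D : Witt) (y : L ⊗[ℂ] Laur) (a : Laur)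
    (z : Laur ⊗[ℂ] V.carrier) : V.tensorAct lam (D, (y, a)) z =
      V.tensorWitt lam D z + (V.tensorLoop y z + V.tensorLaur a z) := rfl

lemma mem_lTensor_of {E F : Type*} [AddCommGroup E] [Module ℂ E] [AddCommGroup F] [Module ℂ F]
    (p : Submodule ℂ E) (f : F) {m : E} (hm : m ∈ p) :
    f ⊗ₜ[ℂ] m ∈ LinearMap.range (LinearMap.lTensor F p.subtype) := ⟨f ⊗ₜ ⟨m, hm⟩, rfl⟩

lemma lTensor_range_le {p q : Submodule ℂ V.carrier}
    {f : (Laur ⊗[ℂ] V.carrier) →ₗ[ℂ] (Laur ⊗[ℂ] V.carrier)}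
    (h : ∀ (j : ℤ), ∀ m ∈ p,
      f (T j ⊗ₜ m) ∈ LinearMap.range (LinearMap.lTensor Laur q.subtype))
    {z : Laur ⊗[ℂ] V.carrier} (hz : z ∈ LinearMap.range (LinearMap.lTensor Laur p.subtype)) :
    f z ∈ LinearMap.range (LinearMap.lTensor Laur q.subtype) := by
  obtain ⟨z, rfl⟩ := hz
  induction z with
  | zero => simp
  | add a b ha hb => simp only [map_add]; exact add_mem ha hb
  | tmul a m =>
    induction a using LaurentPolynomial.induction_on' with
    | add a b ha hb => simp only [TensorProduct.add_tmul, map_add]; exact add_mem ha hb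
    | C_mul_T n c =>
      rw [← LaurentPolynomial.smul_eq_C_mul, ← TensorProduct.smul_tmul', map_smul, map_smul]
      exact Submodule.smul_mem _ _ (h n m m.2)

lemma tensorWitt_mem (lam : ℂ) (D : Witt) {j : ZMod 2} {z : Laur ⊗[ℂ] V.carrier}
    (hz : z ∈ LinearMap.range (LinearMap.lTensor Laur (V.part j).subtype)) :
    V.tensorWitt lam D z ∈ LinearMap.range (LinearMap.lTensor Laur (V.part j).subtype) := by
  refine V.lTensor_range_le (fun k m hm => ?_) hz
  rw [← Witt.symb_smul D]
  generalize Witt.symb D = f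
  induction f using LaurentPolynomial.induction_on' with
  | add a b ha hb =>
    rw [add_smul, map_add, LinearMap.add_apply]
    exact add_mem ha hb
  | C_mul_T n c =>
    have e : (LaurentPolynomial.C c * T n : Laur) • Witt.euler = c • Witt.d n := by
      rw [← LaurentPolynomial.smul_eq_C_mul, smul_assoc, Witt.d]
    rw [e, map_smul, LinearMap.smul_apply, tensorWitt_apply]
    have h0 : d.aD n ∈ d.aZero.part 0 := ⟨by simp, zero_mem _⟩
    have h1 := V.act_mem h0 hm
    rw [zero_add] at h1
    exact Submodule.smul_mem _ _ (add_mem (Submodule.smul_mem _ _ (mem_lTensor_of _ _ hm))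
      (mem_lTensor_of _ _ h1))

lemma tensorLoop_mem {i j : ZMod 2} {y : L ⊗[ℂ] Laur} (hy : y ∈ g.loop.part i)
    {z : Laur ⊗[ℂ] V.carrier}
    (hz : z ∈ LinearMap.range (LinearMap.lTensor Laur (V.part j).subtype)) :
    V.tensorLoop y z ∈ LinearMap.range (LinearMap.lTensor Laur (V.part (i + j)).subtype) := by
  refine V.lTensor_range_le (fun k m hm => ?_) hz
  induction hy using LieSuperalgebra.range_rTensor_induction with
  | zero => simp
  | add a b _ _ ha hb => rw [map_add, LinearMap.add_apply]; exact add_mem ha hb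
  | tmul x hx f =>
    induction f using LaurentPolynomial.induction_on' with
    | add a b ha hb =>
      rw [TensorProduct.tmul_add, map_add, LinearMap.add_apply]
      exact add_mem ha hb
    | C_mul_T n c =>
      rw [← LaurentPolynomial.smul_eq_C_mul, TensorProduct.tmul_smul, map_smul,
        LinearMap.smul_apply, tensorLoop_apply]
      exact Submodule.smul_mem _ _ (mem_lTensor_of _ _ (V.act_mem
        (show d.aLoop (x ⊗ₜ T n) ∈ d.aZero.part i from
          ⟨zero_mem _, (⟨x, hx⟩ : g.part i) ⊗ₜ T n, rfl⟩) hm))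

lemma tensorLaur_mem (a : Laur) {j : ZMod 2} {z : Laur ⊗[ℂ] V.carrier}
    (hz : z ∈ LinearMap.range (LinearMap.lTensor Laur (V.part j).subtype)) :
    V.tensorLaur a z ∈ LinearMap.range (LinearMap.lTensor Laur (V.part j).subtype) := by
  refine V.lTensor_range_le (fun k m hm => ?_) hz
  rw [tensorLaur_apply]
  exact mem_lTensor_of _ _ hm

lemma tensorAct_mem (lam : ℂ) {i j : ZMod 2} {D : Witt} {y : L ⊗[ℂ] Laur} {a : Laur}
    (hX : (D, y, a) ∈ d.affineExt.part i) {z : Laur ⊗[ℂ] V.carrier}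
    (hz : z ∈ LinearMap.range (LinearMap.lTensor Laur (V.part j).subtype)) :
    V.tensorAct lam (D, y, a) z ∈
      LinearMap.range (LinearMap.lTensor Laur (V.part (i + j)).subtype) := by
  obtain ⟨hD, hy, ha⟩ := hX
  have h2 := V.tensorLoop_mem (i := i) (y := y) hy hz
  rw [tensorAct_apply]
  rcases LieSuperalgebra.zmod2_cases i with rfl | rfl
  · rw [zero_add] at h2 ⊢
    exact add_mem (V.tensorWitt_mem lam D hz) (add_mem h2 (V.tensorLaur_mem a hz))
  · have hD' : D = 0 := by simpa using hD
    have ha' : a = 0 := by simpa using ha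
    have e1 : V.tensorWitt lam D z = 0 := by rw [hD']; simp
    have e2 : V.tensorLaur a z = 0 := by rw [ha']; simp
    rw [e1, e2, zero_add, add_zero]
    exact h2

lemma map_sub_add_apply {E F : Type*} [AddCommGroup E] [Module ℂ E] [AddCommGroup F]
    [Module ℂ F] (f : E →ₗ[ℂ] F →ₗ[ℂ] F) (p q r : E) (z : F) :
    f (p - q + r) z = f p z - f q z + f r z := by
  simp

lemma bracket_comb {F : Type*} [AddCommGroup F] [Module ℂ F] (w w' l l' r r' : F →ₗ[ℂ] F)
    (s : ℂ) (z : F) (h : s = 1 ∨ (w = 0 ∧ w' = 0 ∧ r = 0 ∧ r' = 0))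
    (h1 : r (r' z) = r' (r z)) (h2 : l (r' z) = r' (l z)) (h3 : l' (r z) = r (l' z)) :
    (w (w' z) - w' (w z)) + (((w (l' z) - l' (w z)) - (w' (l z) - l (w' z)) +
      (l (l' z) - s • l' (l z))) + ((w (r' z) - r' (w z)) - (w' (r z) - r (w' z)))) =
    (w (w' z + (l' z + r' z)) + (l (w' z + (l' z + r' z)) + r (w' z + (l' z + r' z)))) -
      s • (w' (w z + (l z + r z)) + (l' (w z + (l z + r z)) + r' (w z + (l z + r z)))) := by
  rcases h with rfl | ⟨rfl, rfl, rfl, rfl⟩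
  · simp only [map_add, h1, h2, h3, one_smul]
    abel
  · simp

lemma tensorAct_bracket (lam : ℂ) {i j : ZMod 2} {D D' : Witt} {y y' : L ⊗[ℂ] Laur}
    {a a' : Laur} (hX : (D, y, a) ∈ d.affineExt.part i) (hY : (D', y', a') ∈ d.affineExt.part j)
    (z : Laur ⊗[ℂ] V.carrier) :
    V.tensorAct lam (d.affineExt.bracket (D, y, a) (D', y', a')) z =
      V.tensorAct lam (D, y, a) (V.tensorAct lam (D', y', a') z) -
        superSign i j • V.tensorAct lam (D', y', a') (V.tensorAct lam (D, y, a) z) := by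
  obtain ⟨hD, hy, ha⟩ := hX
  obtain ⟨hD', hy', ha'⟩ := hY
  have hb : d.affineExt.bracket (D, y, a) (D', y', a') =
      (⁅D, D'⁆, (d.wittLin D y' - d.wittLin D' y + g.loop.bracket y y', D a' - D' a + 0)) := rfl
  have hs : superSign i j = 1 ∨ (V.tensorWitt lam D = 0 ∧ V.tensorWitt lam D' = 0 ∧
      V.tensorLaur a = 0 ∧ V.tensorLaur a' = 0) := by
    rcases LieSuperalgebra.zmod2_cases i with rfl | rfl
    · exact Or.inl (LieSuperalgebra.superSign_zero_left j)
    rcases LieSuperalgebra.zmod2_cases j with rfl | rfl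
    · exact Or.inl (LieSuperalgebra.superSign_zero_right 1)
    have e1 : D = 0 := by simpa using hD
    have e2 : a = 0 := by simpa using ha
    have e3 : D' = 0 := by simpa using hD'
    have e4 : a' = 0 := by simpa using ha'
    refine Or.inr ⟨?_, ?_, ?_, ?_⟩
    · rw [e1, map_zero]
    · rw [e3, map_zero]
    · rw [e2, map_zero]
    · rw [e4, map_zero]
  have s1 : V.tensorLoop (d.wittLin D y' - d.wittLin D' y + g.loop.bracket y y') z =
      (V.tensorWitt lam D (V.tensorLoop y' z) - V.tensorLoop y' (V.tensorWitt lam D z)) -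
      (V.tensorWitt lam D' (V.tensorLoop y z) - V.tensorLoop y (V.tensorWitt lam D' z)) +
      (V.tensorLoop y (V.tensorLoop y' z) - superSign i j • V.tensorLoop y' (V.tensorLoop y z)) :=
    (map_sub_add_apply V.tensorLoop (d.wittLin D y') (d.wittLin D' y)
      (g.loop.bracket y y') z).trans (congrArg₂ (· + ·)
        (congrArg₂ (· - ·) (V.tensorWitt_loop lam D y' z) (V.tensorWitt_loop lam D' y z))
        (V.tensorLoop_loop (i := i) (j := j) (y := y) (z := y') hy hy' z))
  have s3 : V.tensorLaur 0 z = 0 := by rw [map_zero, LinearMap.zero_apply]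
  have s2 : V.tensorLaur (D a' - D' a + 0) z =
      (V.tensorWitt lam D (V.tensorLaur a' z) - V.tensorLaur a' (V.tensorWitt lam D z)) -
      (V.tensorWitt lam D' (V.tensorLaur a z) - V.tensorLaur a (V.tensorWitt lam D' z)) :=
    (map_sub_add_apply V.tensorLaur (D a') (D' a) 0 z).trans
      ((congrArg (V.tensorLaur (D a') z - V.tensorLaur (D' a) z + ·) s3).trans
        ((add_zero _).trans (congrArg₂ (· - ·) (V.tensorWitt_laur lam D a' z)
          (V.tensorWitt_laur lam D' a z))))
  have t1 := V.tensorAct_apply lam D' y' a' z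
  have t2 := V.tensorAct_apply lam D y a z
  have c1 : ∀ y a, V.tensorLoop y (V.tensorLaur a z) = V.tensorLaur a (V.tensorLoop y z) :=
    fun y a => LinearMap.congr_fun (V.tensorLoop_laur y a) z
  have c2 : V.tensorLaur a (V.tensorLaur a' z) = V.tensorLaur a' (V.tensorLaur a z) := by
    have h1 := LinearMap.congr_fun (V.tensorLaur_laur a a') z
    have h2 := LinearMap.congr_fun (V.tensorLaur_laur a' a) z
    rw [mul_comm a' a] at h2
    exact h1.trans h2.symm
  have e1 := (congrArg (V.tensorAct lam (D, y, a)) t1).trans (V.tensorAct_apply lam D y a _)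
  have e2 := (congrArg (V.tensorAct lam (D', y', a')) t2).trans
    (V.tensorAct_apply lam D' y' a' _)
  exact (congrArg (fun X => V.tensorAct lam X z) hb).trans
    ((V.tensorAct_apply lam _ _ _ z).trans
      ((congrArg₂ (· + ·) (V.tensorWitt_lie lam D D' z) (congrArg₂ (· + ·) s1 s2)).trans
        ((bracket_comb (V.tensorWitt lam D) (V.tensorWitt lam D') (V.tensorLoop y)
          (V.tensorLoop y') (V.tensorLaur a) (V.tensorLaur a') (superSign i j) z hs c2
          (c1 y a') (c1 y' a)).trans
          (congrArg₂ (· - ·) e1.symm (congrArg (superSign i j • ·) e2.symm)))))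

/-- The `A𝔏`-module `F_λ(V) = A ⊗ V` attached to an `𝔞₀`-module `V`, with action
`tⁱ · (tʲ ⊗ u) = tⁱ⁺ʲ ⊗ u`, `d_i · (tʲ ⊗ u) = (λ + j) tⁱ⁺ʲ ⊗ u + tⁱ⁺ʲ ⊗ (d_i - d₀) u` and
`(x ⊗ tⁱ) · (tʲ ⊗ u) = tⁱ⁺ʲ ⊗ (x ⊗ tⁱ) u`. -/
def tensorObj (lam : ℂ) : SuperMod.{u} d.affineExt where
  carrier := Laur ⊗[ℂ] V.carrier
  part i := LinearMap.range (LinearMap.lTensor Laur (V.part i).subtype)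
  isCompl := isCompl_lTensor V.isCompl
  act := V.tensorAct lam
  act_mem := fun hX hz => V.tensorAct_mem lam hX hz
  act_bracket := fun hX hY z => V.tensorAct_bracket lam hX hY z

lemma tensorObj_act_laur (lam : ℂ) (i j : ℤ) (m : V.carrier) :
    (V.tensorObj lam).act (laurElt d (T i)) ((T j : Laur) ⊗ₜ[ℂ] m) =
      (T (i + j) : Laur) ⊗ₜ[ℂ] m := by
  change V.tensorAct lam (0, (0, T i)) (T j ⊗ₜ m) = _
  rw [tensorAct_apply, tensorLaur_apply, LaurentPolynomial.T_add]
  simp only [map_zero, LinearMap.zero_apply, zero_add]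

lemma tensorObj_act_witt (lam : ℂ) (i j : ℤ) (m : V.carrier) :
    (V.tensorObj lam).act (wittElt d i) ((T j : Laur) ⊗ₜ[ℂ] m) =
      (lam + j) • ((T (i + j) : Laur) ⊗ₜ[ℂ] m) + (T (i + j) : Laur) ⊗ₜ[ℂ] V.act (d.aD i) m := by
  change V.tensorAct lam (Witt.d i, (0, 0)) (T j ⊗ₜ m) = _
  rw [tensorAct_apply, tensorWitt_apply]
  simp only [map_zero, LinearMap.zero_apply, add_zero]

lemma tensorObj_act_loop (lam : ℂ) (x : L) (i j : ℤ) (m : V.carrier) :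
    (V.tensorObj lam).act (loopElt d x i) ((T j : Laur) ⊗ₜ[ℂ] m) =
      (T (i + j) : Laur) ⊗ₜ[ℂ] V.act (d.aLoop (x ⊗ₜ T i)) m := by
  change V.tensorAct lam (0, (x ⊗ₜ T i, 0)) (T j ⊗ₜ m) = _
  rw [tensorAct_apply, tensorLoop_apply]
  simp only [map_zero, LinearMap.zero_apply, add_zero, zero_add]

end Tensor

section Map

variable {V V' : SuperMod.{u} d.aZero} (φ : Hom V V')

lemma lTensor_ext {f f' : (Laur ⊗[ℂ] V.carrier) →ₗ[ℂ] (Laur ⊗[ℂ] V'.carrier)}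
    (H : ∀ (j : ℤ) (m : V.carrier), f (T j ⊗ₜ m) = f' (T j ⊗ₜ m)) : f = f' := by
  have h : (TensorProduct.mk ℂ Laur V.carrier).compr₂ f =
      (TensorProduct.mk ℂ Laur V.carrier).compr₂ f' :=
    Laur.hom_ext fun j => LinearMap.ext fun m => H j m
  exact TensorProduct.ext h

lemma lTensor_mem {i : ZMod 2} {z : Laur ⊗[ℂ] V.carrier}
    (hz : z ∈ LinearMap.range (LinearMap.lTensor Laur (V.part i).subtype)) :
    LinearMap.lTensor Laur φ.toLin z ∈
      LinearMap.range (LinearMap.lTensor Laur (V'.part i).subtype) := by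
  obtain ⟨z, rfl⟩ := hz
  induction z with
  | zero => simp
  | add a b ha hb => simp only [map_add]; exact add_mem ha hb
  | tmul a m => exact mem_lTensor_of _ _ (φ.map_mem m.2)

lemma lTensor_witt (lam : ℂ) (D : Witt) (z : Laur ⊗[ℂ] V.carrier) :
    LinearMap.lTensor Laur φ.toLin (V.tensorWitt lam D z) =
      V'.tensorWitt lam D (LinearMap.lTensor Laur φ.toLin z) := by
  have key : (V.tensorWitt lam).compr₂ (LinearMap.lTensor Laur φ.toLin) =
      (V'.tensorWitt lam).compl₂ (LinearMap.lTensor Laur φ.toLin) := by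
    refine Witt.hom_ext fun n => lTensor_ext fun j m => ?_
    simp only [LinearMap.compr₂_apply, LinearMap.compl₂_apply, LinearMap.lTensor_tmul,
      tensorWitt_apply, map_add, map_smul, φ.map_act]
  exact LinearMap.congr_fun₂ key D z

lemma lTensor_loop (y : L ⊗[ℂ] Laur) (z : Laur ⊗[ℂ] V.carrier) :
    LinearMap.lTensor Laur φ.toLin (V.tensorLoop y z) =
      V'.tensorLoop y (LinearMap.lTensor Laur φ.toLin z) := by
  have key : V.tensorLoop.compr₂ (LinearMap.lTensor Laur φ.toLin) =
      V'.tensorLoop.compl₂ (LinearMap.lTensor Laur φ.toLin) := by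
    refine TensorProduct.ext (LinearMap.ext fun x => Laur.hom_ext fun k =>
      lTensor_ext fun j m => ?_)
    simp only [LinearMap.compr₂ₛₗ_apply, LinearMap.compr₂_apply, LinearMap.compl₂_apply,
      LinearMap.lTensor_tmul, TensorProduct.mk_apply, tensorLoop_apply, φ.map_act]
  exact LinearMap.congr_fun₂ key y z

lemma lTensor_laur (a : Laur) (z : Laur ⊗[ℂ] V.carrier) :
    LinearMap.lTensor Laur φ.toLin (V.tensorLaur a z) =
      V'.tensorLaur a (LinearMap.lTensor Laur φ.toLin z) := by
  have key : LinearMap.lTensor Laur φ.toLin ∘ₗ V.tensorLaur a =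
      V'.tensorLaur a ∘ₗ LinearMap.lTensor Laur φ.toLin := by
    refine lTensor_ext fun j m => ?_
    simp only [LinearMap.comp_apply, LinearMap.lTensor_tmul, tensorLaur_apply]
  exact LinearMap.congr_fun key z

lemma lTensor_act (lam : ℂ) (D : Witt) (y : L ⊗[ℂ] Laur) (a : Laur)
    (z : Laur ⊗[ℂ] V.carrier) :
    LinearMap.lTensor Laur φ.toLin (V.tensorAct lam (D, (y, a)) z) =
      V'.tensorAct lam (D, (y, a)) (LinearMap.lTensor Laur φ.toLin z) := by
  rw [V.tensorAct_apply, V'.tensorAct_apply, map_add, map_add, lTensor_witt, lTensor_loop,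
    lTensor_laur]

/-- The morphism `id ⊗ φ : F_λ(V) → F_λ(V')`. -/
def tensorMap (lam : ℂ) : Hom (V.tensorObj lam) (V'.tensorObj lam) where
  toLin := LinearMap.lTensor Laur φ.toLin
  map_mem := fun hz => lTensor_mem φ hz
  map_act := fun X z => lTensor_act φ lam X.1 X.2.1 X.2.2 z

end Map

variable (d) in
/-- The functor `F_λ` from `𝔞₀`-modules to `A𝔏`-modules. -/
def tensorFunctor (lam : ℂ) : SuperMod.{u} d.aZero ⥤ SuperMod.{u} d.affineExt where
  obj V := V.tensorObj lam
  map φ := tensorMap φ lam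
  map_id _ := Hom.ext (LinearMap.lTensor_id _ _)
  map_comp _ _ := Hom.ext (LinearMap.lTensor_comp _ _ _)

end SuperMod

end

/-!
A module `V` in `𝒥_λ` is a free `A`-module on which `𝔏` acts by differential operators of order at
most one, that is, a vector bundle on the punctured line. Elements of `𝔞₀` have vector field part
vanishing at `t = 1`, so they act on the fibre `V / (t - 1) V`. Multiplication by `tⁿ` maps the
`d₀`-weight space `V_λ` isomorphically onto `V_{λ+n}`, so the fibre is realized on `V_λ`
(`SuperMod.weightMul_bijective`, `SuperMod.fibre`), and `V ≅ A ⊗ V_λ` is `F_λ` of its fibre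
(`SuperMod.tensorFibreIso`). Conversely evaluation at `t = 1` recovers an `𝔞₀`-module from `F_λ`,
and a morphism between two `F_λ(V)` preserves the weight space `1 ⊗ V` and commutes with `A`, so
that `F_λ` is fully faithful.

That a finite-dimensional `𝔞₀`-module is annihilated by some `𝔞ₖ` is proved as follows, with
`θ = t d/dt`. The coordinate `w = 1 - t⁻¹` satisfies `(t - 1) θ(w) = w`, so the vector fields
`(t - 1) wⁿ θ` are eigenvectors of `ad (t - 1)θ` with eigenvalues `n`, and only finitely many of
them act as nonzero operators. Two consecutive ones which act as zero generate, through
`[fθ, u hθ] - [u fθ, hθ] = 2 θ(u) f hθ`, all vector fields of high order at `t = 1`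
(`SuperMod.exists_forall_act_aVec_eq_zero`). For `d(x) = β x` with `β ≠ 1` the identity
`[f hθ, x ⊗ a] - [fθ, x ⊗ h a] = (β - 1) x ⊗ f θ(h) a` then gives the annihilation by loops of high
order (`SuperMod.act_aLoop_eq_zero`).

Let `V` be a simple finite-dimensional `𝔞₀`-module annihilated by `𝔞ₖ₊₂`. Since
`[𝔞ₖ₊₁, 𝔞ₖ₊₁] ⊆ 𝔞ₖ₊₂`, the algebra `𝔞ₖ₊₁` acts by operators commuting up to sign. A spanning set of
them has no nonzero eigenvalue: modulo `𝔞ₖ₊₂` such an operator is an eigenvector of `ad (t - 1)θ` of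
nonzero eigenvalue, or the commutator of two operators commuting with it, or odd and hence of square
zero. So these operators have a common kernel, which is a submodule since `[𝔞ₖ₊₁, 𝔞₀] ⊆ 𝔞ₖ₊₁`, and
hence is `V` (`SuperMod.IsSimple.isAnnihilatedBy_succ`). By descent `𝔞₁` annihilates `V`, so that
`V` is a `ĝ`-module (`SuperMod.toHat`). As `F_λ` preserves and reflects simplicity, the equivalence
restricts to simple modules.
-/

noncomputable section

/-! ### Operators on complex vector spaces -/

namespace Module

lemma eq_zero_of_eq_neg {E : Type*} [AddCommGroup E] [Module ℂ E] {v : E} (h : v = -v) :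
    v = 0 := by
  have h2 : (2 : ℂ) • v = 0 := by rw [two_smul, ← sub_neg_eq_add, ← h, sub_self]
  exact (smul_eq_zero.1 h2).resolve_left two_ne_zero

end Module

namespace Module.End

section
variable {E : Type*} [AddCommGroup E] [Module ℂ E] [FiniteDimensional ℂ E]

/-- On a finite-dimensional space only finitely many scalars occur as eigenvalues of `ad A`, so
eigenvectors of `ad A` with eigenvalues `0, 1, 2, …` vanish from some point on. -/
lemma eventually_eq_zero_of_commutator_eq_smul {A : Module.End ℂ E} {c : ℂ} (hc : c ≠ 0)
    {C : ℕ → Module.End ℂ E} (h : ∀ n : ℕ, A * C n - C n * A = (n * c) • C n) :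
    ∃ N, ∀ n, N ≤ n → C n = 0 := by
  let δ : Module.End ℂ (Module.End ℂ E) := LinearMap.mulLeft ℂ A - LinearMap.mulRight ℂ A
  have hfin := Module.End.finite_hasEigenvalue δ
  have hinj : Function.Injective fun n : ℕ => (n : ℂ) * c := fun m n hmn => by
    exact_mod_cast mul_right_cancel₀ hc hmn
  obtain ⟨N, hN⟩ := (hfin.preimage hinj.injOn).bddAbove
  refine ⟨N + 1, fun n hn => ?_⟩
  by_contra hne
  have : n ≤ N := hN (Module.End.hasEigenvalue_of_hasEigenvector
    (x := C n) ⟨Module.End.mem_eigenspace_iff.2 (by simpa [δ] using h n), hne⟩)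
  omega

/-- If `[A, C] = c C` with `c ≠ 0`, then `0` is the only eigenvalue of `C`. -/
lemma eigenvalue_eq_zero_of_commutator_eq_smul {A C : Module.End ℂ E} {c : ℂ} (hc : c ≠ 0)
    (h : A * C - C * A = c • C) {μ : ℂ} (hμ : C.HasEigenvalue μ) : μ = 0 := by
  have hpow : ∀ n : ℕ, A * C ^ n - C ^ n * A = (n * c) • C ^ n := by
    intro n
    induction n with
    | zero => simp
    | succ n ih =>
      have e : A * C ^ (n + 1) - C ^ (n + 1) * A =
          (A * C ^ n - C ^ n * A) * C + C ^ n * (A * C - C * A) := by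
        rw [pow_succ]; noncomm_ring
      rw [e, ih, h, smul_mul_assoc, mul_smul_comm, ← pow_succ, ← add_smul]
      push_cast
      ring_nf
  obtain ⟨N, hN⟩ := eventually_eq_zero_of_commutator_eq_smul hc hpow
  exact (hμ.isNilpotent_of_isNilpotent ⟨N, hN N le_rfl⟩).eq_zero

/-- If `[A, B]` is a nonzero multiple of an operator `C` commuting with both, then `0` is the
only eigenvalue of `C`: the trace of `[A, B]` vanishes on each eigenspace of `C`. -/
lemma eigenvalue_eq_zero_of_commutator_central {A B C : Module.End ℂ E} {c : ℂ} (hc : c ≠ 0)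
    (h : A * B - B * A = c • C) (hA : A * C = C * A) (hB : B * C = C * B) {μ : ℂ}
    (hμ : C.HasEigenvalue μ) : μ = 0 := by
  have stable : ∀ D : Module.End ℂ E, D * C = C * D →
      ∀ x ∈ C.eigenspace μ, D x ∈ C.eigenspace μ := by
    intro D hD x hx
    rw [Module.End.mem_eigenspace_iff] at hx ⊢
    have := LinearMap.congr_fun hD x
    simp only [Module.End.mul_apply, hx, map_smul] at this
    exact this.symm
  let A' : Module.End ℂ (C.eigenspace μ) := A.restrict (stable A hA)
  let B' : Module.End ℂ (C.eigenspace μ) := B.restrict (stable B hB)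
  have e : A' * B' - B' * A' = (c * μ) • (1 : Module.End ℂ (C.eigenspace μ)) := by
    ext x
    have h1 := LinearMap.congr_fun h x
    have h2 := Module.End.mem_eigenspace_iff.1 x.2
    simp only [LinearMap.sub_apply, Module.End.mul_apply, LinearMap.smul_apply, h2] at h1
    simpa [A', B', mul_smul] using h1
  have ht := congrArg (LinearMap.trace ℂ _) e
  -- The left side of the traced identity is `0`, the right side is `c μ` times the dimension.
  rw [map_sub, LinearMap.trace_mul_comm, sub_self, map_smul, LinearMap.trace_one, smul_eq_mul] at ht
  have hd : (Module.finrank ℂ (C.eigenspace μ) : ℂ) ≠ 0 := by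
    have : C.eigenspace μ ≠ ⊥ := hμ
    exact_mod_cast fun h0 => this (Submodule.finrank_eq_zero.1 h0)
  have : c * μ = 0 := by
    rcases mul_eq_zero.1 ht.symm with h | h
    · exact h
    · exact absurd h hd
  exact (mul_eq_zero.1 this).resolve_left hc

/-- A family of operators which commute up to scalars and have `0` as only eigenvalue has a
common kernel. In a minimal nonzero invariant subspace the kernel of each operator is invariant,
hence everything. -/
lemma exists_ne_zero_forall_apply_eq_zero [Nontrivial E] (S : Set (Module.End ℂ E))
    (hS : ∀ X ∈ S, ∀ μ : ℂ, X.HasEigenvalue μ → μ = 0)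
    (hcomm : ∀ X ∈ S, ∀ Y ∈ S, ∃ c : ℂ, X * Y = c • (Y * X)) :
    ∃ m : E, m ≠ 0 ∧ ∀ X ∈ S, X m = 0 := by
  obtain ⟨U, ⟨hU0, hU⟩, hmin⟩ := exists_minimal_of_wellFoundedLT
    (fun U : Submodule ℂ E => U ≠ ⊥ ∧ ∀ X ∈ S, ∀ m ∈ U, X m ∈ U)
    ⟨⊤, top_ne_bot, fun _ _ _ _ => Submodule.mem_top⟩
  obtain ⟨m, hmU, hm0⟩ := U.exists_mem_ne_zero_of_ne_bot hU0
  refine ⟨m, hm0, fun X hX => ?_⟩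
  have : Nontrivial U := Submodule.nontrivial_iff_ne_bot.2 hU0
  obtain ⟨μ, hμ⟩ := Module.End.exists_eigenvalue (X.restrict (hU X hX))
  obtain ⟨⟨y, hyU⟩, hy⟩ := hμ.exists_hasEigenvector
  have hy0 : y ≠ 0 := fun h => hy.2 (Subtype.ext h)
  have hXy : X y = μ • y := congrArg Subtype.val hy.apply_eq_smul
  have hμ0 : μ = 0 := hS X hX μ (Module.End.hasEigenvalue_of_hasEigenvector
    ⟨Module.End.mem_eigenspace_iff.2 hXy, hy0⟩)
  rw [hμ0, zero_smul] at hXy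
  have hle : U ≤ U ⊓ LinearMap.ker X := by
    refine hmin ⟨fun h => hy0 ?_, fun Y hY n hn => ⟨hU Y hY n hn.1, ?_⟩⟩ inf_le_left
    · exact (Submodule.mem_bot ℂ).1 (h ▸ (⟨hyU, hXy⟩ : y ∈ U ⊓ LinearMap.ker X))
    · obtain ⟨c, hc⟩ := hcomm X hX Y hY
      have h1 := LinearMap.congr_fun hc n
      have h2 : X n = 0 := hn.2
      simpa [h2] using h1
  exact (hle hmU).2

end

end Module.End

namespace IsCompl

/-- An injective linear map respecting two decompositions reflects membership in the parts. -/
lemma mem_of_map_mem {E F : Type*} [AddCommGroup E] [Module ℂ E] [AddCommGroup F] [Module ℂ F]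
    {p : ZMod 2 → Submodule ℂ E} {q : ZMod 2 → Submodule ℂ F} (hp : IsCompl (p 0) (p 1))
    (hq : IsCompl (q 0) (q 1)) {f : E →ₗ[ℂ] F} (hf : Function.Injective f)
    (h : ∀ i, ∀ a ∈ p i, f a ∈ q i) {i : ZMod 2} {a : E} (ha : f a ∈ q i) : a ∈ p i := by
  obtain ⟨b, hb, c, hc, rfl⟩ := Submodule.mem_sup.1
    (hp.sup_eq_top ▸ Submodule.mem_top : a ∈ p 0 ⊔ p 1)
  rw [map_add] at ha
  rcases LieSuperalgebra.zmod2_cases i with rfl | rfl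
  · have h1 : f c ∈ q 0 := by simpa using sub_mem ha (h 0 b hb)
    have h2 : f c = 0 := Submodule.disjoint_def.1 hq.disjoint _ h1 (h 1 c hc)
    rw [(map_eq_zero_iff f hf).1 h2, add_zero]
    exact hb
  · have h1 : f b ∈ q 1 := by simpa using sub_mem ha (h 1 c hc)
    have h2 : f b = 0 := Submodule.disjoint_def.1 hq.disjoint _ (h 0 b hb) h1
    rw [(map_eq_zero_iff f hf).1 h2, zero_add]
    exact hc

/-- The homogeneous components of an eigenvector of an even operator are eigenvectors. -/
lemma apply_eq_smul_of_apply_add_eq_smul {E : Type*} [AddCommGroup E] [Module ℂ E]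
    {p : ZMod 2 → Submodule ℂ E} (hp : IsCompl (p 0) (p 1)) {f : E →ₗ[ℂ] E}
    (h : ∀ i, ∀ a ∈ p i, f a ∈ p i) {c : ℂ} {a b : E} (ha : a ∈ p 0) (hb : b ∈ p 1)
    (hab : f (a + b) = c • (a + b)) : f a = c • a ∧ f b = c • b := by
  have e : f a - c • a = c • b - f b := by
    rw [map_add, smul_add] at hab
    rw [sub_eq_sub_iff_add_eq_add, hab, add_comm]
  have h0 : f a - c • a ∈ p 0 := sub_mem (h 0 a ha) (Submodule.smul_mem _ _ ha)
  have h1 : c • b - f b ∈ p 1 := sub_mem (Submodule.smul_mem _ _ hb) (h 1 b hb)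
  have h2 := Submodule.disjoint_def.1 hp.disjoint _ h0 (e ▸ h1)
  exact ⟨sub_eq_zero.1 h2, (sub_eq_zero.1 (e ▸ h2)).symm⟩

end IsCompl

/-! ### Elements of `𝔞₀` and the annihilation of finite-dimensional modules by some `𝔞ₖ` -/

namespace Laur

@[simp] lemma euler_T_one_sub_one : Witt.euler (T 1 - 1 : Laur) = T 1 := by
  simp

lemma T_one_mul_T_neg_one : (T 1 * T (-1) : Laur) = 1 := by
  rw [← LaurentPolynomial.T_add]; simp

lemma euler_T_sub_one_mul_T_neg_one : Witt.euler ((T 1 - 1) * T (-1) : Laur) = T (-1) := by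
  simp only [Derivation.leibniz, smul_eq_mul, euler_T_one_sub_one, Witt.euler_T]
  push_cast
  rw [neg_smul, one_smul]
  ring

/-- A Laurent polynomial is congruent to its value at `t = 1` modulo `t - 1`. -/
lemma exists_eq_evalOne_add (a : Laur) :
    ∃ b : Laur, a = algebraMap ℂ Laur (evalOne a) + (T 1 - 1) * b := by
  induction a using LaurentPolynomial.induction_on' with
  | add a b ha hb =>
    obtain ⟨a', ha⟩ := ha
    obtain ⟨b', hb⟩ := hb
    refine ⟨a' + b', ?_⟩
    rw [map_add, map_add, mul_add]
    conv_lhs => rw [ha, hb]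
    ring
  | C_mul_T n c =>
    obtain ⟨q, hq⟩ := LieSuperalgebra.EvenDerivation.T_sub_one_dvd n
    refine ⟨LaurentPolynomial.C c * q, ?_⟩
    have e : evalOne (LaurentPolynomial.C c * T n : Laur) = c := by
      rw [← LaurentPolynomial.smul_eq_C_mul, map_smul, evalOne_T, smul_eq_mul, mul_one]
    rw [e, ← LaurentPolynomial.C_eq_algebraMap, mul_left_comm, ← hq]
    ring

end Laur

lemma Witt.sub_smul_euler (a b : Laur) :
    (a - b) • Witt.euler = a • Witt.euler - b • Witt.euler := by
  ext1 c
  simp [Derivation.smul_apply, Derivation.sub_apply, sub_mul]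

namespace LieSuperalgebra.EvenDerivation

variable {L : Type v} [AddCommGroup L] [Module ℂ L] {g : LieSuperalgebra L}
  (d : EvenDerivation g)

/-- The vector field `(t - 1) h · t d/dt`, as an element of `𝔞₀`. -/
def aVec : Laur →ₗ[ℂ] d.aSub 0 where
  toFun h := ⟨(((T 1 - 1 : Laur) * h) • Witt.euler, 0),
    d.mem_aSub_zero_iff.2 ⟨h • Witt.euler, by rw [smul_smul]⟩⟩
  map_add' a b := Subtype.ext (Prod.ext (by simp [mul_add, add_smul]) (by simp))
  map_smul' c a := Subtype.ext (Prod.ext (by simp) (by simp))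

lemma aVec_val (h : Laur) : (d.aVec h).1 = (((T 1 - 1 : Laur) * h) • Witt.euler, 0) := rfl

lemma aLoop_val (y : L ⊗[ℂ] Laur) : (d.aLoop y).1 = (0, y) := rfl

lemma exists_eq_aVec_add_aLoop (X : d.aSub 0) : ∃ h y, X = d.aVec h + d.aLoop y := by
  obtain ⟨D, hD⟩ := d.mem_aSub_zero_iff.1 X.2
  refine ⟨Witt.symb D, X.1.2, Subtype.ext (Prod.ext ?_ ?_)⟩
  · rw [Submodule.coe_add, aVec_val, aLoop_val, mul_smul, Witt.symb_smul]
    simpa using hD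
  · simp [aVec_val, aLoop_val]

lemma aVec_mem (h : Laur) : d.aVec h ∈ d.aZero.part 0 := ⟨by simp, zero_mem _⟩

lemma aLoop_tmul_mem {i : ZMod 2} {x : L} (hx : x ∈ g.part i) (a : Laur) :
    d.aLoop (x ⊗ₜ a) ∈ d.aZero.part i :=
  ⟨zero_mem _, (⟨x, hx⟩ : g.part i) ⊗ₜ a, rfl⟩

lemma wittLin_smul_euler {x : L} {β : ℂ} (hx : d.toLin x = β • x) (f a : Laur) :
    d.wittLin (f • Witt.euler) (x ⊗ₜ a) =
      x ⊗ₜ (f * Witt.euler a + β • (Witt.euler f * a)) := by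
  rw [wittLin_tmul, hx, Witt.dsymb_apply, Witt.symb_smul_euler, TensorProduct.smul_tmul,
    ← TensorProduct.tmul_add]
  rfl

lemma lie_smul_euler (f h : Laur) :
    ⁅f • Witt.euler, h • Witt.euler⁆ = (f * Witt.euler h - Witt.euler f * h) • Witt.euler := by
  rw [← Witt.symb_smul ⁅f • Witt.euler, h • Witt.euler⁆, Witt.symb_lie]
  simp [mul_comm h]

lemma bracket_aVec_aVec (f h : Laur) : d.aZero.bracket (d.aVec f) (d.aVec h) =
    d.aVec (f * Witt.euler ((T 1 - 1) * h) - Witt.euler ((T 1 - 1) * f) * h) := by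
  refine Subtype.ext (Prod.ext ?_ ?_)
  · change ⁅((T 1 - 1 : Laur) * f) • Witt.euler, ((T 1 - 1 : Laur) * h) • Witt.euler⁆ = _
    rw [lie_smul_euler, aVec_val]
    congr 1
    ring
  · change d.wittLin _ 0 - d.wittLin _ 0 + g.loop.bracket 0 0 = 0
    simp

lemma bracket_aVec_aLoop {x : L} {β : ℂ} (hx : d.toLin x = β • x) (f a : Laur) :
    d.aZero.bracket (d.aVec f) (d.aLoop (x ⊗ₜ a)) = d.aLoop (x ⊗ₜ
      ((T 1 - 1) * f * Witt.euler a + β • (Witt.euler ((T 1 - 1) * f) * a))) := by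
  refine Subtype.ext (Prod.ext ?_ ?_)
  · change ⁅((T 1 - 1 : Laur) * f) • Witt.euler, (0 : Witt)⁆ = 0
    exact lie_zero (((T 1 - 1 : Laur) * f) • Witt.euler)
  · change d.wittLin (((T 1 - 1 : Laur) * f) • Witt.euler) (x ⊗ₜ a) - d.wittLin 0 0 +
      g.loop.bracket 0 (x ⊗ₜ a) = x ⊗ₜ _
    rw [wittLin_smul_euler d hx]
    simp

lemma bracket_aLoop_aLoop (x y : L) (a b : Laur) :
    d.aZero.bracket (d.aLoop (x ⊗ₜ a)) (d.aLoop (y ⊗ₜ b)) =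
      d.aLoop (g.bracket x y ⊗ₜ (a * b)) := by
  refine Subtype.ext (Prod.ext ?_ ?_)
  · change ⁅(0 : Witt), (0 : Witt)⁆ = 0
    simp
  · change d.wittLin 0 _ - d.wittLin 0 _ + g.loop.bracket (x ⊗ₜ a) (y ⊗ₜ b) = _
    simp [loop, aLoop_val]

lemma aLoop_tmul_mem_aSub (k : ℕ) (x : L) (a : Laur) :
    (d.aLoop (x ⊗ₜ ((T 1 - 1) ^ k * a))).1 ∈ d.aSub k :=
  ⟨zero_mem _, x ⊗ₜ a, rfl⟩

lemma aVec_mem_aSub (k : ℕ) (a : Laur) : (d.aVec ((T 1 - 1) ^ k * a)).1 ∈ d.aSub k := by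
  refine ⟨⟨a • Witt.euler, ?_⟩, zero_mem _⟩
  change (T 1 - 1 : Laur) ^ (k + 1) • a • Witt.euler = _
  rw [aVec_val, smul_smul, pow_succ', mul_assoc]

lemma mem_aSub_iff {k : ℕ} {X : d.aSub 0} : X.1 ∈ d.aSub k ↔
    ∃ h y, X = d.aVec ((T 1 - 1) ^ k * h) +
      d.aLoop (LinearMap.lTensor L (LinearMap.mulLeft ℂ ((T 1 - 1 : Laur) ^ k)) y) := by
  constructor
  · rintro ⟨⟨D, hD⟩, y, hy⟩
    refine ⟨Witt.symb D, y, Subtype.ext (Prod.ext ?_ ?_)⟩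
    · rw [Submodule.coe_add, aVec_val, aLoop_val, ← mul_assoc, mul_smul, Witt.symb_smul,
        ← pow_succ']
      exact hD.symm.trans (add_zero _).symm
    · rw [hy]
      simp [aVec_val, aLoop_val]
  · rintro ⟨h, y, rfl⟩
    rw [Submodule.coe_add]
    exact add_mem (d.aVec_mem_aSub k h) ⟨zero_mem _, y, rfl⟩

end LieSuperalgebra.EvenDerivation

namespace SuperMod

variable {L : Type v} [AddCommGroup L] [Module ℂ L] {g : LieSuperalgebra L}
  {d : LieSuperalgebra.EvenDerivation g} (V : SuperMod.{u} d.aZero)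

/-- If `𝔤` has a basis of eigenvectors of `d`, being annihilated by `𝔞ₖ` can be tested on vector
fields and on loops in homogeneous eigenvectors. -/
lemma act_eq_zero_of_forall {S : Type w} (x : Module.Basis S ℂ L) {β : S → ℂ}
    (hβ : ∀ s, d.toLin (x s) = β s • x s) {k : ℕ} {m : V.carrier}
    (hvec : ∀ h, V.act (d.aVec ((T 1 - 1) ^ k * h)) m = 0)
    (hloop : ∀ (s : S) (i : ZMod 2), ∀ y ∈ g.part i, d.toLin y = β s • y → ∀ a,
      V.act (d.aLoop (y ⊗ₜ ((T 1 - 1) ^ k * a))) m = 0) {X : d.aSub 0} (hX : X.1 ∈ d.aSub k) :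
    V.act X m = 0 := by
  obtain ⟨h, y, rfl⟩ := d.mem_aSub_iff.1 hX
  rw [map_add, LinearMap.add_apply, hvec, zero_add]
  induction y with
  | zero => simp
  | add a b ha hb =>
    rw [map_add, map_add, map_add, LinearMap.add_apply]
    rw [ha, hb, add_zero] <;> exact d.mem_aSub_iff.2 ⟨h, _, rfl⟩
  | tmul y a =>
    have key : LinearMap.applyₗ m ∘ₗ (V.act ∘ₗ d.aLoop) ∘ₗ
        (TensorProduct.mk ℂ L Laur).flip ((T 1 - 1 : Laur) ^ k * a) = 0 := by
      refine x.ext fun s => ?_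
      obtain ⟨y0, h0, y1, h1, e⟩ := Submodule.mem_sup.1
        (g.isCompl.sup_eq_top ▸ Submodule.mem_top : x s ∈ g.part 0 ⊔ g.part 1)
      have hs := hβ s
      rw [← e] at hs
      obtain ⟨e0, e1⟩ := IsCompl.apply_eq_smul_of_apply_add_eq_smul g.isCompl (f := d.toLin)
        (fun i a ha => d.map_mem ha) h0 h1 hs
      rw [← e, map_add]
      have r0 := hloop s 0 y0 h0 e0 a
      have r1 := hloop s 1 y1 h1 e1 a
      exact (congrArg₂ (· + ·) r0 r1).trans (add_zero 0)
    exact LinearMap.congr_fun key y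

/-- The identity `[fθ, u hθ] - [u fθ, hθ] = 2 θ(u) f hθ` for `θ = t d/dt` turns the vanishing of
two elements into that of an ideal of vector fields. -/
lemma act_aVec_eq_zero_of_two {f u : Laur} (h1 : V.act (d.aVec f) = 0)
    (h2 : V.act (d.aVec (u * f)) = 0) (h : Laur) :
    V.act (d.aVec (Witt.euler u * (T 1 - 1) * f * h)) = 0 := by
  have e : (2 : ℂ) • d.aVec (Witt.euler u * (T 1 - 1) * f * h) =
      d.aZero.bracket (d.aVec f) (d.aVec (u * h)) +
        (-1 : ℂ) • d.aZero.bracket (d.aVec (u * f)) (d.aVec h) := by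
    rw [d.bracket_aVec_aVec, d.bracket_aVec_aVec, ← map_smul, ← map_smul, ← map_add, neg_one_smul]
    congr 1
    have h2 : (2 : ℂ) • (Witt.euler u * (T 1 - 1) * f * h) =
        2 * (Witt.euler u * (T 1 - 1) * f * h) := by
      rw [two_smul, two_mul]
    simp only [h2, Derivation.leibniz, smul_eq_mul, Laur.euler_T_one_sub_one]
    ring
  ext m
  have h3 := LinearMap.congr_fun (congrArg V.act e) m
  rw [map_smul, map_add, map_smul, LinearMap.add_apply, LinearMap.smul_apply,
    LinearMap.smul_apply, V.act_bracket_even (d.aVec_mem _),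
    V.act_bracket_even (d.aVec_mem _), h1, h2] at h3
  simpa using h3

/-- The coordinate `w = 1 - t⁻¹` linearizes the vector field `(t - 1) t d/dt`. -/
lemma bracket_aVec_one_pow (n : ℕ) :
    d.aZero.bracket (d.aVec 1) (d.aVec (((T 1 - 1) * T (-1)) ^ n)) =
      (n : ℂ) • d.aVec (((T 1 - 1) * T (-1)) ^ n) := by
  have e : (n : ℂ) • (((T 1 - 1) * T (-1) : Laur) ^ n) = (n : Laur) * ((T 1 - 1) * T (-1)) ^ n := by
    rw [Nat.cast_smul_eq_nsmul, nsmul_eq_mul]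
  rw [d.bracket_aVec_aVec, ← map_smul, e, Derivation.leibniz, Derivation.leibniz_pow,
    Laur.euler_T_sub_one_mul_T_neg_one, mul_one,
    Laur.euler_T_one_sub_one]
  congr 1
  simp only [smul_eq_mul, nsmul_eq_mul]
  rcases n with _ | n
  · simp
  · rw [Nat.add_sub_cancel, pow_succ]
    ring

/-- A finite-dimensional `𝔞₀`-module is annihilated by all vector fields of high order at `1`. -/
lemma exists_forall_act_aVec_eq_zero [FiniteDimensional ℂ V.carrier] :
    ∃ N : ℕ, ∀ h, V.act (d.aVec ((T 1 - 1) ^ N * h)) = 0 := by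
  have hc : ∀ n : ℕ, V.act (d.aVec 1) * V.act (d.aVec (((T 1 - 1) * T (-1)) ^ n)) -
      V.act (d.aVec (((T 1 - 1) * T (-1)) ^ n)) * V.act (d.aVec 1) =
        ((n : ℂ) * 1) • V.act (d.aVec (((T 1 - 1) * T (-1)) ^ n)) := by
    intro n
    ext m
    have h := LinearMap.congr_fun (congrArg V.act (bracket_aVec_one_pow (d := d) n)) m
    rw [V.act_bracket_even (d.aVec_mem _), map_smul] at h
    rw [mul_one]
    exact h
  -- `w = (t-1) t⁻¹` has `θ(w) = t⁻¹`, a unit: the vanishing of `wᴺ` and `wᴺ⁺¹ = w wᴺ` gives that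
  -- of all multiples of `t⁻¹ (t-1) wᴺ`, that is, of all multiples of `(t-1)ᴺ⁺¹`.
  obtain ⟨N, hN⟩ := Module.End.eventually_eq_zero_of_commutator_eq_smul one_ne_zero hc
  refine ⟨N + 1, fun h => ?_⟩
  have h1 := hN N le_rfl
  have h2 := hN (N + 1) (Nat.le_succ N)
  rw [pow_succ'] at h2
  have h3 := V.act_aVec_eq_zero_of_two h1 h2 (T 1 ^ (N + 1) * h)
  have e : (T 1 - 1 : Laur) ^ (N + 1) * h = T (-1) * (T 1 - 1) *
      ((T 1 - 1) * T (-1)) ^ N * (T 1 ^ (N + 1) * h) := by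
    calc (T 1 - 1 : Laur) ^ (N + 1) * h
        = (T 1 - 1) ^ (N + 1) * h * (T 1 * T (-1)) ^ (N + 1) := by
          rw [Laur.T_one_mul_T_neg_one, one_pow, mul_one]
      _ = _ := by rw [mul_pow, mul_pow]; ring
  rw [Laur.euler_T_sub_one_mul_T_neg_one] at h3
  rw [e]
  exact h3

/-- The key use of `β ≠ 1`: for `x` with `d(x) = β x` one has
`[f hθ, x ⊗ a] - [fθ, x ⊗ h a] = (β - 1) x ⊗ f θ(h) a`. -/
lemma act_aLoop_eq_zero {y : L} {β : ℂ} (hy : d.toLin y = β • y) (hβ : β ≠ 1) {f : Laur}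
    (hf : ∀ h, V.act (d.aVec (f * h)) = 0) (a : Laur) :
    V.act (d.aLoop (y ⊗ₜ ((T 1 - 1) * f * a))) = 0 := by
  have e : (β - 1) • d.aLoop (y ⊗ₜ[ℂ] ((T 1 - 1) * f * a)) =
      d.aZero.bracket (d.aVec (f * T 1)) (d.aLoop (y ⊗ₜ (T (-1) * a))) +
        (-1 : ℂ) • d.aZero.bracket (d.aVec (f * 1)) (d.aLoop (y ⊗ₜ a)) := by
    rw [d.bracket_aVec_aLoop hy, d.bracket_aVec_aLoop hy, ← map_smul, ← map_smul, ← map_add,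
      ← TensorProduct.tmul_smul, ← TensorProduct.tmul_smul, ← TensorProduct.tmul_add,
      neg_one_smul]
    congr 2
    simp only [Derivation.leibniz, smul_eq_mul, Derivation.map_one_eq_zero, Witt.euler_T, mul_one,
      Algebra.smul_def, map_sub, map_one]
    push_cast
    linear_combination (-((T 1 - 1) * f * Witt.euler a) + (T 1 - 1) * f * a
      - algebraMap ℂ Laur β * ((T 1 - 1) * f * a + (T 1 - 1) * Witt.euler f * a
      + f * T 1 * a)) * Laur.T_one_mul_T_neg_one
  ext m
  have h3 := LinearMap.congr_fun (congrArg V.act e) m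
  rw [map_smul, map_add, map_smul, LinearMap.add_apply, LinearMap.smul_apply,
    LinearMap.smul_apply, V.act_bracket_even (d.aVec_mem _),
    V.act_bracket_even (d.aVec_mem _), hf, hf] at h3
  simpa [sub_eq_zero, hβ] using h3

/-- If no `β s` is `1`, every finite-dimensional `𝔞₀`-module is annihilated by some `𝔞ₖ`. -/
lemma exists_isAnnihilatedBy [FiniteDimensional ℂ V.carrier] {S : Type w}
    (x : Module.Basis S ℂ L) {β : S → ℂ} (hβ : ∀ s, d.toLin (x s) = β s • x s)
    (hβ1 : ∀ s, β s ≠ 1) : ∃ k : ℕ, V.IsAnnihilatedBy (k + 1) := by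
  obtain ⟨N, hN⟩ := V.exists_forall_act_aVec_eq_zero
  refine ⟨N, fun X hX m => V.act_eq_zero_of_forall x hβ (fun h => ?_)
    (fun s i y _ hy a => ?_) hX⟩
  · rw [pow_succ, mul_assoc, hN, LinearMap.zero_apply]
  · rw [pow_succ', V.act_aLoop_eq_zero hy (hβ1 s) hN a, LinearMap.zero_apply]

end SuperMod

/-! ### The functor `F_λ` is fully faithful -/

/-- A subspace stable under `D` contains the components of its elements in eigenspaces of `D`. -/
lemma Module.End.mem_of_sum_eigenvectors_mem {E ι : Type*} [AddCommGroup E] [Module ℂ E]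
    (D : Module.End ℂ E) {N : Submodule ℂ E} (hN : ∀ m ∈ N, D m ∈ N) {μ : ι → ℂ}
    (hμ : Function.Injective μ) (s : Finset ι) : ∀ m : ι → E, (∀ i, D (m i) = μ i • m i) →
      ∑ i ∈ s, m i ∈ N → ∀ i ∈ s, m i ∈ N := by
  classical
  induction s using Finset.induction_on with
  | empty => simp
  | insert j s hj ih =>
    intro m hm hsum
    have h1 : ∑ i ∈ s, (μ i - μ j) • m i ∈ N := by
      have h2 := sub_mem (hN _ hsum) (N.smul_mem (μ j) hsum)
      rw [map_sum, Finset.smul_sum, ← Finset.sum_sub_distrib, Finset.sum_insert hj, hm, sub_self,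
        zero_add] at h2
      simpa only [hm, ← sub_smul] using h2
    have h3 : ∀ i ∈ s, m i ∈ N := fun i hi => by
      have h4 := ih (fun i => (μ i - μ j) • m i)
        (fun i => by rw [map_smul, hm, smul_comm]) h1 i hi
      have hne : μ i - μ j ≠ 0 := sub_ne_zero.2 fun h => hj (hμ h ▸ hi)
      exact (N.smul_mem_iff hne).1 h4
    intro i hi
    rcases Finset.mem_insert.1 hi with rfl | hi
    · rw [Finset.sum_insert hj] at hsum
      simpa using sub_mem hsum (sum_mem h3)
    · exact h3 i hi

/-- If a sum of eigenvectors with distinct eigenvalues is an eigenvector for `c`, then the terms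
with eigenvalue other than `c` vanish. -/
lemma Module.End.eq_zero_of_sum_eigenvectors {E ι : Type*} [AddCommGroup E] [Module ℂ E]
    (D : Module.End ℂ E) {μ : ι → ℂ} (hμ : Function.Injective μ) (s : Finset ι) {m : ι → E}
    (hm : ∀ i, D (m i) = μ i • m i) {c : ℂ} (h : D (∑ i ∈ s, m i) = c • ∑ i ∈ s, m i) {i : ι}
    (hi : i ∈ s) (hc : c ≠ μ i) : m i = 0 := by
  have hmem := D.mem_of_sum_eigenvectors_mem (N := ⊥)
    (fun m hm => by rw [(Submodule.mem_bot ℂ).1 hm]; simp) hμ s (fun i => (μ i - c) • m i)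
    (fun i => by rw [map_smul, hm, smul_comm])
    (by
      rw [map_sum, Finset.smul_sum, ← sub_eq_zero, ← Finset.sum_sub_distrib] at h
      simpa only [hm, ← sub_smul, Submodule.mem_bot] using h) i hi
  rw [Submodule.mem_bot, smul_eq_zero, sub_eq_zero] at hmem
  exact hmem.resolve_left fun h => hc h.symm

namespace Laur

variable {E : Type*} [AddCommGroup E] [Module ℂ E]

lemma exists_eq_sum_T_tmul (z : Laur ⊗[ℂ] E) :
    ∃ m : ℤ →₀ E, z = ∑ j ∈ m.support, (T j : Laur) ⊗ₜ[ℂ] m j := by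
  change ∃ m : ℤ →₀ E, z = m.sum fun j u => (T j : Laur) ⊗ₜ[ℂ] u
  induction z with
  | zero => exact ⟨0, by simp⟩
  | add a b ha hb =>
    obtain ⟨m, rfl⟩ := ha
    obtain ⟨m', rfl⟩ := hb
    exact ⟨m + m', (Finsupp.sum_add_index' (by simp) (by simp [TensorProduct.tmul_add])).symm⟩
  | tmul a u =>
    induction a using LaurentPolynomial.induction_on' with
    | add a b ha hb =>
      obtain ⟨m, hm⟩ := ha
      obtain ⟨m', hm'⟩ := hb
      refine ⟨m + m', ?_⟩
      rw [Finsupp.sum_add_index' (by simp) (by simp [TensorProduct.tmul_add]),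
        TensorProduct.add_tmul, hm, hm']
    | C_mul_T n c =>
      refine ⟨Finsupp.single n (c • u), ?_⟩
      rw [Finsupp.sum_single_index (by simp), ← LaurentPolynomial.smul_eq_C_mul,
        TensorProduct.smul_tmul]

variable (E) in
/-- Evaluation at `t = 1`, as a map `A ⊗ E → E`. -/
def evalTensor : Laur ⊗[ℂ] E →ₗ[ℂ] E :=
  (TensorProduct.lid ℂ E).toLinearMap ∘ₗ LinearMap.rTensor E evalOne.toLinearMap

@[simp] lemma evalTensor_tmul (a : Laur) (m : E) : evalTensor E (a ⊗ₜ m) = evalOne a • m := by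
  simp [evalTensor]

lemma T_tmul_eq_zero_iff (j : ℤ) (m : E) : (T j : Laur) ⊗ₜ[ℂ] m = 0 ↔ m = 0 := by
  refine ⟨fun h => ?_, fun h => by rw [h, TensorProduct.tmul_zero]⟩
  simpa using congrArg (evalTensor E) h

lemma evalTensor_mem {p : Submodule ℂ E} {z : Laur ⊗[ℂ] E}
    (hz : z ∈ LinearMap.range (LinearMap.lTensor Laur p.subtype)) : evalTensor E z ∈ p := by
  obtain ⟨z, rfl⟩ := hz
  induction z with
  | zero => simp
  | add a b ha hb => simp only [map_add]; exact add_mem ha hb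
  | tmul a m => simpa using p.smul_mem _ m.2

end Laur

namespace LieSuperalgebra.EvenDerivation

variable {L : Type v} [AddCommGroup L] [Module ℂ L] {g : LieSuperalgebra L}
  (d : EvenDerivation g)

lemma aVec_eq_lift : d.aVec = Laur.lift d.aD ∘ₗ LinearMap.mulLeft ℂ (T 1 - 1 : Laur) := by
  refine Laur.hom_ext fun n => ?_
  have e : (T 1 - 1 : Laur) * T n = T (1 + n) - T n := by
    rw [sub_mul, one_mul, ← LaurentPolynomial.T_add]
  rw [LinearMap.comp_apply, LinearMap.mulLeft_apply, e, map_sub, Laur.lift_T, Laur.lift_T]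
  refine Subtype.ext (Prod.ext ?_ ?_)
  · change ((T 1 - 1 : Laur) * T n) • Witt.euler =
      (Witt.d (1 + n) - Witt.d 0) - (Witt.d n - Witt.d 0)
    rw [e, Witt.sub_smul_euler]
    simp [Witt.d]
  · exact (sub_zero (0 : L ⊗[ℂ] Laur)).symm

/-- `𝔞₀` is spanned by the `d_n - d₀` and the `x ⊗ tⁿ`. -/
lemma aSub_zero_hom_ext {N : Type*} [AddCommGroup N] [Module ℂ N] {f f' : d.aSub 0 →ₗ[ℂ] N}
    (h1 : ∀ n, f (d.aD n) = f' (d.aD n))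
    (h2 : ∀ x n, f (d.aLoop (x ⊗ₜ T n)) = f' (d.aLoop (x ⊗ₜ T n))) : f = f' := by
  have e1 : f ∘ₗ Laur.lift d.aD = f' ∘ₗ Laur.lift d.aD :=
    Laur.hom_ext fun n => by simpa using h1 n
  have e2 : f ∘ₗ d.aLoop = f' ∘ₗ d.aLoop :=
    TensorProduct.ext (LinearMap.ext fun x => Laur.hom_ext fun n => h2 x n)
  ext X
  obtain ⟨h, y, rfl⟩ := d.exists_eq_aVec_add_aLoop X
  rw [map_add, map_add, aVec_eq_lift]
  exact congrArg₂ (· + ·) (LinearMap.congr_fun e1 _) (LinearMap.congr_fun e2 y)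

@[simp] lemma aD_zero : d.aD 0 = 0 := Subtype.ext (Prod.ext (sub_self _) rfl)

/-- The inclusion `𝔞₀ → 𝔏̃`. -/
def aExt : Hom d.aZero d.affineExt where
  toLin := (LinearMap.prodMap LinearMap.id (LinearMap.inl ℂ (L ⊗[ℂ] Laur) Laur)) ∘ₗ
    (d.aSub 0).subtype
  map_mem := fun hX => ⟨hX.1, hX.2, zero_mem _⟩
  map_bracket X Y := by
    refine Prod.ext rfl (Prod.ext rfl ?_)
    change (0 : Laur) = X.1.1 0 - Y.1.1 0 + 0
    simp

lemma aExt_aD (n : ℤ) : d.aExt.toLin (d.aD n) =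
    SuperMod.wittElt d n + (-1 : ℂ) • SuperMod.wittElt d 0 := by
  refine Prod.ext ?_ (Prod.ext ?_ ?_)
  · change Witt.d n - Witt.d 0 = Witt.d n + (-1 : ℂ) • Witt.d 0
    ext1 a
    simp [sub_eq_add_neg]
  · change (0 : L ⊗[ℂ] Laur) = 0 + (-1 : ℂ) • 0
    rw [smul_zero, add_zero]
  · change (0 : Laur) = 0 + (-1 : ℂ) • 0
    rw [smul_zero, add_zero]

/-- `𝔏̃` is spanned by the `d_n`, the `x ⊗ tⁿ` and the `tⁿ`. -/
lemma affineExt_hom_ext {N : Type*} [AddCommGroup N] [Module ℂ N]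
    {f f' : Witt × ((L ⊗[ℂ] Laur) × Laur) →ₗ[ℂ] N}
    (h1 : ∀ n, f (SuperMod.wittElt d n) = f' (SuperMod.wittElt d n))
    (h2 : ∀ x n, f (SuperMod.loopElt d x n) = f' (SuperMod.loopElt d x n))
    (h3 : ∀ n, f (SuperMod.laurElt d (T n)) = f' (SuperMod.laurElt d (T n))) : f = f' := by
  refine LinearMap.prod_ext (Witt.hom_ext h1) (LinearMap.prod_ext ?_ (Laur.hom_ext h3))
  exact TensorProduct.ext (LinearMap.ext fun x => Laur.hom_ext fun n => h2 x n)

end LieSuperalgebra.EvenDerivation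

namespace SuperMod

variable {L : Type v} [AddCommGroup L] [Module ℂ L] {g : LieSuperalgebra L}
  {d : LieSuperalgebra.EvenDerivation g}

section
variable (V : SuperMod.{u} d.aZero) (lam : ℂ)

lemma tensorAct_laurElt (a b : Laur) (m : V.carrier) :
    V.tensorAct lam (laurElt d a) (b ⊗ₜ[ℂ] m) = (a * b) ⊗ₜ[ℂ] m := by
  change V.tensorAct lam (0, (0, a)) (b ⊗ₜ m) = _
  rw [tensorAct_apply, tensorLaur_apply]
  simp only [map_zero, LinearMap.zero_apply, zero_add]

lemma tensorAct_wittElt (i j : ℤ) (m : V.carrier) :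
    V.tensorAct lam (wittElt d i) ((T j : Laur) ⊗ₜ[ℂ] m) =
      (lam + j) • ((T (i + j) : Laur) ⊗ₜ[ℂ] m) + (T (i + j) : Laur) ⊗ₜ[ℂ] V.act (d.aD i) m :=
  V.tensorObj_act_witt lam i j m

lemma tensorAct_loopElt (x : L) (i j : ℤ) (m : V.carrier) :
    V.tensorAct lam (loopElt d x i) ((T j : Laur) ⊗ₜ[ℂ] m) =
      (T (i + j) : Laur) ⊗ₜ[ℂ] V.act (d.aLoop (x ⊗ₜ T i)) m :=
  V.tensorObj_act_loop lam x i j m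

lemma tensorAct_wittElt_zero (j : ℤ) (m : V.carrier) :
    V.tensorAct lam (wittElt d 0) ((T j : Laur) ⊗ₜ[ℂ] m) =
      (lam + j) • ((T j : Laur) ⊗ₜ[ℂ] m) := by
  rw [tensorAct_wittElt, d.aD_zero, map_zero, LinearMap.zero_apply, TensorProduct.tmul_zero,
    add_zero, zero_add]

/-- Evaluation at `t = 1` is a morphism of `𝔞₀`-modules `F_λ(V) → V`. -/
lemma evalTensor_act (X : d.aSub 0) (z : Laur ⊗[ℂ] V.carrier) :
    Laur.evalTensor V.carrier (V.tensorAct lam (d.aExt.toLin X) z) =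
      V.act X (Laur.evalTensor V.carrier z) := by
  have key : (V.tensorAct lam ∘ₗ d.aExt.toLin).compr₂ (Laur.evalTensor V.carrier) =
      V.act.compl₂ (Laur.evalTensor V.carrier) := by
    refine d.aSub_zero_hom_ext (fun n => ?_) fun x n => ?_
    · refine TensorProduct.ext (Laur.hom_ext fun j => LinearMap.ext fun m => ?_)
      change Laur.evalTensor V.carrier (V.tensorAct lam (d.aExt.toLin (d.aD n)) (T j ⊗ₜ m)) =
        V.act (d.aD n) (Laur.evalTensor V.carrier (T j ⊗ₜ m))
      rw [d.aExt_aD, map_add, map_smul, LinearMap.add_apply, LinearMap.smul_apply,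
        tensorAct_wittElt_zero, tensorAct_wittElt]
      simp
    · refine TensorProduct.ext (Laur.hom_ext fun j => LinearMap.ext fun m => ?_)
      change Laur.evalTensor V.carrier (V.tensorAct lam (loopElt d x n) (T j ⊗ₜ m)) =
        V.act (d.aLoop (x ⊗ₜ T n)) (Laur.evalTensor V.carrier (T j ⊗ₜ m))
      rw [tensorAct_loopElt]
      simp
  exact LinearMap.congr_fun₂ key X z

variable {V lam}

/-- Every eigenvector of `d₀` in `F_λ(V)` is a sum of terms `tʲ ⊗ m` of the same weight. -/
lemma tmul_eq_zero_of_weight {m : ℤ →₀ V.carrier} {μ : ℂ}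
    (h : V.tensorAct lam (wittElt d 0) (∑ j ∈ m.support, (T j : Laur) ⊗ₜ[ℂ] m j) =
      μ • ∑ j ∈ m.support, (T j : Laur) ⊗ₜ[ℂ] m j) {j : ℤ} (hj : μ ≠ lam + j) : m j = 0 := by
  by_contra hm
  refine hm ((Laur.T_tmul_eq_zero_iff j _).1 ?_)
  exact Module.End.eq_zero_of_sum_eigenvectors (V.tensorAct lam (wittElt d 0))
    (μ := fun j : ℤ => lam + j) (fun i j hij => by simpa using hij) m.support
    (m := fun j => (T j : Laur) ⊗ₜ[ℂ] m j) (fun j => V.tensorAct_wittElt_zero lam j (m j)) h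
    (Finsupp.mem_support_iff.2 hm) hj

/-- The weight space `F_λ(V)_λ` is `1 ⊗ V`. -/
lemma eq_one_tmul_of_weight {z : Laur ⊗[ℂ] V.carrier}
    (h : V.tensorAct lam (wittElt d 0) z = lam • z) :
    z = 1 ⊗ₜ Laur.evalTensor V.carrier z := by
  obtain ⟨m, rfl⟩ := Laur.exists_eq_sum_T_tmul z
  have h0 : ∀ j, j ≠ 0 → m j = 0 := fun j hj =>
    tmul_eq_zero_of_weight h (by simpa using hj)
  have e : ∑ j ∈ m.support, (T j : Laur) ⊗ₜ[ℂ] m j = 1 ⊗ₜ m 0 := by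
    rw [← LaurentPolynomial.T_zero]
    refine Finset.sum_eq_single 0 (fun j _ hj => by rw [h0 j hj, TensorProduct.tmul_zero]) ?_
    intro hm
    rw [Finsupp.notMem_support_iff.1 hm, TensorProduct.tmul_zero]
  rw [e]
  simp

end

/-- `F_λ` is full: a morphism `F_λ(V) → F_λ(V')` preserves the weight space `1 ⊗ V` and commutes
with `A`, so it is determined by its evaluation at `t = 1`. -/
lemma exists_tensorMap_eq {V V' : SuperMod.{u} d.aZero} {lam : ℂ}
    (f : Hom (V.tensorObj lam) (V'.tensorObj lam)) : ∃ φ : Hom V V', tensorMap φ lam = f := by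
  let F : Laur ⊗[ℂ] V.carrier →ₗ[ℂ] Laur ⊗[ℂ] V'.carrier := f.toLin
  let φ : V.carrier →ₗ[ℂ] V'.carrier :=
    Laur.evalTensor V'.carrier ∘ₗ F ∘ₗ TensorProduct.mk ℂ Laur V.carrier 1
  have hact : ∀ X z, F (V.tensorAct lam X z) = V'.tensorAct lam X (F z) := f.map_act
  have h1 : ∀ m, F (1 ⊗ₜ m) = 1 ⊗ₜ φ m := fun m => by
    refine eq_one_tmul_of_weight (lam := lam) ?_
    have e := V.tensorAct_wittElt_zero lam 0 m
    rw [LaurentPolynomial.T_zero, Int.cast_zero, add_zero] at e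
    rw [← hact, e, map_smul]
  have h2 : F = LinearMap.lTensor Laur φ := by
    refine TensorProduct.ext' fun a m => ?_
    have e := hact (laurElt d a) (1 ⊗ₜ m)
    rwa [h1, tensorAct_laurElt, tensorAct_laurElt, mul_one] at e
  have h3 : ∀ z, Laur.evalTensor V'.carrier (F z) = φ (Laur.evalTensor V.carrier z) := fun z => by
    rw [h2]
    induction z with
    | zero => simp
    | add a b ha hb => simp only [map_add, ha, hb]
    | tmul a m => simp
  have h4 : ∀ {i : ZMod 2} {a : V.carrier}, a ∈ V.part i → φ a ∈ V'.part i := fun {i a} ha => by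
    have e : (1 : Laur) ⊗ₜ[ℂ] a ∈ LinearMap.range (LinearMap.lTensor Laur (V.part i).subtype) :=
      ⟨1 ⊗ₜ ⟨a, ha⟩, rfl⟩
    exact Laur.evalTensor_mem (z := F (1 ⊗ₜ a)) (f.map_mem e)
  refine ⟨⟨φ, h4, fun X a => ?_⟩, Hom.ext h2.symm⟩
  · have e := V.evalTensor_act lam X (1 ⊗ₜ a)
    rw [Laur.evalTensor_tmul, map_one, one_smul] at e
    rw [← e, ← h3, hact, evalTensor_act]
    rfl

instance (lam : ℂ) : (tensorFunctor.{u} d lam).Full where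
  map_surjective f := exists_tensorMap_eq f

instance (lam : ℂ) : (tensorFunctor.{u} d lam).Faithful where
  map_injective {V V'} φ ψ h := by
    refine Hom.ext (LinearMap.ext fun m => ?_)
    have h1 : LinearMap.lTensor Laur (Hom.toLin (V := V) (V' := V') φ) =
      LinearMap.lTensor Laur (Hom.toLin (V := V) (V' := V') ψ) := congrArg Hom.toLin h
    simpa using congrArg (Laur.evalTensor V'.carrier) (LinearMap.congr_fun h1 (1 ⊗ₜ m))

/-- `F_λ(V)` lies in `𝒥_λ` for finite-dimensional `V`. -/
lemma jet_tensorObj (V : SuperMod.{u} d.aZero) [FiniteDimensional ℂ V.carrier] (lam : ℂ) :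
    jet d lam (V.tensorObj lam) := by
  have hA : (V.tensorObj lam).IsAModule := by
    constructor
    · refine LinearMap.congr_fun (f := V.tensorAct lam (laurElt d 1)) (g := LinearMap.id)
        (TensorProduct.ext' fun b m => ?_)
      rw [tensorAct_laurElt, one_mul, LinearMap.id_apply]
    · intro a b
      refine LinearMap.congr_fun (f := V.tensorAct lam (laurElt d (a * b)))
        (g := V.tensorAct lam (laurElt d a) ∘ₗ V.tensorAct lam (laurElt d b))
        (TensorProduct.ext' fun c m => ?_)
      rw [LinearMap.comp_apply, tensorAct_laurElt, tensorAct_laurElt, tensorAct_laurElt, mul_assoc]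
  refine ⟨⟨?_, hA, ?_⟩, fun μ hμ => ?_⟩
  · refine eq_top_iff.2 fun z _ => ?_
    obtain ⟨m, rfl⟩ := Laur.exists_eq_sum_T_tmul (E := V.carrier) z
    refine Submodule.sum_mem _ fun j _ => ?_
    exact Submodule.mem_iSup_of_mem (lam + j)
      (Module.End.mem_eigenspace_iff.2 (V.tensorAct_wittElt_zero lam j (m j)))
  · let := hA.toModule
    let e : (Laur ⊗[ℂ] V.carrier) ≃ₗ[Laur] (V.tensorObj lam).carrier :=
      { AddEquiv.refl (Laur ⊗[ℂ] V.carrier) with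
        map_smul' := fun a z => by
          change a • z = V.tensorAct lam (laurElt d a) z
          induction z with
          | zero => rw [smul_zero, map_zero]
          | add x y hx hy => rw [smul_add, map_add, hx, hy]
          | tmul b m => rw [tensorAct_laurElt, TensorProduct.smul_tmul', smul_eq_mul] }
    exact ⟨Module.Free.of_equiv e, Module.Finite.equiv e⟩
  · obtain ⟨z, hz, hz0⟩ := Submodule.exists_mem_ne_zero_of_ne_bot hμ
    obtain ⟨m, rfl⟩ := Laur.exists_eq_sum_T_tmul (E := V.carrier) z
    by_contra hne
    refine hz0 (Finset.sum_eq_zero fun j _ => ?_)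
    rw [tmul_eq_zero_of_weight (Module.End.mem_eigenspace_iff.1 hz) (j := j)
      fun h => hne ⟨j, h⟩, TensorProduct.tmul_zero]
    rfl

end SuperMod

/-! ### The fibre at `t = 1` and essential surjectivity -/

namespace SuperMod

section
variable {L : Type v} [AddCommGroup L] [Module ℂ L] {g : LieSuperalgebra L}

/-- A bijective morphism of modules is an isomorphism. -/
def isoOfBijective {V V' : SuperMod.{u} g} (f : Hom V V') (hf : Function.Bijective f.toLin) :
    V ≅ V' where
  hom := f
  inv := show Hom V' V from
    { toLin := (LinearEquiv.ofBijective f.toLin hf).symm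
      map_mem := fun {i a} ha => by
        refine IsCompl.mem_of_map_mem V.isCompl V'.isCompl hf.1 (fun i a => f.map_mem) (i := i) ?_
        change LinearEquiv.ofBijective f.toLin hf _ ∈ _
        simpa using ha
      map_act := fun x a => by
        refine hf.1 ?_
        rw [f.map_act]
        change LinearEquiv.ofBijective f.toLin hf _ =
          V'.act x (LinearEquiv.ofBijective f.toLin hf _)
        simp }
  hom_inv_id := Hom.ext (LinearMap.ext fun m =>
    (LinearEquiv.ofBijective f.toLin hf).symm_apply_apply m)
  inv_hom_id := Hom.ext (LinearMap.ext fun m =>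
    (LinearEquiv.ofBijective f.toLin hf).apply_symm_apply m)

end

variable {L : Type v} [AddCommGroup L] [Module ℂ L] {g : LieSuperalgebra L}
  {d : LieSuperalgebra.EvenDerivation g} {V : SuperMod.{u} d.affineExt} {lam : ℂ}

lemma laurElt_mem (a : Laur) : laurElt d a ∈ d.affineExt.part 0 :=
  ⟨zero_mem _, zero_mem _, by simp⟩

lemma wittElt_mem (n : ℤ) : wittElt d n ∈ d.affineExt.part 0 :=
  ⟨by simp, zero_mem _, zero_mem _⟩

lemma bracket_laurElt (a : Laur) (X : Witt × ((L ⊗[ℂ] Laur) × Laur)) :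
    d.affineExt.bracket (laurElt d a) X = laurElt d (-(X.1 a)) := by
  refine Prod.ext ?_ (Prod.ext ?_ ?_)
  · change ⁅(0 : Witt), X.1⁆ = 0
    exact zero_lie X.1
  · change d.wittLin 0 X.2.1 - d.wittLin X.1 0 + g.loop.bracket 0 X.2.1 = 0
    simp
  · change (0 : Witt) X.2.2 - X.1 a + 0 = -(X.1 a)
    simp

lemma bracket_wittElt_zero_wittElt (n : ℤ) :
    d.affineExt.bracket (wittElt d 0) (wittElt d n) = (n : ℂ) • wittElt d n := by
  refine Prod.ext ?_ (Prod.ext ?_ ?_)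
  · change ⁅Witt.d 0, Witt.d n⁆ = (n : ℂ) • Witt.d n
    rw [Witt.lie_d]
    simp
  · change d.wittLin (Witt.d 0) 0 - d.wittLin (Witt.d n) 0 + g.loop.bracket 0 0 = (n : ℂ) • 0
    simp
  · change Witt.d 0 0 - Witt.d n 0 + 0 = (n : ℂ) • (0 : Laur)
    simp

lemma bracket_wittElt_zero_loopElt (x : L) (n : ℤ) :
    d.affineExt.bracket (wittElt d 0) (loopElt d x n) = (n : ℂ) • loopElt d x n := by
  refine Prod.ext ?_ (Prod.ext ?_ ?_)
  · change ⁅Witt.d 0, (0 : Witt)⁆ = (n : ℂ) • 0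
    exact (lie_zero (Witt.d 0)).trans (smul_zero _).symm
  · change d.wittLin (Witt.d 0) (x ⊗ₜ T n) - d.wittLin 0 0 + g.loop.bracket 0 (x ⊗ₜ T n) =
      (n : ℂ) • (x ⊗ₜ T n)
    simp [Witt.d_apply_T, Witt.dsymb_apply]
  · change Witt.d 0 0 - (0 : Witt) 0 + 0 = (n : ℂ) • (0 : Laur)
    simp

/-- Elements of `𝔏̃` act on an `𝔏̃`-module by differential operators of order one over `A`. -/
lemma act_act_laurElt (X : Witt × ((L ⊗[ℂ] Laur) × Laur)) (a : Laur) (m : V.carrier) :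
    V.act X (V.act (laurElt d a) m) =
      V.act (laurElt d a) (V.act X m) + V.act (laurElt d (X.1 a)) m := by
  have h := V.act_bracket_even (laurElt_mem a) X m
  have e : laurElt d (-(X.1 a)) = -laurElt d (X.1 a) := by
    refine Prod.ext neg_zero.symm (Prod.ext neg_zero.symm rfl)
  rw [bracket_laurElt, e, map_neg, LinearMap.neg_apply] at h
  rw [eq_sub_iff_add_eq, neg_add_eq_iff_eq_add] at h
  rw [h, add_comm]

lemma mem_weightSpace_iff {μ : ℂ} {m : V.carrier} :
    m ∈ V.weightSpace μ ↔ V.act (wittElt d 0) m = μ • m := Module.End.mem_eigenspace_iff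

lemma act_T_mem_weightSpace {μ : ℂ} (n : ℤ) {m : V.carrier} (hm : m ∈ V.weightSpace μ) :
    V.act (laurElt d (T n)) m ∈ V.weightSpace (μ + n) := by
  rw [mem_weightSpace_iff] at hm ⊢
  have e : laurElt d ((wittElt d 0).1 (T n)) = (n : ℂ) • laurElt d (T n) := by
    refine Prod.ext (smul_zero _).symm (Prod.ext (smul_zero _).symm ?_)
    change Witt.d 0 (T n) = (n : ℂ) • T n
    rw [Witt.d_apply_T, add_zero]
  rw [act_act_laurElt, hm, e, map_smul, map_smul, LinearMap.smul_apply, add_smul]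

lemma act_wittElt_mem_weightSpace {μ : ℂ} (n : ℤ) {m : V.carrier} (hm : m ∈ V.weightSpace μ) :
    V.act (wittElt d n) m ∈ V.weightSpace (μ + n) := by
  rw [mem_weightSpace_iff] at hm ⊢
  have h := V.act_bracket_even (wittElt_mem 0) (wittElt d n) m
  rw [bracket_wittElt_zero_wittElt, map_smul, LinearMap.smul_apply, hm, map_smul,
    eq_sub_iff_add_eq] at h
  rw [← h, add_smul, add_comm]

lemma act_loopElt_mem_weightSpace {μ : ℂ} (x : L) (n : ℤ) {m : V.carrier}
    (hm : m ∈ V.weightSpace μ) : V.act (loopElt d x n) m ∈ V.weightSpace (μ + n) := by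
  rw [mem_weightSpace_iff] at hm ⊢
  have h := V.act_bracket_even (wittElt_mem 0) (loopElt d x n) m
  rw [bracket_wittElt_zero_loopElt, map_smul, LinearMap.smul_apply, hm, map_smul,
    eq_sub_iff_add_eq] at h
  rw [← h, add_smul, add_comm]

variable (V lam) in
/-- The multiplication map `A ⊗ V_λ → V`. -/
def weightMul : Laur ⊗[ℂ] V.weightSpace lam →ₗ[ℂ] V.carrier :=
  TensorProduct.lift ((V.act ∘ₗ LinearMap.inr ℂ _ _ ∘ₗ LinearMap.inr ℂ _ _).compl₂
    (V.weightSpace lam).subtype)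

lemma weightMul_tmul (a : Laur) (m : V.weightSpace lam) :
    V.weightMul lam (a ⊗ₜ m) = V.act (laurElt d a) m := rfl

lemma IsAModule.act_T_act_T (h : V.IsAModule) (i j : ℤ) (m : V.carrier) :
    V.act (laurElt d (T i)) (V.act (laurElt d (T j)) m) = V.act (laurElt d (T (i + j))) m := by
  rw [← h.mul_act, LaurentPolynomial.T_add]

lemma IsAModule.act_T_zero (h : V.IsAModule) (m : V.carrier) :
    V.act (laurElt d (T 0)) m = m := by
  rw [LaurentPolynomial.T_zero, h.one_act]

lemma weightMul_T_tmul_of_mem (h : V.IsAModule) {n : ℤ} {m : V.carrier}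
    (hm : m ∈ V.weightSpace (lam + n)) : ∃ m' : V.weightSpace lam,
      V.weightMul lam ((T n : Laur) ⊗ₜ m') = m := by
  have h1 := act_T_mem_weightSpace (-n) hm
  rw [show lam + n + ((-n : ℤ) : ℂ) = lam by push_cast; ring] at h1
  refine ⟨⟨_, h1⟩, ?_⟩
  rw [weightMul_tmul]
  change V.act (laurElt d (T n)) (V.act (laurElt d (T (-n))) m) = m
  rw [h.act_T_act_T, add_neg_cancel, h.act_T_zero]

/-- In a module of `𝒥_λ` the powers of `t` translate the weight space of weight `λ`
isomorphically to all the others. -/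
lemma weightMul_bijective (hV : jet d lam V) : Function.Bijective (V.weightMul lam) := by
  obtain ⟨⟨hw, hA, -⟩, hs⟩ := hV
  constructor
  · refine (injective_iff_map_eq_zero _).2 fun z hz => ?_
    obtain ⟨m, rfl⟩ := Laur.exists_eq_sum_T_tmul z
    refine Finset.sum_eq_zero fun j hj => ?_
    have h := Module.End.mem_of_sum_eigenvectors_mem (V.act (wittElt d 0)) (N := ⊥)
      (fun m hm => by rw [(Submodule.mem_bot ℂ).1 hm]; simp) (μ := fun j : ℤ => lam + j)
      (fun i j hij => by simpa using hij) m.support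
      (fun j => V.act (laurElt d (T j)) (m j))
      (fun j => mem_weightSpace_iff.1 (act_T_mem_weightSpace j (m j).2))
      (by
        rw [map_sum] at hz
        exact hz) j hj
    have h0 : V.act (laurElt d (T j)) (m j) = 0 := (Submodule.mem_bot ℂ).1 h
    have h1 := hA.act_T_act_T (-j) j (m j)
    rw [h0, map_zero, neg_add_cancel, hA.act_T_zero] at h1
    have h2 : m j = 0 := Subtype.ext h1.symm
    rw [h2, TensorProduct.tmul_zero]
  · rw [← LinearMap.range_eq_top, eq_top_iff, ← show _ = ⊤ from hw]
    refine iSup_le fun μ m hm => ?_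
    by_cases hm0 : m = 0
    · exact hm0 ▸ zero_mem _
    · obtain ⟨n, rfl⟩ := hs (show V.weightSpace μ ≠ ⊥ from
        fun h => hm0 ((Submodule.mem_bot ℂ).1 (h ▸ hm)))
      obtain ⟨m', hm'⟩ := weightMul_T_tmul_of_mem hA hm
      exact ⟨_, hm'⟩

/-- The isomorphism `A ⊗ V_λ ≃ V` for a module `V` of `𝒥_λ`. -/
def weightEquiv (hV : jet d lam V) : (Laur ⊗[ℂ] V.weightSpace lam) ≃ₗ[ℂ] V.carrier :=
  LinearEquiv.ofBijective (V.weightMul lam) (weightMul_bijective hV)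

/-- The projection `tʲ m ↦ m` of `V` onto `V_λ`. Its kernel is `(t - 1) V`, so that it identifies
`V_λ` with the fibre of `V` at `t = 1`. -/
def weightProj (hV : jet d lam V) : V.carrier →ₗ[ℂ] V.weightSpace lam :=
  Laur.evalTensor _ ∘ₗ (weightEquiv hV).symm.toLinearMap

lemma weightProj_weightMul (hV : jet d lam V) (z : Laur ⊗[ℂ] V.weightSpace lam) :
    weightProj hV (V.weightMul lam z) = Laur.evalTensor _ z :=
  congrArg (Laur.evalTensor _) ((weightEquiv hV).symm_apply_apply z)

lemma weightProj_act (hV : jet d lam V) (a : Laur) (m : V.weightSpace lam) :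
    weightProj hV (V.act (laurElt d a) m) = Laur.evalOne a • m := by
  rw [← weightMul_tmul, weightProj_weightMul, Laur.evalTensor_tmul]

lemma weightProj_coe (hV : jet d lam V) (m : V.weightSpace lam) :
    weightProj hV (m : V.carrier) = m := by
  have h := weightProj_act hV 1 m
  rwa [hV.1.2.1.one_act, map_one, one_smul] at h

/-- To check an equation of linear maps on a module of `𝒥_λ` it suffices to consider the `a m` with
`a ∈ A` and `m ∈ V_λ`. -/
lemma jet_hom_ext (hV : jet d lam V) {N : Type*} [AddCommGroup N] [Module ℂ N]
    {f f' : V.carrier →ₗ[ℂ] N} (h : ∀ a (m : V.weightSpace lam),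
      f (V.act (laurElt d a) m) = f' (V.act (laurElt d a) m)) : f = f' := by
  have e : f ∘ₗ V.weightMul lam = f' ∘ₗ V.weightMul lam := TensorProduct.ext' h
  refine LinearMap.ext fun m => ?_
  obtain ⟨z, rfl⟩ := (weightMul_bijective hV).2 m
  exact LinearMap.congr_fun e z

lemma weightProj_act_laurElt (hV : jet d lam V) (a : Laur) (m : V.carrier) :
    weightProj hV (V.act (laurElt d a) m) = Laur.evalOne a • weightProj hV m := by
  refine LinearMap.congr_fun (f := weightProj hV ∘ₗ V.act (laurElt d a))
    (g := Laur.evalOne a • weightProj hV) (jet_hom_ext hV fun b m => ?_) m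
  rw [LinearMap.comp_apply, LinearMap.smul_apply, ← hV.1.2.1.mul_act, weightProj_act,
    weightProj_act, map_mul, mul_smul]

/-- Elements of `𝔞₀` act on the fibre at `t = 1`. -/
lemma weightProj_act_aExt (hV : jet d lam V) (X : d.aSub 0) (m : V.carrier) :
    weightProj hV (V.act (d.aExt.toLin X) (weightProj hV m)) =
      weightProj hV (V.act (d.aExt.toLin X) m) := by
  -- The vector field component of an element of `𝔞₀` vanishes at `t = 1`.
  have h0 : ∀ a, Laur.evalOne (X.1.1 a) = 0 := fun a => by
    obtain ⟨D, hD⟩ := d.mem_aSub_zero_iff.1 X.2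
    rw [hD]
    simp
  refine LinearMap.congr_fun (f := weightProj hV ∘ₗ V.act (d.aExt.toLin X) ∘ₗ
    (V.weightSpace lam).subtype ∘ₗ weightProj hV) (g := weightProj hV ∘ₗ V.act (d.aExt.toLin X))
    (jet_hom_ext hV fun a m => ?_) m
  simp only [LinearMap.comp_apply, Submodule.subtype_apply]
  rw [weightProj_act, act_act_laurElt, map_add, weightProj_act_laurElt, weightProj_act]
  change _ = _ + Laur.evalOne (X.1.1 a) • m
  rw [h0, zero_smul, add_zero, Submodule.coe_smul, map_smul, map_smul]

/-- `d₀` is even, so its weight spaces are graded. -/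
lemma isCompl_weightSpace (V : SuperMod.{u} d.affineExt) (lam : ℂ) :
    IsCompl ((V.part 0).comap (V.weightSpace lam).subtype)
      ((V.part 1).comap (V.weightSpace lam).subtype) := by
  constructor
  · rw [disjoint_iff, ← Submodule.comap_inf, V.isCompl.inf_eq_bot]
    simp
  · rw [codisjoint_iff, eq_top_iff]
    rintro ⟨m, hm⟩ -
    obtain ⟨a, ha, b, hb, rfl⟩ := Submodule.mem_sup.1
      (V.isCompl.sup_eq_top ▸ Submodule.mem_top : m ∈ V.part 0 ⊔ V.part 1)
    obtain ⟨h0, h1⟩ := IsCompl.apply_eq_smul_of_apply_add_eq_smul V.isCompl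
      (f := V.act (wittElt d 0))
      (fun i a ha => by simpa using V.act_mem (wittElt_mem 0) ha) ha hb (mem_weightSpace_iff.1 hm)
    exact Submodule.mem_sup.2 ⟨⟨a, mem_weightSpace_iff.2 h0⟩, ha, ⟨b, mem_weightSpace_iff.2 h1⟩, hb,
      rfl⟩

lemma weightMul_mem {i : ZMod 2} {z : Laur ⊗[ℂ] V.weightSpace lam}
    (hz : z ∈ LinearMap.range (LinearMap.lTensor Laur
      ((V.part i).comap (V.weightSpace lam).subtype).subtype)) :
    V.weightMul lam z ∈ V.part i := by
  obtain ⟨z, rfl⟩ := hz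
  induction z with
  | zero => simp
  | add a b ha hb => simp only [map_add]; exact add_mem ha hb
  | tmul a m =>
    rw [LinearMap.lTensor_tmul, weightMul_tmul]
    simpa using V.act_mem (laurElt_mem a) m.2

lemma weightProj_mem (hV : jet d lam V) {i : ZMod 2} {m : V.carrier} (hm : m ∈ V.part i) :
    weightProj hV m ∈ (V.part i).comap (V.weightSpace lam).subtype := by
  obtain ⟨z, rfl⟩ := (weightMul_bijective hV).2 m
  rw [weightProj_weightMul]
  exact Laur.evalTensor_mem (IsCompl.mem_of_map_mem (isCompl_lTensor (isCompl_weightSpace V lam))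
    V.isCompl (p := fun i => LinearMap.range (LinearMap.lTensor Laur
      ((V.part i).comap (V.weightSpace lam).subtype).subtype))
    (weightMul_bijective hV).1 (fun i a ha => weightMul_mem ha) hm)

/-- The fibre at `t = 1` of a module `V` of `𝒥_λ`, realized on the weight space `V_λ`, as a module
over `𝔞₀`. -/
def fibre (hV : jet d lam V) : SuperMod.{u} d.aZero where
  carrier := V.weightSpace lam
  part i := (V.part i).comap (V.weightSpace lam).subtype
  isCompl := isCompl_weightSpace V lam
  act := ((V.act ∘ₗ d.aExt.toLin).compr₂ (weightProj hV)).compl₂ (V.weightSpace lam).subtype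
  act_mem hX hm := weightProj_mem hV (V.act_mem (d.aExt.map_mem hX) hm)
  act_bracket {i j X Y} hX hY m := by
    have h := congrArg (weightProj hV)
      (V.act_bracket (d.aExt.map_mem hX) (d.aExt.map_mem hY) (m : V.carrier))
    rw [← d.aExt.map_bracket, map_sub, map_smul, ← weightProj_act_aExt hV X (V.act _ _),
      ← weightProj_act_aExt hV Y (V.act _ _)] at h
    exact h

/-- On the weight space `V_{λ+n}` the projection to `V_λ` is multiplication by `t⁻ⁿ`. -/
lemma act_T_weightProj (hV : jet d lam V) {n : ℤ} {m : V.carrier}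
    (hm : m ∈ V.weightSpace (lam + n)) : V.act (laurElt d (T n)) (weightProj hV m) = m := by
  obtain ⟨m', rfl⟩ := weightMul_T_tmul_of_mem hV.1.2.1 hm
  rw [weightProj_weightMul, Laur.evalTensor_tmul, Laur.evalOne_T, one_smul, weightMul_tmul]

/-- The fibre is the image of a finitely generated `A`-module under a map which is semilinear along
`A → ℂ`, `t ↦ 1`. -/
lemma finiteDimensional_fibre (hV : jet d lam V) : FiniteDimensional ℂ (fibre hV).carrier := by
  obtain ⟨h, -, hfin⟩ := hV.1.2
  let := h.toModule
  let f : V.carrier →ₛₗ[(Laur.evalOne : Laur →+* ℂ)] V.weightSpace lam :=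
    { toFun := weightProj hV
      map_add' := map_add _
      map_smul' := weightProj_act_laurElt hV }
  exact Module.Finite.of_surjective f fun m : V.weightSpace lam => ⟨m, weightProj_coe hV m⟩

/-- The multiplication `A ⊗ V_λ → V` is a morphism from `F_λ` of the fibre. -/
lemma weightMul_act (hV : jet d lam V) (X : Witt × ((L ⊗[ℂ] Laur) × Laur))
    (z : Laur ⊗[ℂ] V.weightSpace lam) :
    V.weightMul lam ((fibre hV).tensorAct lam X z) = V.act X (V.weightMul lam z) := by
  have hA := hV.1.2.1
  have key : ((fibre hV).tensorAct lam).compr₂ (V.weightMul lam) =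
      V.act.compl₂ (V.weightMul lam) := by
    refine d.affineExt_hom_ext (fun n => ?_) (fun x n => ?_) fun n => ?_
    · refine TensorProduct.ext
        (Laur.hom_ext fun j => LinearMap.ext fun (m : V.weightSpace lam) => ?_)
      change V.weightMul lam ((fibre hV).tensorAct lam (wittElt d n) (T j ⊗ₜ m)) =
        V.act (wittElt d n) (V.weightMul lam (T j ⊗ₜ m))
      have e : V.weightMul lam ((fibre hV).tensorAct lam (wittElt d n) (T j ⊗ₜ m)) =
          (lam + j) • V.act (laurElt d (T (n + j))) m + V.act (laurElt d (T (n + j)))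
            (weightProj hV (V.act (d.aExt.toLin (d.aD n)) m)) := by
        refine (congrArg (V.weightMul lam) ((fibre hV).tensorAct_wittElt lam n j m)).trans ?_
        refine (map_add (V.weightMul lam) _ _).trans (congrArg₂ (· + ·) ?_ rfl)
        exact map_smul (V.weightMul lam) (lam + j) ((T (n + j) : Laur) ⊗ₜ[ℂ] m)
      have e1 : laurElt d ((wittElt d n).1 (T j)) = (j : ℂ) • laurElt d (T (n + j)) := by
        refine Prod.ext (smul_zero _).symm (Prod.ext (smul_zero _).symm ?_)
        change Witt.d n (T j) = (j : ℂ) • T (n + j)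
        rw [Witt.d_apply_T, add_comm]
      have e2 := act_T_weightProj hV (act_wittElt_mem_weightSpace n m.2)
      rw [e, d.aExt_aD, map_add, map_smul, LinearMap.add_apply, LinearMap.smul_apply,
        mem_weightSpace_iff.1 m.2, map_add, map_smul, map_smul, weightProj_coe, weightMul_tmul,
        act_act_laurElt, e1, map_smul, LinearMap.smul_apply, Submodule.coe_add, map_add,
        Submodule.coe_smul, Submodule.coe_smul, map_smul, map_smul, add_comm n j,
        ← hA.act_T_act_T j n (weightProj hV _), e2]
      module
    · refine TensorProduct.ext
        (Laur.hom_ext fun j => LinearMap.ext fun (m : V.weightSpace lam) => ?_)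
      change V.weightMul lam ((fibre hV).tensorAct lam (loopElt d x n) (T j ⊗ₜ m)) =
        V.act (loopElt d x n) (V.weightMul lam (T j ⊗ₜ m))
      have e : V.weightMul lam ((fibre hV).tensorAct lam (loopElt d x n) (T j ⊗ₜ m)) =
          V.act (laurElt d (T (n + j))) (weightProj hV (V.act (loopElt d x n) m)) :=
        congrArg (V.weightMul lam) ((fibre hV).tensorAct_loopElt lam x n j m)
      have e1 : laurElt d ((loopElt d x n).1 (T j)) = 0 := rfl
      rw [e, weightMul_tmul, act_act_laurElt, e1, map_zero, LinearMap.zero_apply, add_zero,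
        add_comm n j, ← hA.act_T_act_T, act_T_weightProj hV (act_loopElt_mem_weightSpace x n m.2)]
    · refine TensorProduct.ext
        (Laur.hom_ext fun j => LinearMap.ext fun (m : V.weightSpace lam) => ?_)
      change V.weightMul lam ((fibre hV).tensorAct lam (laurElt d (T n)) (T j ⊗ₜ m)) =
        V.act (laurElt d (T n)) (V.weightMul lam (T j ⊗ₜ m))
      refine (congrArg (V.weightMul lam) ((fibre hV).tensorAct_laurElt lam (T n) (T j) m)).trans ?_
      exact hA.mul_act (T n) (T j) m
  exact LinearMap.congr_fun₂ key X z

/-- Every module `V` of `𝒥_λ` is `F_λ` of its fibre at `t = 1`. -/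
def tensorFibreIso (hV : jet d lam V) : (tensorFunctor d lam).obj (fibre hV) ≅ V :=
  isoOfBijective (V := (fibre hV).tensorObj lam)
    { toLin := V.weightMul lam
      map_mem := weightMul_mem
      map_act := weightMul_act hV } (weightMul_bijective hV)

end SuperMod

/-! ### Simple modules and the functor `F_λ` -/

namespace SuperMod

section
variable {L : Type v} [AddCommGroup L] [Module ℂ L] {g : LieSuperalgebra L}

/-- A subspace is graded if and only if it contains the homogeneous components of its elements. -/
lemma graded_iff (V : SuperMod.{u} g) {N : Submodule ℂ V.carrier} :
    N ≤ (N ⊓ V.part 0) ⊔ (N ⊓ V.part 1) ↔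
      ∀ a ∈ V.part 0, ∀ b ∈ V.part 1, a + b ∈ N → a ∈ N ∧ b ∈ N := by
  constructor
  · intro h a ha b hb hab
    obtain ⟨a', ha', b', hb', e⟩ := Submodule.mem_sup.1 (h hab)
    have h1 : a - a' = b' - b := by
      rw [sub_eq_sub_iff_add_eq_add, ← e, add_comm]
    have h2 := Submodule.disjoint_def.1 V.isCompl.disjoint (a - a') (sub_mem ha ha'.2)
      (h1 ▸ sub_mem hb'.2 hb)
    have e0 : a = a' := sub_eq_zero.1 h2
    have e1 : b' = b := sub_eq_zero.1 (h1.symm.trans h2)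
    exact ⟨e0 ▸ ha'.1, e1 ▸ hb'.1⟩
  · intro h m hm
    obtain ⟨a, ha, b, hb, rfl⟩ := Submodule.mem_sup.1
      (V.isCompl.sup_eq_top ▸ Submodule.mem_top : m ∈ V.part 0 ⊔ V.part 1)
    obtain ⟨h0, h1⟩ := h a ha b hb hm
    exact Submodule.add_mem_sup ⟨h0, ha⟩ ⟨h1, hb⟩

lemma IsSimple.of_bijective {V V' : SuperMod.{u} g} (hV : V.IsSimple) (f : Hom V V')
    (hf : Function.Bijective f.toLin) : V'.IsSimple := by
  have := hV.1
  refine ⟨hf.1.nontrivial, fun N hN => ?_⟩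
  have hmap : (N.comap f.toLin).map f.toLin = N := Submodule.map_comap_eq_of_surjective hf.2 N
  have hsub : V.IsSubmodule (N.comap f.toLin) := by
    refine ⟨V.graded_iff.2 fun a ha b hb hab => ?_, fun x a ha => ?_⟩
    · exact V'.graded_iff.1 hN.graded _ (f.map_mem ha) _ (f.map_mem hb) (map_add f.toLin a b ▸ hab)
    · rw [Submodule.mem_comap, f.map_act]
      exact hN.stable x _ ha
  rcases hV.2 (N.comap f.toLin) hsub with h | h
  · left
    rw [← hmap, h, Submodule.map_bot]
  · right
    rw [← hmap, h, Submodule.map_top, LinearMap.range_eq_top.2 hf.2]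

lemma IsSimple.of_iso {V V' : SuperMod.{u} g} (hV : V.IsSimple) (e : V ≅ V') : V'.IsSimple := by
  refine hV.of_bijective e.hom ⟨?_, ?_⟩
  · exact Function.LeftInverse.injective (g := Hom.toLin (V := V') (V' := V) e.inv) fun m =>
      LinearMap.congr_fun (congrArg Hom.toLin e.hom_inv_id) m
  · exact Function.RightInverse.surjective (g := Hom.toLin (V := V') (V' := V) e.inv) fun m =>
      LinearMap.congr_fun (congrArg Hom.toLin e.inv_hom_id) m

end

section
variable {L : Type v} [AddCommGroup L] [Module ℂ L] {g : LieSuperalgebra L}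
  {L' : Type w} [AddCommGroup L'] [Module ℂ L'] {h : LieSuperalgebra L'}

lemma isSimple_restrict_iff {f : LieSuperalgebra.Hom g h} (hf : Function.Surjective f.toLin)
    (V : SuperMod.{u} h) : ((restrict f).obj V).IsSimple ↔ V.IsSimple := by
  have e : ∀ N : Submodule ℂ V.carrier, ((restrict f).obj V).IsSubmodule N ↔ V.IsSubmodule N := by
    refine fun N => ⟨fun H => ⟨H.graded, fun x a ha => ?_⟩,
      fun H => ⟨H.graded, fun x a ha => H.stable _ a ha⟩⟩
    obtain ⟨y, rfl⟩ := hf x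
    exact H.stable y a ha
  exact and_congr Iff.rfl (forall_congr' fun N => imp_congr (e N) Iff.rfl)

/-- Linear maps commuting with `𝔤` commute with every quotient of `𝔤`. -/
lemma full_restrict {f : LieSuperalgebra.Hom g h} (hf : Function.Surjective f.toLin) :
    (restrict.{u} f).Full where
  map_surjective {V V'} φ := by
    let ψ : Hom V V' :=
      { toLin := (show Hom ((restrict f).obj V) ((restrict f).obj V') from φ).toLin
        map_mem := (show Hom ((restrict f).obj V) ((restrict f).obj V') from φ).map_mem
        map_act := fun x a => by
          obtain ⟨y, rfl⟩ := hf x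
          exact (show Hom ((restrict f).obj V) ((restrict f).obj V') from φ).map_act y a }
    exact ⟨ψ, rfl⟩

instance (f : LieSuperalgebra.Hom g h) : (restrict.{u} f).Faithful where
  map_injective {V V'} _ _ e := Hom.ext (congrArg
    (Hom.toLin (V := (restrict f).obj V) (V' := (restrict f).obj V')) e)

end

variable {L : Type v} [AddCommGroup L] [Module ℂ L] {g : LieSuperalgebra L}
  {d : LieSuperalgebra.EvenDerivation g}

/-- `F_λ` preserves simplicity: a submodule of `F_λ(V)` contains the components of its elements in
the weight spaces `tʲ ⊗ V`, and is therefore `A ⊗ N` for a submodule `N` of `V`. -/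
lemma IsSimple.tensorObj {V : SuperMod.{u} d.aZero} (hV : V.IsSimple) (lam : ℂ) :
    (V.tensorObj lam).IsSimple := by
  have := hV.1
  refine ⟨?_, fun (M : Submodule ℂ (Laur ⊗[ℂ] V.carrier)) hM => ?_⟩
  · obtain ⟨m, hm⟩ := exists_ne (0 : V.carrier)
    exact ⟨(T 0 : Laur) ⊗ₜ[ℂ] m, 0, fun h => hm ((Laur.T_tmul_eq_zero_iff 0 m).1 h)⟩
  have stable : ∀ X, ∀ z ∈ M, V.tensorAct lam X z ∈ M := hM.stable
  let N : Submodule ℂ V.carrier := M.comap (TensorProduct.mk ℂ Laur V.carrier 1)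
  have hN : ∀ m, m ∈ N ↔ (1 : Laur) ⊗ₜ[ℂ] m ∈ M := fun m => Iff.rfl
  have hT : ∀ m j, m ∈ N → (T j : Laur) ⊗ₜ[ℂ] m ∈ M := fun m j hm => by
    have := stable (laurElt d (T j)) _ ((hN m).1 hm)
    rwa [tensorAct_laurElt, mul_one] at this
  have hcoef : ∀ m : ℤ →₀ V.carrier, ∑ j ∈ m.support, (T j : Laur) ⊗ₜ[ℂ] m j ∈ M →
      ∀ j ∈ m.support, m j ∈ N := fun m hm j hj => by
    have h1 := Module.End.mem_of_sum_eigenvectors_mem (V.tensorAct lam (wittElt d 0)) (stable _)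
      (μ := fun j : ℤ => lam + j) (fun i j hij => by simpa using hij) m.support
      (fun j => (T j : Laur) ⊗ₜ[ℂ] m j) (fun j => V.tensorAct_wittElt_zero lam j (m j)) hm j hj
    have h2 := stable (laurElt d (T (-j))) _ h1
    rwa [tensorAct_laurElt, ← LaurentPolynomial.T_add, neg_add_cancel, LaurentPolynomial.T_zero]
      at h2
  have hev : ∀ z ∈ M, Laur.evalTensor V.carrier z ∈ N := fun z hz => by
    obtain ⟨m, rfl⟩ := Laur.exists_eq_sum_T_tmul z
    rw [map_sum]
    refine sum_mem fun j hj => ?_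
    rw [Laur.evalTensor_tmul, Laur.evalOne_T, one_smul]
    exact hcoef m hz j hj
  have hsub : V.IsSubmodule N := by
    refine ⟨V.graded_iff.2 fun a ha b hb hab => ?_, fun X m hm => ?_⟩
    · rw [hN, TensorProduct.tmul_add] at hab
      exact (V.tensorObj lam).graded_iff.1 hM.graded ((1 : Laur) ⊗ₜ[ℂ] a)
        ⟨1 ⊗ₜ ⟨a, ha⟩, rfl⟩ ((1 : Laur) ⊗ₜ[ℂ] b) ⟨1 ⊗ₜ ⟨b, hb⟩, rfl⟩ hab
    · have h1 := hev _ (stable (d.aExt.toLin X) _ ((hN m).1 hm))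
      rwa [evalTensor_act, Laur.evalTensor_tmul, map_one, one_smul] at h1
  rcases hV.2 N hsub with h | h
  · left
    refine (Submodule.eq_bot_iff _).2 fun z hz => ?_
    obtain ⟨m, rfl⟩ := Laur.exists_eq_sum_T_tmul (E := V.carrier) z
    refine Finset.sum_eq_zero fun j hj => ?_
    have h0 : m j = 0 := (Submodule.mem_bot ℂ).1 (h ▸ hcoef m hz j hj)
    rw [h0, TensorProduct.tmul_zero]
  · right
    refine eq_top_iff.2 fun z _ => ?_
    obtain ⟨m, rfl⟩ := Laur.exists_eq_sum_T_tmul (E := V.carrier) z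
    exact Submodule.sum_mem M fun j _ => hT (m j) j (h ▸ Submodule.mem_top)

/-- `F_λ` reflects simplicity: a submodule `N` of `V` gives the submodule `A ⊗ N` of `F_λ(V)`. -/
lemma IsSimple.of_tensorObj {V : SuperMod.{u} d.aZero} {lam : ℂ}
    (hV : (V.tensorObj lam).IsSimple) : V.IsSimple := by
  have hnt : Nontrivial (Laur ⊗[ℂ] V.carrier) := hV.1
  refine ⟨?_, fun N hN => ?_⟩
  · by_contra h
    rw [not_nontrivial_iff_subsingleton] at h
    exact not_subsingleton (Laur ⊗[ℂ] V.carrier) inferInstance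
  let M : Submodule ℂ (Laur ⊗[ℂ] V.carrier) := LinearMap.range (LinearMap.lTensor Laur N.subtype)
  have hM : ∀ (a : Laur), ∀ m ∈ N, a ⊗ₜ[ℂ] m ∈ M := fun a m hm => ⟨a ⊗ₜ ⟨m, hm⟩, rfl⟩
  have stable : ∀ X z, V.tensorAct lam X (LinearMap.lTensor Laur N.subtype z) ∈ M := by
    have key : ((V.tensorAct lam).compr₂ M.mkQ).compl₂ (LinearMap.lTensor Laur N.subtype) = 0 := by
      refine d.affineExt_hom_ext (fun n => ?_) (fun x n => ?_) fun n => ?_ <;>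
        refine TensorProduct.ext (Laur.hom_ext fun j => LinearMap.ext fun m =>
          (Submodule.Quotient.mk_eq_zero M).2 ?_)
      · change V.tensorAct lam (wittElt d n) (T j ⊗ₜ m.1) ∈ M
        rw [tensorAct_wittElt]
        exact add_mem (M.smul_mem _ (hM _ _ m.2)) (hM _ _ (hN.stable _ _ m.2))
      · change V.tensorAct lam (loopElt d x n) (T j ⊗ₜ m.1) ∈ M
        rw [tensorAct_loopElt]
        exact hM _ _ (hN.stable _ _ m.2)
      · change V.tensorAct lam (laurElt d (T n)) (T j ⊗ₜ m.1) ∈ M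
        rw [tensorAct_laurElt]
        exact hM _ _ m.2
    exact fun X z => (Submodule.Quotient.mk_eq_zero M).1 (LinearMap.congr_fun₂ key X z)
  have graded : M ≤ (M ⊓ LinearMap.range (LinearMap.lTensor Laur (V.part 0).subtype)) ⊔
      (M ⊓ LinearMap.range (LinearMap.lTensor Laur (V.part 1).subtype)) := by
    rintro _ ⟨z, rfl⟩
    induction z with
    | zero => rw [map_zero]; exact zero_mem _
    | add a b ha hb => rw [map_add]; exact add_mem ha hb
    | tmul a m =>
      obtain ⟨m0, h0, m1, h1, e⟩ := Submodule.mem_sup.1 (hN.graded m.2)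
      rw [LinearMap.lTensor_tmul, Submodule.subtype_apply, ← e, TensorProduct.tmul_add]
      exact Submodule.add_mem_sup ⟨hM a m0 h0.1, ⟨a ⊗ₜ ⟨m0, h0.2⟩, rfl⟩⟩
        ⟨hM a m1 h1.1, ⟨a ⊗ₜ ⟨m1, h1.2⟩, rfl⟩⟩
  have hsub : (V.tensorObj lam).IsSubmodule M := ⟨graded, by
    rintro X _ ⟨z, rfl⟩
    exact stable X z⟩
  rcases hV.2 M hsub with h | h
  · left
    refine (Submodule.eq_bot_iff _).2 fun m hm => ?_
    have h1 : (T 0 : Laur) ⊗ₜ[ℂ] m ∈ (⊥ : Submodule ℂ (Laur ⊗[ℂ] V.carrier)) := by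
      refine (show M = ⊥ from h) ▸ hM _ m hm
    exact (Laur.T_tmul_eq_zero_iff 0 m).1 ((Submodule.mem_bot ℂ).1 h1)
  · right
    refine eq_top_iff.2 fun m _ => ?_
    have h1 : (1 : Laur) ⊗ₜ[ℂ] m ∈ M := (show M = ⊤ from h) ▸ Submodule.mem_top
    simpa using Laur.evalTensor_mem h1

end SuperMod

/-! ### The filtration by the `𝔞ₖ` and the descent of simple modules to `ĝ` -/

namespace Derivation

lemma mul_apply_pow_mul {R A : Type*} [CommRing R] [CommRing A] [Algebra R A]
    (D : Derivation R A A) (z a : A) (n : ℕ) :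
    z * D (z ^ n * a) = z ^ n * (n * D z * a + z * D a) := by
  rw [Derivation.leibniz, Derivation.leibniz_pow]
  simp only [smul_eq_mul, nsmul_eq_mul]
  rcases n with _ | n
  · simp
  · rw [Nat.add_sub_cancel]
    ring

end Derivation

namespace LieSuperalgebra.EvenDerivation

variable {L : Type v} [AddCommGroup L] [Module ℂ L] {g : LieSuperalgebra L}
  (d : EvenDerivation g)

/-- The inclusion `[𝔞ₖ, 𝔞ₗ] ⊆ 𝔞ₖ₊ₗ` for a vector field and a loop, with `z` in place of `t - 1`. -/
lemma wittLin_mem (z : Laur) (D : Witt) (k l : ℕ) (y : L ⊗[ℂ] Laur) :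
    d.wittLin (z ^ (k + 1) • D) (LinearMap.lTensor L (LinearMap.mulLeft ℂ (z ^ l)) y) ∈
      LinearMap.range (LinearMap.lTensor L (LinearMap.mulLeft ℂ (z ^ (k + l)))) := by
  induction y with
  | zero => simp
  | add a b ha hb => rw [map_add, map_add]; exact add_mem ha hb
  | tmul x a =>
    rw [LinearMap.lTensor_tmul, LinearMap.mulLeft_apply, wittLin_tmul]
    refine add_mem ⟨x ⊗ₜ (l * D z * a + z * D a), ?_⟩
      ⟨d.toLin x ⊗ₜ (((k + 1 : ℕ) * Witt.euler z * Witt.symb D + z * Witt.dsymb D) * a), ?_⟩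
    · rw [LinearMap.lTensor_tmul, LinearMap.mulLeft_apply, pow_add, mul_assoc,
        ← Derivation.mul_apply_pow_mul, Derivation.smul_apply, smul_eq_mul]
      ring_nf
    · have e : Witt.dsymb (z ^ (k + 1) • D) =
          z ^ k * ((k + 1 : ℕ) * Witt.euler z * Witt.symb D + z * Witt.dsymb D) := by
        have e1 : Witt.symb (z ^ (k + 1) • D) = z ^ (k + 1) * Witt.symb D := by
          conv_lhs => rw [← Witt.symb_smul D, smul_smul, Witt.symb_smul_euler]
        rw [Witt.dsymb_apply, e1, Derivation.leibniz, Derivation.leibniz_pow, Nat.add_sub_cancel,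
          Witt.dsymb_apply]
        simp only [smul_eq_mul, nsmul_eq_mul]
        ring
      rw [e, LinearMap.lTensor_tmul, LinearMap.mulLeft_apply]
      congr 1
      ring

lemma loop_bracket_mem (z : Laur) (k l : ℕ) (y y' : L ⊗[ℂ] Laur) :
    g.loop.bracket (LinearMap.lTensor L (LinearMap.mulLeft ℂ (z ^ k)) y)
      (LinearMap.lTensor L (LinearMap.mulLeft ℂ (z ^ l)) y') ∈
        LinearMap.range (LinearMap.lTensor L (LinearMap.mulLeft ℂ (z ^ (k + l)))) := by
  induction y with
  | zero => simp
  | add a b ha hb => rw [map_add, map_add, LinearMap.add_apply]; exact add_mem ha hb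
  | tmul x a =>
    induction y' with
    | zero => simp
    | add a b ha hb => rw [map_add, map_add]; exact add_mem ha hb
    | tmul x' a' =>
      refine ⟨g.bracket x x' ⊗ₜ (a * a'), ?_⟩
      simp only [loop, LinearMap.lTensor_tmul, LinearMap.mulLeft_apply,
        TensorProduct.map₂_apply_tmul, TensorProduct.map_tmul, LinearMap.mul_apply']
      congr 1
      ring

/-- The filtration by the `𝔞ₖ` is compatible with the bracket: `[𝔞ₖ, 𝔞ₗ] ⊆ 𝔞ₖ₊ₗ`. -/
lemma bracket_mem_aSub {k l : ℕ} {X Y : d.aSub 0} (hX : X.1 ∈ d.aSub k) (hY : Y.1 ∈ d.aSub l) :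
    (d.aZero.bracket X Y).1 ∈ d.aSub (k + l) := by
  obtain ⟨⟨D, hD⟩, y, hy⟩ := hX
  obtain ⟨⟨D', hD'⟩, y', hy'⟩ := hY
  have eD : X.1.1 = (T 1 - 1 : Laur) ^ (k + 1) • D := hD.symm
  have eD' : Y.1.1 = (T 1 - 1 : Laur) ^ (l + 1) • D' := hD'.symm
  constructor
  · refine ⟨((l + 1 : ℕ) * D (T 1 - 1) : Laur) • D' +
      (-((k + 1 : ℕ) * D' (T 1 - 1)) : Laur) • D + (T 1 - 1 : Laur) • ⁅D, D'⁆, ?_⟩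
    change (T 1 - 1 : Laur) ^ (k + l + 1) • _ = ⁅X.1.1, Y.1.1⁆
    rw [eD, eD']
    ext1 a
    simp only [Derivation.commutator_apply, Derivation.smul_apply, Derivation.add_apply,
      smul_eq_mul, Derivation.leibniz, Derivation.leibniz_pow, Nat.add_sub_cancel, nsmul_eq_mul]
    ring
  · change d.wittLin X.1.1 Y.1.2 - d.wittLin Y.1.1 X.1.2 + g.loop.bracket X.1.2 Y.1.2 ∈ _
    rw [eD, eD', ← hy, ← hy']
    refine add_mem (sub_mem (d.wittLin_mem _ _ _ _ _) ?_) (loop_bracket_mem _ _ _ _ _)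
    rw [add_comm k l]
    exact d.wittLin_mem _ _ _ _ _

lemma aSub_le_aSub {k l : ℕ} (h : k ≤ l) : d.aSub l ≤ d.aSub k := by
  obtain ⟨n, rfl⟩ := Nat.exists_eq_add_of_le h
  refine Submodule.prod_mono ?_ ?_
  · rintro _ ⟨D, rfl⟩
    refine ⟨(T 1 - 1 : Laur) ^ n • D, ?_⟩
    change (T 1 - 1 : Laur) ^ (k + 1) • (T 1 - 1 : Laur) ^ n • D =
      (T 1 - 1 : Laur) ^ (k + n + 1) • D
    rw [smul_smul, ← pow_add]
    congr 2
    omega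
  · rintro _ ⟨y, rfl⟩
    refine ⟨LinearMap.lTensor L (LinearMap.mulLeft ℂ ((T 1 - 1 : Laur) ^ n)) y, ?_⟩
    rw [← LinearMap.comp_apply, ← LinearMap.lTensor_comp, ← LinearMap.mulLeft_mul, ← pow_add]

/-- The linear section `(c, x) ↦ c (d₁ - d₀) + x ⊗ 1` of `𝔞₀ → ĝ`. -/
def hatSection : ℂ × L →ₗ[ℂ] d.aSub 0 :=
  (LinearMap.toSpanSingleton ℂ _ (d.aVec 1)).coprod
    (d.aLoop ∘ₗ (TensorProduct.mk ℂ L Laur).flip 1)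

lemma hatSection_apply (c : ℂ) (x : L) :
    d.hatSection (c, x) = c • d.aVec 1 + d.aLoop (x ⊗ₜ 1) := rfl

lemma aToHat_aVec (h : Laur) : d.aToHat.toLin (d.aVec h) = (Laur.evalOne h, 0) := by
  refine Prod.ext ?_ ?_
  · change Laur.evalOne (Witt.dsymb (((T 1 - 1 : Laur) * h) • Witt.euler)) = _
    rw [Witt.dsymb_apply, Witt.symb_smul_euler, Derivation.leibniz, Laur.euler_T_one_sub_one]
    simp
  · change TensorProduct.rid ℂ L (LinearMap.lTensor L Laur.evalOne.toLinearMap 0) = 0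
    simp

lemma aToHat_aLoop (x : L) (a : Laur) :
    d.aToHat.toLin (d.aLoop (x ⊗ₜ a)) = (0, Laur.evalOne a • x) := by
  refine Prod.ext ?_ ?_
  · change Laur.evalOne (Witt.dsymb 0) = 0
    simp
  · change TensorProduct.rid ℂ L (LinearMap.lTensor L Laur.evalOne.toLinearMap (x ⊗ₜ a)) = _
    simp

lemma aToHat_hatSection (X : ℂ × L) : d.aToHat.toLin (d.hatSection X) = X := by
  rw [← Prod.mk.eta (p := X), hatSection_apply, map_add, map_smul, aToHat_aVec, aToHat_aLoop]
  simp

lemma aToHat_surjective : Function.Surjective d.aToHat.toLin := fun X => ⟨_, d.aToHat_hatSection X⟩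

lemma hatSection_mem {i : ZMod 2} {X : ℂ × L} (hX : X ∈ d.hat.part i) :
    d.hatSection X ∈ d.aZero.part i := by
  obtain ⟨h1, h2⟩ := hX
  rw [← Prod.mk.eta (p := X), hatSection_apply]
  refine add_mem ?_ (d.aLoop_tmul_mem h2 1)
  rcases zmod2_cases i with rfl | rfl
  · exact Submodule.smul_mem _ _ (d.aVec_mem 1)
  · have h0 : X.1 = 0 := by simpa using h1
    rw [h0, zero_smul]
    exact zero_mem _

end LieSuperalgebra.EvenDerivation

namespace SuperMod

variable {L : Type v} [AddCommGroup L] [Module ℂ L] {g : LieSuperalgebra L}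
  {d : LieSuperalgebra.EvenDerivation g} (V : SuperMod.{u} d.aZero)

/-- Modulo `𝔞₁` every element of `𝔞₀` is in the image of the section of `𝔞₀ → ĝ`. -/
lemma act_hatSection_aToHat (hV : V.IsAnnihilatedBy 1) (X : d.aSub 0) :
    V.act (d.hatSection (d.aToHat.toLin X)) = V.act X := by
  have h1 : ∀ a, V.act (d.aVec ((T 1 - 1) * a)) = 0 := fun a => by
    ext m
    have := d.aVec_mem_aSub 1 a
    rw [pow_one] at this
    exact hV _ this m
  have h2 : ∀ x a, V.act (d.aLoop (x ⊗ₜ ((T 1 - 1) * a))) = 0 := fun x a => by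
    ext m
    have := d.aLoop_tmul_mem_aSub 1 x a
    rw [pow_one] at this
    exact hV _ this m
  obtain ⟨h, y, rfl⟩ := d.exists_eq_aVec_add_aLoop X
  rw [map_add, map_add, map_add, map_add]
  congr 1
  · rw [d.aToHat_aVec, d.hatSection_apply, TensorProduct.zero_tmul, map_zero, add_zero]
    obtain ⟨b, hb⟩ := Laur.exists_eq_evalOne_add h
    conv_rhs => rw [hb, map_add, map_add, h1, add_zero, Algebra.algebraMap_eq_smul_one, map_smul]
  · induction y with
    | zero => simp
    | add a b ha hb => rw [map_add, map_add, map_add, map_add, ha, hb, map_add]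
    | tmul x a =>
      rw [d.aToHat_aLoop, d.hatSection_apply, zero_smul, zero_add]
      obtain ⟨b, hb⟩ := Laur.exists_eq_evalOne_add a
      conv_rhs => rw [hb, TensorProduct.tmul_add, map_add, map_add, h2, add_zero,
        Algebra.algebraMap_eq_smul_one, ← TensorProduct.smul_tmul]

/-- An `𝔞₀`-module annihilated by `𝔞₁`, as a `ĝ`-module. -/
def toHat (hV : V.IsAnnihilatedBy 1) : SuperMod.{u} d.hat where
  carrier := V.carrier
  part := V.part
  isCompl := V.isCompl
  act := V.act ∘ₗ d.hatSection
  act_mem hX ha := V.act_mem (d.hatSection_mem hX) ha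
  act_bracket {i j X Y} hX hY a := by
    have e : d.hat.bracket X Y =
        d.aToHat.toLin (d.aZero.bracket (d.hatSection X) (d.hatSection Y)) := by
      rw [d.aToHat.map_bracket, d.aToHat_hatSection, d.aToHat_hatSection]
    rw [LinearMap.comp_apply, e, V.act_hatSection_aToHat hV]
    exact V.act_bracket (d.hatSection_mem hX) (d.hatSection_mem hY) a

/-- The `ĝ`-module structure on a module annihilated by `𝔞₁` induces the given `𝔞₀`-action. -/
def restrictToHatIso (hV : V.IsAnnihilatedBy 1) :
    V ≅ (restrict d.aToHat).obj (V.toHat hV) :=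
  isoOfBijective (V' := (restrict d.aToHat).obj (V.toHat hV))
    { toLin := LinearMap.id
      map_mem := fun ha => ha
      map_act := fun X a => (LinearMap.congr_fun (V.act_hatSection_aToHat hV X) a).symm }
    Function.bijective_id

section
variable {V} {k : ℕ}

lemma IsAnnihilatedBy.act_bracket_eq_zero (hk : V.IsAnnihilatedBy k) {p q : ℕ} (hpq : k ≤ p + q)
    {X Y : d.aSub 0} (hX : X.1 ∈ d.aSub p) (hY : Y.1 ∈ d.aSub q) (m : V.carrier) :
    V.act (d.aZero.bracket X Y) m = 0 :=
  hk _ (d.aSub_le_aSub hpq (d.bracket_mem_aSub hX hY)) m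

lemma IsAnnihilatedBy.act_aVec (hk : V.IsAnnihilatedBy k) (h : Laur) :
    V.act (d.aVec ((T 1 - 1) ^ k * h)) = 0 :=
  LinearMap.ext fun m => hk _ (d.aVec_mem_aSub k h) m

lemma IsAnnihilatedBy.act_aLoop (hk : V.IsAnnihilatedBy k) (x : L) (a : Laur) :
    V.act (d.aLoop (x ⊗ₜ ((T 1 - 1) ^ k * a))) = 0 :=
  LinearMap.ext fun m => hk _ (d.aLoop_tmul_mem_aSub k x a) m

/-- An odd loop of `𝔞ₖ₊₁` acts by an operator of square zero. -/
lemma eigenvalue_act_aLoop_odd_eq_zero (hk : V.IsAnnihilatedBy (k + 2)) {x : L}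
    (hx : x ∈ g.part 1) (a : Laur) {μ : ℂ}
    (hμ : Module.End.HasEigenvalue (V.act (d.aLoop (x ⊗ₜ ((T 1 - 1) ^ (k + 1) * a)))) μ) :
    μ = 0 := by
  refine (hμ.isNilpotent_of_isNilpotent ⟨2, ?_⟩).eq_zero
  ext m
  have hm := d.aLoop_tmul_mem hx ((T 1 - 1) ^ (k + 1) * a)
  have h1 := V.act_bracket hm hm m
  rw [hk.act_bracket_eq_zero (by omega) (d.aLoop_tmul_mem_aSub (k + 1) x a)
    (d.aLoop_tmul_mem_aSub (k + 1) x a), LieSuperalgebra.superSign_one_one, neg_one_smul,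
    sub_neg_eq_add] at h1
  rw [pow_two]
  exact Module.eq_zero_of_eq_neg (eq_neg_of_add_eq_zero_left h1.symm)

variable [FiniteDimensional ℂ V.carrier]

/-- Modulo `𝔞ₖ₊₂` the vector field `(t-1)ᵏ⁺² h t d/dt` is an eigenvector of `(t-1) t d/dt` of
eigenvalue `k + 1`. -/
lemma eigenvalue_act_aVec_eq_zero (hk : V.IsAnnihilatedBy (k + 2)) (h : Laur) {μ : ℂ}
    (hμ : Module.End.HasEigenvalue (V.act (d.aVec ((T 1 - 1) ^ (k + 1) * h))) μ) : μ = 0 := by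
  have hc : ((k + 1 : ℕ) : ℂ) ≠ 0 := Nat.cast_ne_zero.2 (Nat.succ_ne_zero k)
  have e : d.aZero.bracket (d.aVec 1) (d.aVec ((T 1 - 1) ^ (k + 1) * h)) =
      ((k + 1 : ℕ) : ℂ) • d.aVec ((T 1 - 1) ^ (k + 1) * h) +
        d.aVec ((T 1 - 1) ^ (k + 2) * (((k + 1 : ℕ) : Laur) * h + Witt.euler h)) := by
    rw [d.bracket_aVec_aVec, ← map_smul, ← map_add, Nat.cast_smul_eq_nsmul, nsmul_eq_mul]
    congr 1
    simp only [Derivation.leibniz, Derivation.leibniz_pow, smul_eq_mul, nsmul_eq_mul,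
      Laur.euler_T_one_sub_one, Nat.add_sub_cancel, Derivation.map_one_eq_zero]
    push_cast
    ring
  refine Module.End.eigenvalue_eq_zero_of_commutator_eq_smul (A := V.act (d.aVec 1)) hc ?_ hμ
  ext m
  have h1 := LinearMap.congr_fun (congrArg V.act e) m
  rw [map_add, hk.act_aVec, add_zero, map_smul, V.act_bracket_even (d.aVec_mem _)] at h1
  exact h1

/-- A loop `x ⊗ (t-1)ᵏ⁺¹ a` in an even eigenvector `x` of eigenvalue `β` is, modulo `𝔞ₖ₊₂`, an
eigenvector of `(t-1) t d/dt` of eigenvalue `k + 1 + β`. If the latter vanishes, it is a nonzero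
multiple of a commutator of operators commuting with it. -/
lemma eigenvalue_act_aLoop_even_eq_zero (hk : V.IsAnnihilatedBy (k + 2)) {x : L}
    (hx : x ∈ g.part 0) {β : ℂ} (hβ : d.toLin x = β • x) (a : Laur) {μ : ℂ}
    (hμ : Module.End.HasEigenvalue (V.act (d.aLoop (x ⊗ₜ ((T 1 - 1) ^ (k + 1) * a)))) μ) :
    μ = 0 := by
  by_cases hc : ((k + 1 : ℕ) : ℂ) + β = 0
  -- Bracketing `(t-1)² t d/dt` with `x ⊗ (t-1)ᵏ a` gives `-(k+2) x ⊗ (t-1)ᵏ⁺¹ a` modulo `𝔞ₖ₊₂`.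
  · have hc' : -((k + 2 : ℕ) : ℂ) ≠ 0 := neg_ne_zero.2 (Nat.cast_ne_zero.2 (Nat.succ_ne_zero _))
    have hβ' : β = -((k + 1 : ℕ) : ℂ) := eq_neg_of_add_eq_zero_right hc
    have e : d.aZero.bracket (d.aVec (T 1 - 1)) (d.aLoop (x ⊗ₜ ((T 1 - 1) ^ k * a))) =
        (-((k + 2 : ℕ) : ℂ)) • d.aLoop (x ⊗ₜ ((T 1 - 1) ^ (k + 1) * a)) +
          d.aLoop (x ⊗ₜ ((T 1 - 1) ^ (k + 2) * (Witt.euler a - ((k + 2 : ℕ) : Laur) * a))) := by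
      have e1 : Witt.euler ((T 1 - 1) * (T 1 - 1) : Laur) = 2 * T 1 * (T 1 - 1) := by
        rw [Derivation.leibniz, Laur.euler_T_one_sub_one, smul_eq_mul]
        ring
      have e2 := Derivation.mul_apply_pow_mul Witt.euler (T 1 - 1) a k
      rw [Laur.euler_T_one_sub_one] at e2
      rw [d.bracket_aVec_aLoop hβ, ← map_smul, ← map_add, ← TensorProduct.tmul_smul,
        ← TensorProduct.tmul_add, mul_assoc, e2, e1, hβ', neg_smul, neg_smul,
        Nat.cast_smul_eq_nsmul, Nat.cast_smul_eq_nsmul, nsmul_eq_mul, nsmul_eq_mul]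
      congr 2
      push_cast
      ring
    have hX : (d.aVec (T 1 - 1)).1 ∈ d.aSub 1 := by
      have := d.aVec_mem_aSub 1 1
      rwa [pow_one, mul_one] at this
    have hxx : g.bracket x x = 0 := by
      have := g.bracket_skew hx hx
      rw [LieSuperalgebra.superSign_zero_left, one_smul] at this
      exact Module.eq_zero_of_eq_neg this
    refine Module.End.eigenvalue_eq_zero_of_commutator_central (A := V.act (d.aVec (T 1 - 1)))
      (B := V.act (d.aLoop (x ⊗ₜ ((T 1 - 1) ^ k * a)))) hc' ?_ ?_ ?_ hμ
    · ext m
      have h1 := LinearMap.congr_fun (congrArg V.act e) m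
      rw [map_add, hk.act_aLoop, add_zero, map_smul, V.act_bracket_even (d.aVec_mem _)] at h1
      exact h1
    · ext m
      have h1 := hk.act_bracket_eq_zero (by omega) hX (d.aLoop_tmul_mem_aSub (k + 1) x a) m
      rw [V.act_bracket_even (d.aVec_mem _)] at h1
      exact sub_eq_zero.1 h1
    · ext m
      have h1 := V.act_bracket_even (d.aLoop_tmul_mem hx ((T 1 - 1) ^ k * a))
        (d.aLoop (x ⊗ₜ ((T 1 - 1) ^ (k + 1) * a))) m
      rw [d.bracket_aLoop_aLoop, hxx, TensorProduct.zero_tmul, map_zero, map_zero,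
        LinearMap.zero_apply] at h1
      exact sub_eq_zero.1 h1.symm
  · have e : d.aZero.bracket (d.aVec 1) (d.aLoop (x ⊗ₜ ((T 1 - 1) ^ (k + 1) * a))) =
        (((k + 1 : ℕ) : ℂ) + β) • d.aLoop (x ⊗ₜ ((T 1 - 1) ^ (k + 1) * a)) +
          d.aLoop (x ⊗ₜ ((T 1 - 1) ^ (k + 2) *
            (((k + 1 : ℕ) : Laur) * a + β • a + Witt.euler a))) := by
      have e2 := Derivation.mul_apply_pow_mul Witt.euler (T 1 - 1) a (k + 1)
      rw [Laur.euler_T_one_sub_one] at e2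
      rw [d.bracket_aVec_aLoop hβ, ← map_smul, ← map_add, ← TensorProduct.tmul_smul,
        ← TensorProduct.tmul_add, mul_one, e2, Laur.euler_T_one_sub_one]
      congr 2
      simp only [Algebra.smul_def, map_add, map_natCast]
      push_cast
      ring
    refine Module.End.eigenvalue_eq_zero_of_commutator_eq_smul (A := V.act (d.aVec 1)) hc ?_ hμ
    ext m
    have h1 := LinearMap.congr_fun (congrArg V.act e) m
    rw [map_add, hk.act_aLoop, add_zero, map_smul, V.act_bracket_even (d.aVec_mem _)] at h1
    exact h1

/-- A simple module annihilated by `𝔞ₖ₊₂` is annihilated by `𝔞ₖ₊₁`: the operators by which a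
spanning set of `𝔞ₖ₊₁` acts commute up to sign and have no nonzero eigenvalue, so that they have a
common kernel, which is a submodule. -/
lemma IsSimple.isAnnihilatedBy_succ (hV : V.IsSimple) {S : Type w} (x : Module.Basis S ℂ L)
    {β : S → ℂ} (hβ : ∀ s, d.toLin (x s) = β s • x s) (hk : V.IsAnnihilatedBy (k + 2)) :
    V.IsAnnihilatedBy (k + 1) := by
  have := hV.1
  -- Homogeneous loops in eigenvectors of `d`: these are the ones whose eigenvalues are controlled.
  let P : Set (d.aSub 0) := {X | (∃ h, X = d.aVec ((T 1 - 1) ^ (k + 1) * h)) ∨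
    ∃ (s : S) (i : ZMod 2), ∃ y ∈ g.part i, d.toLin y = β s • y ∧
      ∃ a, X = d.aLoop (y ⊗ₜ ((T 1 - 1) ^ (k + 1) * a))}
  have hPa : ∀ X ∈ P, X.1 ∈ d.aSub (k + 1) := by
    rintro X (⟨h, rfl⟩ | ⟨s, i, y, -, -, a, rfl⟩)
    · exact d.aVec_mem_aSub _ _
    · exact d.aLoop_tmul_mem_aSub _ _ _
  have hPi : ∀ X ∈ P, ∃ i, X ∈ d.aZero.part i := by
    rintro X (⟨h, rfl⟩ | ⟨s, i, y, hy, -, a, rfl⟩)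
    · exact ⟨0, d.aVec_mem _⟩
    · exact ⟨i, d.aLoop_tmul_mem hy _⟩
  have hP0 : ∀ X ∈ P, ∀ μ : ℂ, Module.End.HasEigenvalue (V.act X) μ → μ = 0 := by
    rintro X (⟨h, rfl⟩ | ⟨s, i, y, hy, hs, a, rfl⟩) μ hμ
    · exact eigenvalue_act_aVec_eq_zero hk h hμ
    · rcases LieSuperalgebra.zmod2_cases i with rfl | rfl
      · exact eigenvalue_act_aLoop_even_eq_zero hk hy hs a hμ
      · exact eigenvalue_act_aLoop_odd_eq_zero hk hy a hμ
  obtain ⟨m, hm0, hm⟩ := Module.End.exists_ne_zero_forall_apply_eq_zero (V.act '' P)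
    (by rintro _ ⟨X, hX, rfl⟩; exact hP0 X hX)
    (by
      rintro _ ⟨X, hX, rfl⟩ _ ⟨Y, hY, rfl⟩
      obtain ⟨i, hi⟩ := hPi X hX
      obtain ⟨j, hj⟩ := hPi Y hY
      refine ⟨superSign i j, LinearMap.ext fun m => ?_⟩
      have h1 := V.act_bracket hi hj m
      rw [hk.act_bracket_eq_zero (by omega) (hPa X hX) (hPa Y hY)] at h1
      exact sub_eq_zero.1 h1.symm)
  let N : Submodule ℂ V.carrier := ⨅ X ∈ P, LinearMap.ker (V.act X)
  have hN : ∀ m, m ∈ N ↔ ∀ X ∈ P, V.act X m = 0 := fun m => by simp [N]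
  have hNa : ∀ m ∈ N, ∀ X : d.aSub 0, X.1 ∈ d.aSub (k + 1) → V.act X m = 0 := fun m hm X hX =>
    V.act_eq_zero_of_forall x hβ (fun h => (hN m).1 hm _ (Or.inl ⟨h, rfl⟩))
      (fun s i y hy hs a => (hN m).1 hm _ (Or.inr ⟨s, i, y, hy, hs, a, rfl⟩)) hX
  have hsub : V.IsSubmodule N := by
    refine ⟨V.graded_iff.2 fun a ha b hb hab => ?_, fun Y m hm => (hN _).2 fun X hX => ?_⟩
    · have h0 : ∀ X ∈ P, V.act X a = 0 ∧ V.act X b = 0 := fun X hX => by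
        obtain ⟨i, hi⟩ := hPi X hX
        have h1 := (hN _).1 hab X hX
        rw [map_add] at h1
        have h2 := V.act_mem hi ha
        have h3 := V.act_mem hi hb
        have h4 : V.act X a = 0 := by
          rcases LieSuperalgebra.zmod2_cases i with rfl | rfl
          · refine Submodule.disjoint_def.1 V.isCompl.disjoint _ (by simpa using h2) ?_
            rw [eq_neg_of_add_eq_zero_left h1]
            exact neg_mem (by simpa using h3)
          · refine Submodule.disjoint_def.1 V.isCompl.disjoint _ ?_ (by simpa using h2)
            rw [eq_neg_of_add_eq_zero_left h1]
            exact neg_mem h3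
        rw [h4, zero_add] at h1
        exact ⟨h4, h1⟩
      exact ⟨(hN _).2 fun X hX => (h0 X hX).1, (hN _).2 fun X hX => (h0 X hX).2⟩
    -- `X (Z m) = [X, Z] m ± Z (X m)`, and `[X, Z]` lies in `𝔞ₖ₊₁` again.
    · obtain ⟨i, hi⟩ := hPi X hX
      have hom : ∀ (j : ZMod 2) (Z : d.aSub 0), Z ∈ d.aZero.part j →
          V.act X (V.act Z m) = 0 := fun j Z hZ => by
        have h1 := V.act_bracket hi hZ m
        have h2 := d.bracket_mem_aSub (hPa X hX) (l := 0) Z.2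
        rw [hNa m hm _ h2, (hN m).1 hm X hX, map_zero, smul_zero, sub_zero] at h1
        exact h1.symm
      obtain ⟨Y0, h0, Y1, h1, rfl⟩ := Submodule.mem_sup.1
        (d.aZero.isCompl.sup_eq_top ▸ Submodule.mem_top :
          Y ∈ d.aZero.part 0 ⊔ d.aZero.part 1)
      rw [map_add, LinearMap.add_apply, map_add, hom 0 Y0 h0, hom 1 Y1 h1, add_zero]
  have htop : N = ⊤ := (hV.2 N hsub).resolve_left fun h =>
    hm0 ((Submodule.mem_bot ℂ).1 (h ▸ (hN m).2 fun X hX => hm _ ⟨X, hX, rfl⟩))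
  exact fun X hX m => hNa m (htop ▸ Submodule.mem_top) X hX

/-- A finite-dimensional simple `𝔞₀`-module is annihilated by the kernel `𝔞₁` of `𝔞₀ → ĝ`. -/
lemma IsSimple.isAnnihilatedBy_one (hV : V.IsSimple) {S : Type w} (x : Module.Basis S ℂ L)
    {β : S → ℂ} (hβ : ∀ s, d.toLin (x s) = β s • x s) (hβ1 : ∀ s, β s ≠ 1) :
    V.IsAnnihilatedBy 1 := by
  obtain ⟨k, hk⟩ := V.exists_isAnnihilatedBy x hβ hβ1
  induction k with
  | zero => exact hk
  | succ k ih => exact ih (hV.isAnnihilatedBy_succ x hβ hk)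

end

end SuperMod

end

/-! ### The equivalences of categories -/

theorem mainTheorem1 {𝔤 : Type v} [AddCommGroup 𝔤] [Module ℂ 𝔤] (g : LieSuperalgebra 𝔤)
    (d : g.EvenDerivation) {S : Type w} (x : Module.Basis S ℂ 𝔤) (β : S → ℂ)
    (hβ : ∀ s, d.toLin (x s) = β s • x s) (lam : ℂ) :
    -- `F_λ` is an equivalence from finite dimensional `𝔞₀`-modules to `𝒥_λ`
    (∃ e : (SuperMod.finDim.{u} d.aZero).FullSubcategory ≌
          (SuperMod.jet.{u} d lam).FullSubcategory,
        Nonempty (e.functor ⋙ (SuperMod.jet d lam).ι ≅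
          (SuperMod.finDim d.aZero).ι ⋙ SuperMod.tensorFunctor d lam)) ∧
    ((∀ s, β s ≠ 1) →
      -- every module in `𝒥_λ` is some `F_λ(V')` with `V'` annihilated by some `𝔞ₖ`
      (∀ V : SuperMod.{u} d.affineExt, SuperMod.jet d lam V →
        ∃ V' : SuperMod.{u} d.aZero, FiniteDimensional ℂ V'.carrier ∧
          (∃ k : ℕ, V'.IsAnnihilatedBy k) ∧
          Nonempty (V ≅ (SuperMod.tensorFunctor d lam).obj V')) ∧
      -- `F_λ`, applied to `ĝ`-modules pulled back along `𝔞₀ → ĝ`, is an equivalence from simple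
      -- finite dimensional `ĝ`-modules to simple modules in `𝒥_λ`
      (∃ e : (SuperMod.simpleFinDim.{u} d.hat).FullSubcategory ≌
            (SuperMod.simpleJet.{u} d lam).FullSubcategory,
          Nonempty (e.functor ⋙ (SuperMod.simpleJet d lam).ι ≅
            (SuperMod.simpleFinDim d.hat).ι ⋙
              SuperMod.restrict d.aToHat ⋙ SuperMod.tensorFunctor d lam))) := by
  refine ⟨?_, fun hβ1 => ⟨fun V hV => ?_, ?_⟩⟩
  · have hjet (V : (SuperMod.finDim.{u} d.aZero).FullSubcategory) : SuperMod.jet d lam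
        (((SuperMod.finDim d.aZero).ι ⋙ SuperMod.tensorFunctor d lam).obj V) :=
      have : FiniteDimensional ℂ V.obj.carrier := V.property
      SuperMod.jet_tensorObj V.obj lam
    let F := (SuperMod.jet d lam).lift
      ((SuperMod.finDim d.aZero).ι ⋙ SuperMod.tensorFunctor.{u} d lam) hjet
    have : F.EssSurj := ⟨fun V => ⟨⟨SuperMod.fibre V.property,
      SuperMod.finiteDimensional_fibre V.property⟩,
      ⟨(SuperMod.jet d lam).isoMk (SuperMod.tensorFibreIso V.property)⟩⟩⟩
    have : F.IsEquivalence := {}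
    exact ⟨F.asEquivalence, ⟨(SuperMod.jet d lam).liftCompιIso _ _⟩⟩
  · have := SuperMod.finiteDimensional_fibre hV
    obtain ⟨k, hk⟩ := (SuperMod.fibre hV).exists_isAnnihilatedBy x hβ hβ1
    exact ⟨SuperMod.fibre hV, this, ⟨_, hk⟩, ⟨(SuperMod.tensorFibreIso hV).symm⟩⟩
  · have : (SuperMod.restrict.{u} d.aToHat).Full := SuperMod.full_restrict d.aToHat_surjective
    have hjet (V : (SuperMod.simpleFinDim.{u} d.hat).FullSubcategory) : SuperMod.simpleJet d lam
        (((SuperMod.simpleFinDim d.hat).ι ⋙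
          SuperMod.restrict d.aToHat ⋙ SuperMod.tensorFunctor d lam).obj V) :=
      have : FiniteDimensional ℂ ((SuperMod.restrict d.aToHat).obj V.obj).carrier := V.property.1
      ⟨SuperMod.jet_tensorObj ((SuperMod.restrict d.aToHat).obj V.obj) lam,
        ((SuperMod.isSimple_restrict_iff d.aToHat_surjective _).2 V.property.2).tensorObj lam⟩
    let F := (SuperMod.simpleJet d lam).lift ((SuperMod.simpleFinDim d.hat).ι ⋙
      SuperMod.restrict d.aToHat ⋙ SuperMod.tensorFunctor.{u} d lam) hjet
    have : F.EssSurj := ⟨fun V => by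
      obtain ⟨V, hV, hsimple⟩ := V
      have hfin := SuperMod.finiteDimensional_fibre hV
      have hU : (SuperMod.fibre hV).IsSimple :=
        (hsimple.of_iso (SuperMod.tensorFibreIso hV).symm).of_tensorObj
      have hann := hU.isAnnihilatedBy_one x hβ hβ1
      have e := (SuperMod.fibre hV).restrictToHatIso hann
      refine ⟨⟨(SuperMod.fibre hV).toHat hann, hfin,
        (SuperMod.isSimple_restrict_iff d.aToHat_surjective _).1 (hU.of_iso e)⟩,
        ⟨(SuperMod.simpleJet d lam).isoMk
          ((SuperMod.tensorFunctor d lam).mapIso e.symm ≪≫ SuperMod.tensorFibreIso hV)⟩⟩⟩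
    have : F.IsEquivalence := {}
    exact ⟨F.asEquivalence, ⟨(SuperMod.simpleJet d lam).liftCompιIso _ _⟩⟩
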